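/- \textbf{Setting.} Let $V$ be an $n$-dimensional Euclidean space with a basis $\Delta=\{\alpha_s : s\in S\}$, identify $s\in S$ with the orthogonal reflection in $\alpha_s^{\perp}$, and let $W$ be the group generated by $S$. Assume that $W$ is finite and that $\Delta$ is a simple system of a reduced root system: with $\Phi=\{w(\alpha_s)\}_{w\in W,\,s\in S}$, the only multiples of a root $\beta$ in $\Phi$ are $\pm\beta$, and every root is a linear combination of $\Delta$ with all coefficients $\ge 0$ (these roots form $\Phi^+$) or all $\le 0$. The fundamental weights $\nabla=\{\omega_s : s\in S\}$ are given by $\langle\alpha_s,\omega_t\rangle=\delta_{st}\langle\alpha_s,\alpha_s\rangle/2$; put $q=\sum_{s}\omega_s$. The fundamental chamber is $C=\{x : \langle\alpha_s,x\rangle\ge 0\ \forall s\}$; chambers are the closures of the connected components of the complement of the hyperplanes $\beta^\perp$, $\beta\in\Phi$. The polar of a cone $K$ is $K^\circ=\{x : \langle x,y\rangle\le 0\ \forall y\in K\}$. A set $U\subseteq\Phi$ is separable if a linear hyperplane strictly separates $U$ from $\Phi\setminus U$. Let $c$ be a Coxeter element (the product of all simple reflections in some order), $\mathsf c$ a reduced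 expression of $c$, $w_\circ$ the longest element of $W$, and $\mathsf w_\circ(\mathsf c)=\mathsf w_1\cdots \mathsf w_N$ the $\mathsf c$-sorting word of $w_\circ$, that is, the reduced expression of $w_\circ$ which is the lexicographically first (as a sequence of positions) among the subwords of $\mathsf c\mathsf c\mathsf c\cdots$. Put $\mathsf Q=\mathsf c\,\mathsf w_\circ(\mathsf c)=\mathsf q_1\cdots \mathsf q_m$. A facet is a set $I\subseteq[m]$ of positions such that the letters of $\mathsf Q$ at the positions outside $I$ form a reduced expression of $w_\circ$. For a facet $I$ and $k\in[m]$ let $\sigma$ be the product, in order, of the $q_j$ with $j<k$, $j\notin I$, and set $\mathsf r(I,k)=\sigma(\alpha_{q_k})$, $\mathsf w(I,k)=\sigma(\omega_{q_k})$. Let $\mathsf R(I)$ be the multiset of the $\mathsf r(I,i)$, $i\in I$, let $\mathsf W(I)$ be the set of the $\mathsf w(I,i)$, $i\in I$, and let $\mathsf B(I)=\sum_{k\in[m]}\mathsf w(I,k)$. The brick polytope $\mathcal B(\mathsf Q)$ is the convex hull of the $\mathsf B(J)$, $J$ a facet. Let $\mathsf C(I)$ be the cone generated by the $\mathsf B(J)-\mathsf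 B(I)$, $J$ a facet, and let $\mathsf N(I)$ be the normal cone of $\mathsf B(I)$ in $\mathcal B(\mathsf Q)$, i.e. the set of $v$ such that $\langle\cdot,v\rangle$ is maximized over $\mathcal B(\mathsf Q)$ at $\mathsf B(I)$. Let $\Omega=\sum_{p=1}^N w_1\cdots w_{p-1}(\omega_{w_p})$. Two words on $S$ are \emph{equal up to commutations} if one is obtained from the other by successively exchanging consecutive letters that commute in $W$. \textbf{Proposition.} For every $w\in W$ there is a unique facet $\kappa(w)$ with $\mathsf R(\kappa(w))\subseteq w(\Phi^+)$, and for every $w\in W$ the following are equivalent: \begin{enumerate} \item $w$ is a singleton for $\kappa$, i.e. $\kappa^{-1}(\kappa(w))=\{w\}$; \item $\mathsf R(\kappa(w))=w(\Delta)$ (as multisets); \item $\mathsf R(\kappa(w))$ is a simple system for $W$: it has no repeated element and is the set of extremal roots of a separable subset $U$ of $\Phi$, i.e. of the roots in $U$ that span an extremal ray of the cone generated by $U$; \item $\mathsf C(\kappa(w))=w(C)^\circ$ and $\mathsf C(\kappa(w))=w(C^\circ)$; \item $\mathsf W(\kappa(w))=w(\nabla)$; \item the cone generated by $\mathsf W(\kappa(w))$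 is a chamber; \item $\mathsf N(\kappa(w))=w(C)$; \item $\mathsf B(\kappa(w))=\Omega+w(q)$; \item there are a reduced expression $\mathsf w$ of $w$ and a reduced expression $\mathsf c'$ of $c$ such that $\mathsf w$ is, up to commutations, a prefix of $\mathsf w_\circ(\mathsf c')$, i.e. $\mathsf w$ is a prefix of some word that equals $\mathsf w_\circ(\mathsf c')$ up to commutations; \item the complement of $\kappa(w)$ in $\mathsf Q$, read as a word, equals $\mathsf w_\circ(\mathsf c)$ up to commutations. \end{enumerate} -/

import Mathlib

open scoped RealInnerProductSpace

noncomputable section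

namespace BrickPolytope

variable {S V : Type*} [Fintype S] [DecidableEq S] [NormedAddCommGroup V] [InnerProductSpace ℝ V]

/-! ### Finite reflection groups, roots and weights

A basis `α` of the euclidean space `V`, indexed by `S`, is the family of simple roots. -/

/-- The simple reflection `s`, i.e. the orthogonal reflection in the hyperplane `(α s)^⊥`. -/
def simpleReflection (α : Module.Basis S ℝ V) (s : S) : V ≃ₗᵢ[ℝ] V :=
  (ℝ ∙ α s)ᗮ.reflection

/-- The group `W` generated by the simple reflections. -/
def reflectionGroup (α : Module.Basis S ℝ V) : Subgroup (V ≃ₗᵢ[ℝ] V) :=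
  Subgroup.closure (Set.range (simpleReflection α))

/-- The set `Φ` of roots: the orbit of the simple roots under `W`. -/
def roots (α : Module.Basis S ℝ V) : Set V :=
  {β | ∃ w ∈ reflectionGroup α, ∃ s : S, β = w (α s)}

/-- `α` is a simple system (of a reduced root system) for a finite essential reflection group:
the group `W` is finite, the only roots on the line of a root `β` are `β` and `-β`,
and every root is a combination of simple roots with all coefficients of the same sign
(equivalently, no reflecting hyperplane cuts the open simplicial cone dual to the simple roots,
so that this cone is an open chamber). -/
structure IsSimpleSystem (α : Module.Basis S ℝ V) : Prop where
  finite : (reflectionGroup α : Set (V ≃ₗᵢ[ℝ] V)).Finite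
  reduced : ∀ β ∈ roots α, ∀ a : ℝ, a • β ∈ roots α → a = 1 ∨ a = -1
  nonneg_or_nonpos : ∀ β ∈ roots α, (∀ s, 0 ≤ α.repr β s) ∨ (∀ s, α.repr β s ≤ 0)

/-- The set `Φ⁺` of positive roots. -/
def posRoots (α : Module.Basis S ℝ V) : Set V :=
  {β | β ∈ roots α ∧ ∀ s, 0 ≤ α.repr β s}

theorem inner_nondegenerate : LinearMap.BilinForm.Nondegenerate (innerₗ V) := by
  constructor
  · intro x hx
    have h := hx x
    simpa using h
  · intro x hx
    have h := hx x
    simpa using h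

/-- The fundamental weights: the basis dual to the basis `2 α_s / ⟪α_s, α_s⟫`. -/
def weight (α : Module.Basis S ℝ V) (t : S) : V :=
  (⟪α t, α t⟫ / 2) • LinearMap.BilinForm.dualBasis (innerₗ V) inner_nondegenerate α t

theorem inner_root_weight (α : Module.Basis S ℝ V) (s t : S) :
    ⟪α s, weight α t⟫ = if s = t then ⟪α s, α s⟫ / 2 else 0 := by
  have h := LinearMap.BilinForm.apply_dualBasis_left (B := innerₗ V) inner_nondegenerate α t s
  rw [innerₗ_apply_apply] at h
  rw [real_inner_comm] at h
  rw [weight, real_inner_smul_right, h]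
  split_ifs with hst
  · subst hst; simp
  · simp

/-- The point `q`, the sum of all fundamental weights. -/
def balancedPoint (α : Module.Basis S ℝ V) : V := ∑ s, weight α s

/-- The fundamental chamber. -/
def fundamentalChamber (α : Module.Basis S ℝ V) : Set V := {x | ∀ s, 0 ≤ ⟪α s, x⟫}

/-- The complement of the Coxeter arrangement. -/
def arrangementComplement (α : Module.Basis S ℝ V) : Set V := {x | ∀ β ∈ roots α, ⟪β, x⟫ ≠ 0}

/-- Chambers are the closures of the connected components of the complement of the arrangement. -/
def IsChamber (α : Module.Basis S ℝ V) (K : Set V) : Prop :=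
  ∃ x ∈ arrangementComplement α, K = closure (connectedComponentIn (arrangementComplement α) x)

/-- A set of roots is separable if a linear hyperplane separates it from the other roots. -/
def IsSeparableRootSet (α : Module.Basis S ℝ V) (U : Set V) : Prop :=
  U ⊆ roots α ∧ ∃ f : V →ₗ[ℝ] ℝ, (∀ β ∈ U, 0 < f β) ∧ ∀ β ∈ roots α, β ∉ U → f β < 0

/-- The closed convex cone with apex `0` generated by a set of vectors. -/
def cone (X : Set V) : Set V := (PointedCone.hull ℝ X : Set V)

/-- The extremal elements of a set `U` of roots: those that span an extremal ray of the cone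
generated by `U`, i.e. that are not non-negative combinations of the other elements of `U`. -/
def extremalRoots (U : Set V) : Set V := {β | β ∈ U ∧ β ∉ cone (U \ {β})}

/-- The polar cone. -/
def polarCone (K : Set V) : Set V := {x | ∀ y ∈ K, ⟪x, y⟫ ≤ 0}

/-! ### Words -/

/-- The element of `W` expressed by a word on `S`. -/
def wordProd (α : Module.Basis S ℝ V) (l : List S) : V ≃ₗᵢ[ℝ] V :=
  (l.map (simpleReflection α)).prod

/-- The length of an element of `W`. -/
def length (α : Module.Basis S ℝ V) (w : V ≃ₗᵢ[ℝ] V) : ℕ :=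
  sInf {n | ∃ l : List S, l.length = n ∧ wordProd α l = w}

/-- The word `l` is a reduced expression of `w`. -/
def IsReducedExpr (α : Module.Basis S ℝ V) (l : List S) (w : V ≃ₗᵢ[ℝ] V) : Prop :=
  wordProd α l = w ∧ l.length = length α w

/-- `w₀` is the longest element of `W`. -/
def IsLongest (α : Module.Basis S ℝ V) (w₀ : V ≃ₗᵢ[ℝ] V) : Prop :=
  w₀ ∈ reflectionGroup α ∧ ∀ w ∈ reflectionGroup α, length α w ≤ length α w₀

/-- `c` is a Coxeter element: the product of all simple reflections in some order. -/
def IsCoxeterElement (α : Module.Basis S ℝ V) (c : V ≃ₗᵢ[ℝ] V) : Prop :=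
  ∃ l : List S, l.Nodup ∧ (∀ s, s ∈ l) ∧ wordProd α l = c

/-- `P` is the (increasing) sequence of positions in the infinite word `c c c ⋯` of a subword `l`
that is a reduced expression of `w`. Positions are numbered from `0`. -/
def IsReducedSubword (α : Module.Basis S ℝ V) (c : List S) (w : V ≃ₗᵢ[ℝ] V)
    (P : List ℕ) (l : List S) : Prop :=
  P.Pairwise (· < ·) ∧ P.map (fun k => getElem? c (k % c.length)) = l.map some ∧ IsReducedExpr α l w

/-- `l` is the `c`-sorting word of `w`: the reduced subword for `w` of `c c c ⋯` whose sequence of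
positions is lexicographically first. -/
def IsSortingWord (α : Module.Basis S ℝ V) (c : List S) (w : V ≃ₗᵢ[ℝ] V) (l : List S) : Prop :=
  ∃ P, IsReducedSubword α c w P l ∧
    ∀ P' l', IsReducedSubword α c w P' l' → P = P' ∨ List.Lex (· < ·) P P'

/-- Exchanging two consecutive letters whose reflections commute. -/
inductive CommutationStep (α : Module.Basis S ℝ V) : List S → List S → Prop
  | swap (u v : List S) (s t : S)
      (h : simpleReflection α s * simpleReflection α t =
        simpleReflection α t * simpleReflection α s) :
      CommutationStep α (u ++ s :: t :: v) (u ++ t :: s :: v)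

/-- Two words are equal up to commutations of consecutive commuting letters. -/
def CommutationEquiv (α : Module.Basis S ℝ V) : List S → List S → Prop :=
  Relation.ReflTransGen (CommutationStep α)

/-! ### The subword complex, root and weight functions, and the brick polytope

Positions in the word `Q` are elements of `Fin Q.length`. -/

/-- The subword of `Q` formed by the letters at positions outside `I`. -/
def complementWord (Q : List S) (I : Finset (Fin Q.length)) : List S :=
  ((List.finRange Q.length).filter (fun k => k ∉ I)).map Q.get

/-- `I` is a facet of the subword complex of `Q`: its complement is a reduced expression of the
longest element. -/
def IsFacet (α : Module.Basis S ℝ V) (w₀ : V ≃ₗᵢ[ℝ] V) (Q : List S)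
    (I : Finset (Fin Q.length)) : Prop :=
  IsReducedExpr α (complementWord Q I) w₀

/-- The product, in order, of the letters of `Q` at the positions before `k` and outside `I`. -/
def prefixProd (α : Module.Basis S ℝ V) (Q : List S) (I : Finset (Fin Q.length))
    (k : Fin Q.length) : V ≃ₗᵢ[ℝ] V :=
  wordProd α (((List.finRange Q.length).filter (fun j => j < k ∧ j ∉ I)).map Q.get)

/-- The root function `r(I, k)`. -/
def rootFn (α : Module.Basis S ℝ V) (Q : List S) (I : Finset (Fin Q.length))
    (k : Fin Q.length) : V :=
  prefixProd α Q I k (α (Q.get k))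

/-- The weight function `w(I, k)`. -/
def weightFn (α : Module.Basis S ℝ V) (Q : List S) (I : Finset (Fin Q.length))
    (k : Fin Q.length) : V :=
  prefixProd α Q I k (weight α (Q.get k))

/-- The root configuration `R(I)`, a multiset. -/
def rootConfig (α : Module.Basis S ℝ V) (Q : List S) (I : Finset (Fin Q.length)) : Multiset V :=
  I.val.map (rootFn α Q I)

/-- The weight configuration `W(I)`, a set. -/
def weightConfig (α : Module.Basis S ℝ V) (Q : List S) (I : Finset (Fin Q.length)) : Set V :=
  {x | ∃ i ∈ I, x = weightFn α Q I i}

/-- The brick vector `B(I)`. -/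
def brickVector (α : Module.Basis S ℝ V) (Q : List S) (I : Finset (Fin Q.length)) : V :=
  ∑ k, weightFn α Q I k

/-- The brick polytope `B(Q)`. -/
def brickPolytope (α : Module.Basis S ℝ V) (w₀ : V ≃ₗᵢ[ℝ] V) (Q : List S) : Set V :=
  convexHull ℝ {x | ∃ I, IsFacet α w₀ Q I ∧ x = brickVector α Q I}

/-- The cone of the brick polytope at the brick vector of `I`. -/
def brickCone (α : Module.Basis S ℝ V) (w₀ : V ≃ₗᵢ[ℝ] V) (Q : List S)
    (I : Finset (Fin Q.length)) : Set V :=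
  cone {x | ∃ J, IsFacet α w₀ Q J ∧ x = brickVector α Q J - brickVector α Q I}

/-- The normal cone of the brick vector of `I` in the brick polytope. -/
def normalCone (α : Module.Basis S ℝ V) (w₀ : V ≃ₗᵢ[ℝ] V) (Q : List S)
    (I : Finset (Fin Q.length)) : Set V :=
  {v | ∀ x ∈ brickPolytope α w₀ Q, ⟪x, v⟫ ≤ ⟪brickVector α Q I, v⟫}

/-- `I` is a facet whose root configuration is contained in `w(Φ⁺)`. -/
def IsProjection (α : Module.Basis S ℝ V) (w₀ : V ≃ₗᵢ[ℝ] V) (Q : List S)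
    (w : reflectionGroup α) (I : Finset (Fin Q.length)) : Prop :=
  IsFacet α w₀ Q I ∧ ∀ β ∈ rootConfig α Q I, β ∈ (w : V ≃ₗᵢ[ℝ] V) '' posRoots α

/-- The map `κ`, sending `w` to the facet whose root configuration is contained in `w(Φ⁺)`. -/
def kappa (α : Module.Basis S ℝ V) (w₀ : V ≃ₗᵢ[ℝ] V) (Q : List S) (w : reflectionGroup α) :
    Finset (Fin Q.length) :=
  Classical.epsilon (IsProjection α w₀ Q w)

/-- The vector `Ω = ∑ₚ w₁ ⋯ wₚ₋₁ (ω_{wₚ})` attached to a word `w₁ ⋯ w_N`. -/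
def translation (α : Module.Basis S ℝ V) (l : List S) : V :=
  ∑ p : Fin l.length, wordProd α (l.take p) (weight α (l.get p))

end BrickPolytope

end

open BrickPolytope

set_option linter.unusedSectionVars false

namespace BrickPolytope

/-! ### Reflections, roots, reduced words and weights of a finite reflection group -/

section Basics

variable {S V : Type*} [Fintype S] [DecidableEq S] [NormedAddCommGroup V] [InnerProductSpace ℝ V]

/-! All ten statements are compared with one description of a facet, `IsSingletonFacet`: it contains
every letter once, its roots and weights are the images under `w` of the simple roots and of the
fundamental weights, its complement is the sorting word up to commutations, and its brick vector is
known.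

The map κ. A facet with positive roots can be recovered by reading `Q` from right to left
(`IsFacet.eq_of_forall_pos`), which settles uniqueness for `w = 1`. Passing from `w` to `ws`
exchanges the first and the last position with root `±w(α_s)` (`IsPositiveFacet.exists_toggle`), and
this exchange is invertible.

The Coxeter element. In a word whose adjacent letters alternate as prescribed by `c`, a prefix with
`k` letters `t` acts on `ω_t` as `c^k` (`AltFrom.wordProd_weight`), so the roots of the word are the
vectors `c^k(1 - c)ω_s`. If `m(s)` is the first exponent at which this root is negative, then
`c^{m(s)}ω_s` is the negative of a fundamental weight (`exists_pow_coxHeight_weight`). Hence the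
alternating words with `m(s)` letters `s` are reduced expressions of `w₀`; they all agree up to
commutations, and the sorting word is one of them. Deleting from `Q` the occurrence number `p(s)` of
each `s`, for alternating counts `p ≤ m`, gives a singleton facet, with `w(ω_s) = c^{p(s)}ω_s`
(`isSingletonFacet_occurrences`). Such `p` cut the sorting word into a prefix expressing `w` and a
rest.

Conversely, the weight of a position `j` is the same in all facets containing `j`, namely `c^k(ω_s)`
for its letter `s` with `k` earlier occurrences (`IsFacet.weightFn_spec`, by flips that fix `j`). If
the weights of a facet are the `w(ω_s)`, this yields exponents `p`, and positivity of roots forces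
`p` to alternate. The statements on roots, weights and brick vectors reduce to this case. For the
cones, a flip moves the brick vector by a negative multiple of the flipped root, and the normal cone
of a facet contains `w'(C)` for every `w'` that κ sends to it. -/

theorem isom_mul_apply (f g : V ≃ₗᵢ[ℝ] V) (x : V) : (f * g) x = f (g x) := rfl

theorem isom_one_apply (x : V) : (1 : V ≃ₗᵢ[ℝ] V) x = x := rfl

theorem isom_inv_apply_self (f : V ≃ₗᵢ[ℝ] V) (x : V) : f⁻¹ (f x) = x := f.symm_apply_apply x

theorem isom_apply_inv_self (f : V ≃ₗᵢ[ℝ] V) (x : V) : f (f⁻¹ x) = x := f.apply_symm_apply x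

theorem inner_isom_left (f : V ≃ₗᵢ[ℝ] V) (x y : V) : ⟪f x, y⟫ = ⟪x, f⁻¹ y⟫ :=
  LinearIsometryEquiv.inner_map_eq_flip f x y

/-- The orthogonal reflection in the hyperplane `β^⊥`. -/
noncomputable def rootReflection (β : V) : V ≃ₗᵢ[ℝ] V := (ℝ ∙ β)ᗮ.reflection

theorem rootReflection_apply (β x : V) :
    rootReflection β x = x - (2 * ⟪β, x⟫ / ⟪β, β⟫) • β := by
  rw [rootReflection, Submodule.reflection_orthogonal_apply, Submodule.reflection_singleton_apply,
    real_inner_self_eq_norm_sq, two_smul, mul_div_assoc, two_mul, add_smul]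
  simp

theorem rootReflection_mul_self (β : V) : rootReflection β * rootReflection β = 1 :=
  Submodule.reflection_mul_reflection _

theorem rootReflection_apply_apply (β x : V) : rootReflection β (rootReflection β x) = x := by
  rw [← isom_mul_apply, rootReflection_mul_self, isom_one_apply]

theorem rootReflection_self (β : V) : rootReflection β β = -β :=
  Submodule.reflection_orthogonalComplement_singleton_eq_neg β

theorem rootReflection_neg (β : V) : rootReflection (-β) = rootReflection β := by
  ext x
  simp [rootReflection_apply, neg_div]

theorem rootReflection_of_inner_eq_zero {β x : V} (h : ⟪β, x⟫ = 0) : rootReflection β x = x := by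
  simp [rootReflection_apply, h]

theorem rootReflection_map (w : V ≃ₗᵢ[ℝ] V) (β : V) :
    rootReflection (w β) = w * rootReflection β * w⁻¹ := by
  ext x
  simp only [isom_mul_apply, rootReflection_apply, map_sub, map_smul, isom_apply_inv_self,
    LinearIsometryEquiv.inner_map_map, inner_isom_left]

variable {α : Module.Basis S ℝ V}

theorem simpleReflection_eq (α : Module.Basis S ℝ V) (s : S) :
    simpleReflection α s = rootReflection (α s) := rfl

theorem simpleReflection_mul_self (s : S) : simpleReflection α s * simpleReflection α s = 1 :=
  rootReflection_mul_self _

theorem simpleReflection_apply_apply (s : S) (x : V) :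
    simpleReflection α s (simpleReflection α s x) = x := rootReflection_apply_apply _ _

theorem simpleReflection_self (s : S) : simpleReflection α s (α s) = -α s := rootReflection_self _

theorem simpleReflection_inv (s : S) : (simpleReflection α s)⁻¹ = simpleReflection α s :=
  inv_eq_of_mul_eq_one_left (simpleReflection_mul_self s)

theorem simpleReflection_mem (α : Module.Basis S ℝ V) (s : S) :
    simpleReflection α s ∈ reflectionGroup α :=
  Subgroup.subset_closure ⟨s, rfl⟩

theorem mul_simpleReflection (w : V ≃ₗᵢ[ℝ] V) (s : S) :
    w * simpleReflection α s = rootReflection (w (α s)) * w := by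
  rw [rootReflection_map, simpleReflection_eq]; group

theorem inner_simple_self_pos (α : Module.Basis S ℝ V) (s : S) : 0 < ⟪α s, α s⟫ :=
  real_inner_self_pos.2 (α.ne_zero s)

theorem apply_mem_roots {w : V ≃ₗᵢ[ℝ] V} (hw : w ∈ reflectionGroup α) {β : V}
    (hβ : β ∈ roots α) : w β ∈ roots α := by
  obtain ⟨v, hv, s, rfl⟩ := hβ
  exact ⟨w * v, mul_mem hw hv, s, rfl⟩

theorem simple_mem_roots (α : Module.Basis S ℝ V) (s : S) : α s ∈ roots α :=
  ⟨1, one_mem _, s, rfl⟩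

theorem neg_mem_roots {β : V} (hβ : β ∈ roots α) : -β ∈ roots α := by
  obtain ⟨v, hv, s, rfl⟩ := hβ
  refine ⟨v * simpleReflection α s, mul_mem hv (simpleReflection_mem α s), s, ?_⟩
  rw [isom_mul_apply, simpleReflection_self, map_neg]

theorem ne_zero_of_mem_roots {β : V} (hβ : β ∈ roots α) : β ≠ 0 := by
  obtain ⟨v, hv, s, rfl⟩ := hβ
  simpa using α.ne_zero s

theorem simple_mem_posRoots (α : Module.Basis S ℝ V) (s : S) : α s ∈ posRoots α := by
  refine ⟨simple_mem_roots α s, fun t => ?_⟩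
  rw [Module.Basis.repr_self, Finsupp.single_apply]
  split_ifs <;> norm_num

theorem mem_posRoots_or_neg (hα : IsSimpleSystem α) {β : V} (hβ : β ∈ roots α) :
    β ∈ posRoots α ∨ -β ∈ posRoots α := by
  rcases hα.nonneg_or_nonpos β hβ with h | h
  · exact Or.inl ⟨hβ, h⟩
  · exact Or.inr ⟨neg_mem_roots hβ, fun s => by simpa using h s⟩

theorem neg_notMem_posRoots {β : V} (hβ : β ∈ posRoots α) : -β ∉ posRoots α := by
  intro h
  apply ne_zero_of_mem_roots hβ.1
  apply α.repr.injective
  ext s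
  have h1 := hβ.2 s
  have h2 := h.2 s
  simp only [map_neg, Finsupp.coe_neg, Pi.neg_apply] at h2
  simp only [map_zero, Finsupp.coe_zero, Pi.zero_apply]
  linarith

theorem notMem_posRoots_of_neg {β : V} (hβ : -β ∈ posRoots α) : β ∉ posRoots α :=
  fun h => neg_notMem_posRoots h hβ

theorem notMem_posRoots_iff (hα : IsSimpleSystem α) {β : V} (hβ : β ∈ roots α) :
    β ∉ posRoots α ↔ -β ∈ posRoots α :=
  ⟨fun h => (mem_posRoots_or_neg hα hβ).resolve_left h, notMem_posRoots_of_neg⟩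

theorem mem_posRoots_of_repr_pos (hα : IsSimpleSystem α) {β : V} (hβ : β ∈ roots α) {t : S}
    (h : 0 < α.repr β t) : β ∈ posRoots α := by
  rcases hα.nonneg_or_nonpos β hβ with h' | h'
  · exact ⟨hβ, h'⟩
  · exact absurd (h' t) (not_le.2 h)

theorem repr_simpleReflection_of_ne {s t : S} (h : t ≠ s) (x : V) :
    α.repr (simpleReflection α s x) t = α.repr x t := by
  rw [simpleReflection_eq, rootReflection_apply]
  simp [h.symm]

/-- The reflection changes only the coordinate at `s`. By reducedness, a positive root other than `α
s` has a positive coordinate elsewhere; it survives, and one positive coordinate decides the sign of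
a root. -/
theorem simpleReflection_mem_posRoots (hα : IsSimpleSystem α) {β : V} (hβ : β ∈ posRoots α)
    {s : S} (h : β ≠ α s) : simpleReflection α s β ∈ posRoots α := by
  have : ∃ t, t ≠ s ∧ α.repr β t ≠ 0 := by
    by_contra! hc
    have e : β = (α.repr β s) • α s := by
      apply α.repr.injective
      ext t
      by_cases hts : t = s
      · subst hts; simp
      · simp [hc t hts, Ne.symm hts]
    rcases hα.reduced (α s) (simple_mem_roots α s) (α.repr β s) (e ▸ hβ.1) with h1 | h1
    · rw [h1, one_smul] at e; exact h e
    · have := hβ.2 s; rw [h1] at this; norm_num at this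
  obtain ⟨t, ht, h0⟩ := this
  refine mem_posRoots_of_repr_pos hα (apply_mem_roots (simpleReflection_mem α s) hβ.1) (t := t) ?_
  rw [repr_simpleReflection_of_ne ht]
  exact lt_of_le_of_ne (hβ.2 t) h0.symm

theorem eq_simple_of_neg_simpleReflection (hα : IsSimpleSystem α) {β : V} (hβ : β ∈ posRoots α)
    {s : S} (h : -simpleReflection α s β ∈ posRoots α) : β = α s := by
  by_contra hne
  exact neg_notMem_posRoots (simpleReflection_mem_posRoots hα hβ hne) h

theorem inner_simple_nonpos (hα : IsSimpleSystem α) {s t : S} (h : s ≠ t) : ⟪α s, α t⟫ ≤ 0 := by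
  have h1 : simpleReflection α s (α t) ∈ posRoots α :=
    simpleReflection_mem_posRoots hα (simple_mem_posRoots α t) (fun e => h (α.injective e).symm)
  have h2 := h1.2 s
  rw [simpleReflection_eq, rootReflection_apply] at h2
  simp only [map_sub, map_smul, Module.Basis.repr_self, Finsupp.smul_single, Finsupp.coe_sub,
    Pi.sub_apply, Finsupp.single_apply, h.symm, if_true, if_false, smul_eq_mul, mul_one] at h2
  by_contra! h3
  have := div_pos (mul_pos two_pos h3) (inner_simple_self_pos α s)
  linarith

theorem repr_map_nonneg {w : V ≃ₗᵢ[ℝ] V} {t : S} (hw : ∀ s, 0 ≤ α.repr (w (α s)) t) {x : V}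
    (hx : ∀ s, 0 ≤ α.repr x s) : 0 ≤ α.repr (w x) t := by
  conv_rhs => rw [← α.sum_repr x]
  simp only [map_sum, map_smul, Finsupp.coe_finsetSum, Finset.sum_apply, Finsupp.coe_smul,
    Pi.smul_apply, smul_eq_mul]
  exact Finset.sum_nonneg fun s _ => mul_nonneg (hx s) (hw s)

/-! ### Words and lengths -/

@[simp] theorem wordProd_nil (α : Module.Basis S ℝ V) : wordProd α [] = 1 := rfl

@[simp] theorem wordProd_cons (s : S) (l : List S) :
    wordProd α (s :: l) = simpleReflection α s * wordProd α l := by simp [wordProd]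

theorem wordProd_append (u v : List S) :
    wordProd α (u ++ v) = wordProd α u * wordProd α v := by simp [wordProd]

theorem wordProd_concat (u : List S) (s : S) :
    wordProd α (u ++ [s]) = wordProd α u * simpleReflection α s := by
  simp [wordProd_append]

theorem wordProd_mem (α : Module.Basis S ℝ V) (l : List S) : wordProd α l ∈ reflectionGroup α := by
  induction l with
  | nil => exact one_mem _
  | cons s l ih => rw [wordProd_cons]; exact mul_mem (simpleReflection_mem α s) ih

theorem exists_wordProd {w : V ≃ₗᵢ[ℝ] V} (hw : w ∈ reflectionGroup α) :
    ∃ l, wordProd α l = w := by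
  induction hw using Subgroup.closure_induction_right with
  | one => exact ⟨[], rfl⟩
  | mul_right x _ y hy ih =>
    obtain ⟨l, rfl⟩ := ih
    obtain ⟨s, rfl⟩ := hy
    exact ⟨l ++ [s], wordProd_concat l s⟩
  | mul_inv_cancel x _ y hy ih =>
    obtain ⟨l, rfl⟩ := ih
    obtain ⟨s, rfl⟩ := hy
    exact ⟨l ++ [s], by rw [wordProd_concat, simpleReflection_inv]⟩

/-- All the roots `s₁ ⋯ sₖ₋₁ (α_{sₖ})` of the word are positive. -/
def IsPosWord (α : Module.Basis S ℝ V) (l : List S) : Prop :=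
  ∀ u s v, l = u ++ s :: v → wordProd α u (α s) ∈ posRoots α

theorem IsPosWord.of_append {u v : List S} (h : IsPosWord α (u ++ v)) : IsPosWord α u := by
  intro x s y hxy
  exact h x s (y ++ v) (by simp [hxy])

theorem isPosWord_concat {u : List S} {s : S} :
    IsPosWord α (u ++ [s]) ↔ IsPosWord α u ∧ wordProd α u (α s) ∈ posRoots α := by
  refine ⟨fun h => ⟨h.of_append, h u s [] (by simp)⟩, fun ⟨h1, h2⟩ x t y hxy => ?_⟩
  rcases List.eq_nil_or_concat y with rfl | ⟨y', b, rfl⟩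
  · obtain ⟨rfl, h⟩ := List.append_inj' hxy rfl
    simp only [List.cons.injEq, and_true] at h
    exact h ▸ h2
  · have : u ++ [s] = (x ++ t :: y') ++ [b] := by simpa using hxy
    exact h1 x t y' (List.append_inj' this rfl).1

/-- Deletion property: when the letters of `u` are applied to `α s` from the right, the letter `t`
at which the root turns negative meets exactly `α t`. Deleting that letter amounts to multiplying by
`s`. -/
theorem exists_shorter_word (hα : IsSimpleSystem α) {s : S} (u : List S)
    (h : -wordProd α u (α s) ∈ posRoots α) :
    ∃ u' : List S, u'.length + 1 = u.length ∧
      wordProd α u' = wordProd α u * simpleReflection α s := by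
  induction u with
  | nil => exact absurd h (neg_notMem_posRoots (simple_mem_posRoots α s))
  | cons t u ih =>
    rcases mem_posRoots_or_neg hα
      (apply_mem_roots (wordProd_mem α u) (simple_mem_roots α s)) with h1 | h1
    · have e := eq_simple_of_neg_simpleReflection hα h1
        (by simpa [isom_mul_apply] using h)
      refine ⟨u, rfl, ?_⟩
      rw [wordProd_cons, mul_assoc, mul_simpleReflection, e, ← simpleReflection_eq, ← mul_assoc,
        simpleReflection_mul_self, one_mul]
    · obtain ⟨u', h2, h3⟩ := ih h1
      exact ⟨t :: u', by simp [h2], by rw [wordProd_cons, h3, wordProd_cons, mul_assoc]⟩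

theorem length_wordProd_le (l : List S) : length α (wordProd α l) ≤ l.length :=
  Nat.sInf_le ⟨l, rfl, rfl⟩

theorem exists_reducedExpr {w : V ≃ₗᵢ[ℝ] V} (hw : w ∈ reflectionGroup α) :
    ∃ l, IsReducedExpr α l w := by
  obtain ⟨l₀, h₀⟩ := exists_wordProd hw
  obtain ⟨l, h1, h2⟩ := Nat.sInf_mem (s := {n | ∃ l : List S, l.length = n ∧ wordProd α l = w})
    ⟨_, l₀, rfl, h₀⟩
  exact ⟨l, h2, h1⟩

theorem IsReducedExpr.isPosWord (hα : IsSimpleSystem α) {l : List S} {w : V ≃ₗᵢ[ℝ] V}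
    (h : IsReducedExpr α l w) : IsPosWord α l := by
  intro u s v hl
  rcases mem_posRoots_or_neg hα
    (apply_mem_roots (wordProd_mem α u) (simple_mem_roots α s)) with h1 | h1
  · exact h1
  · obtain ⟨u', h2, h3⟩ := exists_shorter_word hα u h1
    have h4 : wordProd α (u' ++ v) = w := by
      rw [← h.1, hl, wordProd_append, h3, wordProd_append, wordProd_cons, mul_assoc]
    have h5 := length_wordProd_le (α := α) (u' ++ v)
    rw [h4, ← h.2, hl] at h5
    simp at h5
    omega

theorem finite_roots (hα : IsSimpleSystem α) : (roots α).Finite := by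
  have : roots α ⊆ (fun p : (V ≃ₗᵢ[ℝ] V) × S => p.1 (α p.2)) ''
      ((reflectionGroup α : Set (V ≃ₗᵢ[ℝ] V)) ×ˢ Set.univ) := by
    rintro β ⟨w, hw, s, rfl⟩
    exact ⟨(w, s), ⟨hw, trivial⟩, rfl⟩
  exact ((hα.finite.prod Set.finite_univ).image _).subset this

/-- The inversions of `w`: the positive roots made negative by `w⁻¹`. -/
def inversions (α : Module.Basis S ℝ V) (w : V ≃ₗᵢ[ℝ] V) : Set V :=
  {β | β ∈ posRoots α ∧ -(w⁻¹ β) ∈ posRoots α}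

theorem finite_inversions (hα : IsSimpleSystem α) (w : V ≃ₗᵢ[ℝ] V) : (inversions α w).Finite :=
  (finite_roots hα).subset fun _ h => h.1.1

theorem mul_simpleReflection_inv_apply (w : V ≃ₗᵢ[ℝ] V) (s : S) (x : V) :
    (w * simpleReflection α s)⁻¹ x = simpleReflection α s (w⁻¹ x) := by
  rw [mul_inv_rev, simpleReflection_inv, isom_mul_apply]

theorem inversions_mul_subset (hα : IsSimpleSystem α) {w : V ≃ₗᵢ[ℝ] V}
    (hw : w ∈ reflectionGroup α) (s : S) :
    inversions α (w * simpleReflection α s) ⊆ insert (w (α s)) (inversions α w) := by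
  rintro β ⟨h1, h2⟩
  rw [mul_simpleReflection_inv_apply] at h2
  rcases mem_posRoots_or_neg hα (apply_mem_roots (inv_mem hw) h1.1) with h3 | h3
  · left
    rw [← eq_simple_of_neg_simpleReflection hα h3 h2, isom_apply_inv_self]
  · exact Or.inr ⟨h1, h3⟩

theorem inversions_mul_of_pos (hα : IsSimpleSystem α) {w : V ≃ₗᵢ[ℝ] V}
    (hw : w ∈ reflectionGroup α) {s : S} (h : w (α s) ∈ posRoots α) :
    inversions α (w * simpleReflection α s) = insert (w (α s)) (inversions α w) := by
  refine (inversions_mul_subset hα hw s).antisymm (Set.insert_subset ?_ ?_)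
  · refine ⟨h, ?_⟩
    rw [mul_simpleReflection_inv_apply, isom_inv_apply_self, simpleReflection_self, neg_neg]
    exact simple_mem_posRoots α s
  · rintro β ⟨h1, h2⟩
    refine ⟨h1, ?_⟩
    rw [mul_simpleReflection_inv_apply, ← map_neg]
    refine simpleReflection_mem_posRoots hα h2 fun e => ?_
    have : -β = w (α s) := by rw [← e, map_neg, isom_apply_inv_self]
    exact neg_notMem_posRoots h1 (this ▸ h)

theorem ncard_inversions_wordProd_le (hα : IsSimpleSystem α) (l : List S) :
    (inversions α (wordProd α l)).ncard ≤ l.length := by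
  induction l using List.reverseRecOn with
  | nil =>
    have : inversions α (wordProd α []) = ∅ := by
      ext β
      simp only [inversions, Set.mem_ofPred_eq, Set.mem_empty_iff_false, iff_false, not_and]
      exact fun h => neg_notMem_posRoots h
    rw [this]; simp
  | append_singleton l s ih =>
    rw [wordProd_concat]
    have := Set.ncard_le_ncard (inversions_mul_subset hα (wordProd_mem α l) s)
      ((finite_inversions hα _).insert _)
    have h2 := Set.ncard_insert_le (wordProd α l (α s)) (inversions α (wordProd α l))
    simp only [List.length_append, List.length_singleton]
    omega

theorem IsPosWord.ncard_inversions (hα : IsSimpleSystem α) {l : List S} (h : IsPosWord α l) :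
    (inversions α (wordProd α l)).ncard = l.length := by
  induction l using List.reverseRecOn with
  | nil => exact Nat.le_zero.1 (ncard_inversions_wordProd_le hα [])
  | append_singleton l s ih =>
    obtain ⟨h1, h2⟩ := isPosWord_concat.1 h
    rw [wordProd_concat, inversions_mul_of_pos hα (wordProd_mem α l) h2,
      Set.ncard_insert_of_notMem _ (finite_inversions hα _), ih h1]
    · simp
    · rintro ⟨_, h3⟩
      rw [isom_inv_apply_self] at h3
      exact neg_notMem_posRoots (simple_mem_posRoots α s) h3

/-- A word has at least as many letters as its product has inversions, and a positive word has
exactly as many. -/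
theorem IsPosWord.isReducedExpr (hα : IsSimpleSystem α) {l : List S} (h : IsPosWord α l) :
    IsReducedExpr α l (wordProd α l) := by
  refine ⟨rfl, le_antisymm ?_ (length_wordProd_le l)⟩
  obtain ⟨l', h1, h2⟩ := exists_reducedExpr (wordProd_mem α l)
  rw [← h2, ← h.ncard_inversions hα, ← h1]
  exact ncard_inversions_wordProd_le hα l'

theorem eq_one_of_forall_pos (hα : IsSimpleSystem α) {w : V ≃ₗᵢ[ℝ] V} (hw : w ∈ reflectionGroup α)
    (h : ∀ s, w (α s) ∈ posRoots α) : w = 1 := by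
  obtain ⟨l, hl⟩ := exists_reducedExpr hw
  have hp := hl.isPosWord hα
  rcases List.eq_nil_or_concat l with rfl | ⟨l', s, rfl⟩
  · exact hl.1.symm
  · rw [List.concat_eq_append] at hl hp
    have h1 := (isPosWord_concat.1 hp).2
    have h2 := h s
    rw [← hl.1, wordProd_concat, isom_mul_apply, simpleReflection_self, map_neg] at h2
    exact absurd h2 (neg_notMem_posRoots h1)

theorem eq_of_forall_mem_image (hα : IsSimpleSystem α) {w w' : V ≃ₗᵢ[ℝ] V}
    (hw : w ∈ reflectionGroup α) (hw' : w' ∈ reflectionGroup α)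
    (h : ∀ s, w' (α s) ∈ w '' posRoots α) : w' = w := by
  have : w⁻¹ * w' = 1 := by
    refine eq_one_of_forall_pos hα (mul_mem (inv_mem hw) hw') fun s => ?_
    obtain ⟨β, hβ, e⟩ := h s
    rw [isom_mul_apply, ← e, isom_inv_apply_self]
    exact hβ
  exact (inv_mul_eq_one.1 this).symm

theorem IsLongest.neg_simple (hα : IsSimpleSystem α) {w₀ : V ≃ₗᵢ[ℝ] V} (h : IsLongest α w₀)
    (s : S) : -w₀ (α s) ∈ posRoots α := by
  refine (mem_posRoots_or_neg hα (apply_mem_roots h.1 (simple_mem_roots α s))).resolve_left ?_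
  intro h1
  obtain ⟨l, hl⟩ := exists_reducedExpr h.1
  have h2 : IsPosWord α (l ++ [s]) := isPosWord_concat.2 ⟨hl.isPosWord hα, by rwa [hl.1]⟩
  have h3 := (h2.isReducedExpr hα).2
  have h4 := h.2 _ (wordProd_mem α (l ++ [s]))
  rw [← h3, ← hl.2] at h4
  simp at h4

theorem IsLongest.neg_apply (hα : IsSimpleSystem α) {w₀ : V ≃ₗᵢ[ℝ] V} (h : IsLongest α w₀)
    {β : V} (hβ : β ∈ posRoots α) : -w₀ β ∈ posRoots α := by
  refine ⟨neg_mem_roots (apply_mem_roots h.1 hβ.1), fun t => ?_⟩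
  -- The isometry `-w₀` sends the simple roots to nonnegative combinations, hence every positive
  -- root as well.
  have := repr_map_nonneg (α := α) (w := w₀ * LinearIsometryEquiv.neg ℝ) (t := t) (x := β)
    (fun s => by simpa [isom_mul_apply] using (h.neg_simple hα s).2 t) hβ.2
  simpa [isom_mul_apply] using this

theorem IsLongest.eq_of_neg (hα : IsSimpleSystem α) {w₀ w : V ≃ₗᵢ[ℝ] V} (h : IsLongest α w₀)
    (hw : w ∈ reflectionGroup α) (hneg : ∀ s, -w (α s) ∈ posRoots α) : w = w₀ := by
  refine eq_of_forall_mem_image hα h.1 hw fun s => ?_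
  refine ⟨w₀⁻¹ (w (α s)), ?_, isom_apply_inv_self _ _⟩
  refine (mem_posRoots_or_neg hα (apply_mem_roots (inv_mem h.1)
    (apply_mem_roots hw (simple_mem_roots α s)))).resolve_right fun h1 => ?_
  have h2 := h.neg_apply hα h1
  rw [map_neg, neg_neg, isom_apply_inv_self] at h2
  exact neg_notMem_posRoots h2 (hneg s)

theorem IsLongest.isReducedExpr (hα : IsSimpleSystem α) {w₀ : V ≃ₗᵢ[ℝ] V} (h : IsLongest α w₀)
    {l : List S} (hl : IsPosWord α l) (hneg : ∀ s, -wordProd α l (α s) ∈ posRoots α) :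
    IsReducedExpr α l w₀ :=
  h.eq_of_neg hα (wordProd_mem α l) hneg ▸ hl.isReducedExpr hα

/-! ### Weights and dominant vectors -/

theorem inner_weight_eq_zero {s t : S} (h : s ≠ t) : ⟪α s, weight α t⟫ = 0 := by
  rw [inner_root_weight, if_neg h]

theorem inner_weight_self_pos (s : S) : 0 < ⟪α s, weight α s⟫ := by
  rw [inner_root_weight, if_pos rfl]; exact half_pos (inner_simple_self_pos α s)

theorem inner_weight_right (x : V) (t : S) :
    ⟪x, weight α t⟫ = α.repr x t * (⟪α t, α t⟫ / 2) := by
  conv_lhs => rw [← α.sum_repr x]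
  simp only [sum_inner, real_inner_smul_left, inner_root_weight]
  simp

theorem inner_weight_nonneg {x : V} (hx : ∀ s, 0 ≤ α.repr x s) (t : S) :
    0 ≤ ⟪x, weight α t⟫ := by
  rw [inner_weight_right]
  exact mul_nonneg (hx t) (half_pos (inner_simple_self_pos α t)).le

theorem inner_weight_pos_iff {x : V} {t : S} : 0 < ⟪x, weight α t⟫ ↔ 0 < α.repr x t := by
  rw [inner_weight_right, mul_pos_iff_of_pos_right (half_pos (inner_simple_self_pos α t))]

theorem eq_of_inner_simple_eq {x y : V} (h : ∀ s, ⟪α s, x⟫ = ⟪α s, y⟫) : x = y :=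
  InnerProductSpace.ext_inner_left_basis (𝕜 := ℝ) α h

theorem eq_sum_weight (α : Module.Basis S ℝ V) (x : V) :
    x = ∑ t, (2 * ⟪α t, x⟫ / ⟪α t, α t⟫) • weight α t := by
  refine eq_of_inner_simple_eq (α := α) fun s => ?_
  simp only [inner_sum, real_inner_smul_right, inner_root_weight]
  have := (inner_simple_self_pos α s).ne'
  rw [Finset.sum_eq_single s (fun t _ h => by simp [h.symm]) (by simp), if_pos rfl]
  field_simp

theorem simpleReflection_weight_of_ne {s t : S} (h : s ≠ t) :
    simpleReflection α s (weight α t) = weight α t :=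
  rootReflection_of_inner_eq_zero (inner_weight_eq_zero h)

theorem simpleReflection_weight_self (s : S) :
    simpleReflection α s (weight α s) = weight α s - α s := by
  have := (inner_simple_self_pos α s).ne'
  rw [simpleReflection_eq, rootReflection_apply, inner_root_weight, if_pos rfl]
  congr 1
  rw [mul_div_cancel₀ _ two_ne_zero, div_self this, one_smul]

theorem wordProd_weight_of_notMem {t : S} {l : List S} (h : t ∉ l) :
    wordProd α l (weight α t) = weight α t := by
  induction l with
  | nil => rfl
  | cons s l ih =>
    simp only [List.mem_cons, not_or] at h
    rw [wordProd_cons, isom_mul_apply, ih h.2, simpleReflection_weight_of_ne (Ne.symm h.1)]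

theorem weight_mem_chamber (α : Module.Basis S ℝ V) (t : S) : weight α t ∈ fundamentalChamber α := by
  intro s
  rw [inner_root_weight]
  have := inner_simple_self_pos α s
  split_ifs <;> positivity

theorem inner_balancedPoint (α : Module.Basis S ℝ V) (s : S) :
    ⟪α s, balancedPoint α⟫ = ⟪α s, α s⟫ / 2 := by
  simp [balancedPoint, inner_sum, inner_root_weight]

theorem inner_balancedPoint_right (x : V) :
    ⟪x, balancedPoint α⟫ = ∑ t, α.repr x t * (⟪α t, α t⟫ / 2) := by
  simp [balancedPoint, inner_sum, inner_weight_right]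

theorem eq_zero_of_inner_balancedPoint {x : V} (hx : ∀ s, 0 ≤ α.repr x s)
    (h : ⟪x, balancedPoint α⟫ ≤ 0) : x = 0 := by
  rw [inner_balancedPoint_right] at h
  have h0 : ∀ t ∈ Finset.univ, 0 ≤ α.repr x t * (⟪α t, α t⟫ / 2) := fun t _ =>
    mul_nonneg (hx t) (half_pos (inner_simple_self_pos α t)).le
  have h1 := (Finset.sum_eq_zero_iff_of_nonneg h0).1 (le_antisymm h (Finset.sum_nonneg h0))
  apply α.repr.injective
  ext t
  simpa [(half_pos (inner_simple_self_pos α t)).ne', α.ne_zero t] using h1 t (Finset.mem_univ t)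

theorem inner_nonneg_of_mem_chamber {x y : V} (hx : ∀ s, 0 ≤ α.repr x s)
    (hy : y ∈ fundamentalChamber α) : 0 ≤ ⟪x, y⟫ := by
  rw [← α.sum_repr x]
  simp only [sum_inner, real_inner_smul_left]
  exact Finset.sum_nonneg fun s _ => mul_nonneg (hx s) (hy s)

theorem inner_pos_of_posRoot {β y : V} (hβ : β ∈ posRoots α) (hy : ∀ s, 0 < ⟪α s, y⟫) :
    0 < ⟪β, y⟫ := by
  refine lt_of_le_of_ne (inner_nonneg_of_mem_chamber hβ.2 fun s => (hy s).le) fun h => ?_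
  apply ne_zero_of_mem_roots hβ.1
  rw [← α.sum_repr β] at h
  simp only [sum_inner, real_inner_smul_left] at h
  have h1 := (Finset.sum_eq_zero_iff_of_nonneg
    fun s _ => mul_nonneg (hβ.2 s) (hy s).le).1 h.symm
  apply α.repr.injective
  ext t
  simpa [(hy t).ne'] using h1 t (Finset.mem_univ t)

/-- Along a reduced word for `w`, each further letter subtracts a nonnegative multiple of a positive
root from the image of the dominant vector `x`. -/
theorem repr_sub_apply_nonneg (hα : IsSimpleSystem α) {x : V} (hx : x ∈ fundamentalChamber α)
    {w : V ≃ₗᵢ[ℝ] V} (hw : w ∈ reflectionGroup α) (t : S) : 0 ≤ α.repr (x - w x) t := by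
  obtain ⟨l, hl⟩ := exists_reducedExpr hw
  have hp := hl.isPosWord hα
  rw [← hl.1]
  clear hl
  induction l using List.reverseRecOn with
  | nil => simp [isom_one_apply]
  | append_singleton l s ih =>
    obtain ⟨h1, h2⟩ := isPosWord_concat.1 hp
    have e : x - wordProd α (l ++ [s]) x = (x - wordProd α l x) +
        (2 * ⟪α s, x⟫ / ⟪α s, α s⟫) • wordProd α l (α s) := by
      rw [wordProd_concat, isom_mul_apply, simpleReflection_eq, rootReflection_apply, map_sub,
        map_smul]
      abel
    rw [e, map_add, map_smul]
    have h3 := ih h1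
    have h4 := h2.2 t
    have h5 := inner_simple_self_pos α s
    have h6 := hx s
    simp only [Finsupp.coe_add, Pi.add_apply, Finsupp.coe_smul, Pi.smul_apply, smul_eq_mul]
    positivity

theorem apply_eq_of_inner_balancedPoint (hα : IsSimpleSystem α) {x : V}
    (hx : x ∈ fundamentalChamber α) {w : V ≃ₗᵢ[ℝ] V} (hw : w ∈ reflectionGroup α)
    (h : ⟪x, balancedPoint α⟫ ≤ ⟪w x, balancedPoint α⟫) : w x = x := by
  have := eq_zero_of_inner_balancedPoint (α := α) (repr_sub_apply_nonneg hα hx hw)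
    (by rw [inner_sub_left]; linarith)
  exact (sub_eq_zero.1 this).symm

/-- The chamber meets each orbit once: `x` and `w x` are both dominant, so each exceeds the other in
the dominance order, and pairing with `balancedPoint α` forces equality. -/
theorem apply_eq_of_mem_chamber (hα : IsSimpleSystem α) {x : V}
    (hx : x ∈ fundamentalChamber α) {w : V ≃ₗᵢ[ℝ] V} (hw : w ∈ reflectionGroup α)
    (h : w x ∈ fundamentalChamber α) : w x = x := by
  have h1 := repr_sub_apply_nonneg hα h (inv_mem hw)
  rw [isom_inv_apply_self] at h1
  refine apply_eq_of_inner_balancedPoint hα hx hw ?_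
  have := inner_nonneg_of_mem_chamber (y := balancedPoint α) h1 fun s => by
    rw [inner_balancedPoint]; exact (half_pos (inner_simple_self_pos α s)).le
  rw [inner_sub_left] at this
  linarith

/-- If a positive multiple of a weight is in the orbit of a weight, the weights agree. -/
theorem eq_of_apply_weight_eq_smul (hα : IsSimpleSystem α) {w : V ≃ₗᵢ[ℝ] V}
    (hw : w ∈ reflectionGroup α) {s t : S} {a : ℝ} (ha : 0 ≤ a)
    (h : w (weight α t) = a • weight α s) : t = s ∧ a = 1 := by
  have h1 := apply_eq_of_mem_chamber hα (weight_mem_chamber α t) hw (by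
    intro r
    rw [h, real_inner_smul_right]
    exact mul_nonneg ha (weight_mem_chamber α s r))
  rw [h] at h1
  have hts : t = s := by
    by_contra hne
    have h2 := inner_weight_self_pos (α := α) t
    rw [← h1, real_inner_smul_right, inner_weight_eq_zero hne, mul_zero] at h2
    exact lt_irrefl _ h2
  subst hts
  refine ⟨rfl, ?_⟩
  have h2 := congrArg (fun x => ⟪α t, x⟫) h1
  simp only [real_inner_smul_right] at h2
  exact (mul_eq_right₀ (inner_weight_self_pos t).ne').1 h2

theorem eq_of_apply_weight_eq (hα : IsSimpleSystem α) {w w' : V ≃ₗᵢ[ℝ] V}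
    (hw : w ∈ reflectionGroup α) (hw' : w' ∈ reflectionGroup α) {s t : S}
    (h : w (weight α t) = w' (weight α s)) : t = s := by
  refine (eq_of_apply_weight_eq_smul hα (mul_mem (inv_mem hw') hw) zero_le_one ?_).1
  rw [isom_mul_apply, h, isom_inv_apply_self, one_smul]

/-- Take `w` maximizing the pairing of `v` with `w(q)`. Since `s` sends `q` to `q - α s`, comparison
with `w s` gives the inequality at `s`. -/
theorem exists_apply_mem_chamber (hα : IsSimpleSystem α) (v : V) :
    ∃ w ∈ reflectionGroup α, ∀ s, 0 ≤ ⟪w (α s), v⟫ := by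
  obtain ⟨w, hw, hmax⟩ := Set.exists_max_image (reflectionGroup α : Set (V ≃ₗᵢ[ℝ] V))
    (fun w => ⟪w (balancedPoint α), v⟫) hα.finite ⟨1, one_mem _⟩
  refine ⟨w, hw, fun s => ?_⟩
  have h := hmax _ (mul_mem hw (simpleReflection_mem α s))
  have h5 := (inner_simple_self_pos α s).ne'
  simp only [isom_mul_apply] at h
  rw [simpleReflection_eq, rootReflection_apply, inner_balancedPoint, mul_div_cancel₀ _ two_ne_zero,
    div_self h5, one_smul, map_sub, inner_sub_left] at h
  linarith

end Basics

/-! ### Facets, flips, and the facet attached to each group element -/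

section Facets

variable {S V : Type*} [Fintype S] [DecidableEq S] [NormedAddCommGroup V] [InnerProductSpace ℝ V]
variable {α : Module.Basis S ℝ V} {Q : List S} {I J : Finset (Fin Q.length)} {w₀ : V ≃ₗᵢ[ℝ] V}

/-- The letters of `Q` before position `k` and outside `I`. -/
def prefixWord (Q : List S) (I : Finset (Fin Q.length)) (k : ℕ) : List S :=
  ((List.finRange Q.length).filter (fun j => j.val < k ∧ j ∉ I)).map Q.get

theorem prefixWord_zero : prefixWord Q I 0 = [] := by simp [prefixWord]

theorem prefixWord_succ (k : Fin Q.length) :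
    prefixWord Q I (k + 1) = prefixWord Q I k ++ if k ∈ I then [] else [Q.get k] := by
  have : (List.finRange Q.length).filter (fun j => j.val < k.val + 1 ∧ j ∉ I) =
      (List.finRange Q.length).filter (fun j => j.val < k.val ∧ j ∉ I) ++
        if k ∈ I then [] else [k] := by
    refine List.Pairwise.eq_of_mem_iff (r := (· < ·))
      ((List.pairwise_lt_finRange _).filter _) ?_ ?_
    · refine List.pairwise_append.2 ⟨(List.pairwise_lt_finRange _).filter _, ?_, ?_⟩
      · split_ifs <;> simp
      · intro a ha b hb
        simp only [List.mem_filter, List.mem_finRange, true_and, decide_eq_true_eq] at ha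
        split_ifs at hb with h
        · simp at hb
        · simp only [List.mem_singleton] at hb
          exact hb ▸ ha.1
    · intro a
      simp only [List.mem_filter, List.mem_finRange, true_and, decide_eq_true_eq, List.mem_append]
      split_ifs with h
      · simp only [List.not_mem_nil, or_false]
        refine and_congr_left fun ha => ?_
        have : a ≠ k := fun e => ha (e ▸ h)
        rw [Ne, Fin.ext_iff] at this
        omega
      · simp only [List.mem_singleton]
        by_cases e : a = k
        · subst e; simp [h]
        · have := e
          rw [Fin.ext_iff] at this
          simp only [e, or_false]
          refine and_congr_left fun _ => by omega
  rw [prefixWord, this, List.map_append, prefixWord]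
  split_ifs <;> simp

theorem prefixWord_length : prefixWord Q I Q.length = complementWord Q I := by
  simp [prefixWord, complementWord]

/-- The product of the letters of `Q` before position `k` and outside `I`. -/
noncomputable def prefixElt (α : Module.Basis S ℝ V) (Q : List S) (I : Finset (Fin Q.length))
    (k : ℕ) : V ≃ₗᵢ[ℝ] V := wordProd α (prefixWord Q I k)

theorem prefixElt_zero : prefixElt α Q I 0 = 1 := by
  rw [prefixElt, prefixWord_zero, wordProd_nil]

theorem prefixElt_mem (k : ℕ) : prefixElt α Q I k ∈ reflectionGroup α := wordProd_mem _ _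

theorem prefixElt_succ_of_mem {k : Fin Q.length} (h : k ∈ I) :
    prefixElt α Q I (k + 1) = prefixElt α Q I k := by
  rw [prefixElt, prefixWord_succ, if_pos h, List.append_nil, prefixElt]

theorem prefixElt_succ_of_notMem {k : Fin Q.length} (h : k ∉ I) :
    prefixElt α Q I (k + 1) = prefixElt α Q I k * simpleReflection α (Q.get k) := by
  rw [prefixElt, prefixWord_succ, if_neg h, wordProd_concat, prefixElt]

theorem rootFn_eq (k : Fin Q.length) :
    rootFn α Q I k = prefixElt α Q I k (α (Q.get k)) := by
  simp [rootFn, prefixProd, prefixElt, prefixWord]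

theorem weightFn_eq (k : Fin Q.length) :
    weightFn α Q I k = prefixElt α Q I k (weight α (Q.get k)) := by
  simp [weightFn, prefixProd, prefixElt, prefixWord]

theorem rootFn_mem_roots (k : Fin Q.length) : rootFn α Q I k ∈ roots α := by
  rw [rootFn_eq]; exact apply_mem_roots (prefixElt_mem _) (simple_mem_roots α _)

theorem inner_weightFn_rootFn_pos (k : Fin Q.length) :
    0 < ⟪rootFn α Q I k, weightFn α Q I k⟫ := by
  rw [rootFn_eq, weightFn_eq, LinearIsometryEquiv.inner_map_map]
  exact inner_weight_self_pos _

theorem prefixElt_succ_of_notMem' {k : Fin Q.length} (h : k ∉ I) :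
    prefixElt α Q I (k + 1) = rootReflection (rootFn α Q I k) * prefixElt α Q I k := by
  rw [prefixElt_succ_of_notMem h, mul_simpleReflection, rootFn_eq]

theorem prefixWord_prefix {k k' : ℕ} (h : k ≤ k') (hk : k' ≤ Q.length) :
    prefixWord Q I k <+: prefixWord Q I k' := by
  induction k', h using Nat.le_induction with
  | base => exact List.prefix_rfl
  | succ n hn ih =>
    refine (ih (by omega)).trans ?_
    have := prefixWord_succ (I := I) (⟨n, hk⟩ : Fin Q.length)
    simp only at this
    rw [this]
    exact List.prefix_append _ _

theorem IsFacet.isPosWord_prefixWord (hα : IsSimpleSystem α) (hI : IsFacet α w₀ Q I) {k : ℕ}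
    (hk : k ≤ Q.length) : IsPosWord α (prefixWord Q I k) := by
  obtain ⟨t, ht⟩ := prefixWord_prefix (I := I) hk le_rfl
  have := IsReducedExpr.isPosWord hα hI
  rw [← prefixWord_length, ← ht] at this
  exact this.of_append

theorem IsFacet.rootFn_pos (hα : IsSimpleSystem α) (hI : IsFacet α w₀ Q I) {k : Fin Q.length}
    (hk : k ∉ I) : rootFn α Q I k ∈ posRoots α := by
  have := hI.isPosWord_prefixWord hα (Nat.succ_le_of_lt k.2)
  rw [Nat.succ_eq_add_one, prefixWord_succ, if_neg hk] at this
  rw [rootFn_eq]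
  exact (isPosWord_concat.1 this).2

theorem IsFacet.prefixElt_length (hI : IsFacet α w₀ Q I) : prefixElt α Q I Q.length = w₀ := by
  rw [prefixElt, prefixWord_length]; exact hI.1

theorem complementWord_length_add_card :
    (complementWord Q I).length + I.card = Q.length := by
  have h1 : (complementWord Q I).length = Iᶜ.card := by
    rw [complementWord, List.length_map, ← List.toFinset_card_of_nodup
      ((List.nodup_finRange _).filter _)]
    congr 1
    ext k
    simp
  rw [h1, Finset.card_compl, Fintype.card_fin]
  have := I.card_le_univ
  rw [Fintype.card_fin] at this
  omega

theorem IsFacet.card_add (hI : IsFacet α w₀ Q I) : length α w₀ + I.card = Q.length := by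
  rw [← hI.2, complementWord_length_add_card]

/-- For a facet, a positive root `γ` is the root of exactly one position `j` outside the facet,
and `γ` becomes an inversion of the prefix products exactly after `j`. -/
theorem IsFacet.exists_position (hα : IsSimpleSystem α) (hw₀ : IsLongest α w₀)
    (hI : IsFacet α w₀ Q I) {γ : V} (hγ : γ ∈ posRoots α) :
    ∃ j ∉ I, rootFn α Q I j = γ ∧
      (∀ k : ℕ, k ≤ j → (prefixElt α Q I k)⁻¹ γ ∈ posRoots α) ∧
      ∀ k : ℕ, j < k → k ≤ Q.length → -((prefixElt α Q I k)⁻¹ γ) ∈ posRoots α := by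
  classical
  have hroot : ∀ k : ℕ, (prefixElt α Q I k)⁻¹ γ ∈ roots α := fun k =>
    apply_mem_roots (inv_mem (prefixElt_mem k)) hγ.1
  -- The full product is `w₀`, for which every positive root is an inversion; the position sought is
  -- the one just before the first prefix that inverts `γ`.
  have hend : ∃ k : ℕ, -((prefixElt α Q I k)⁻¹ γ) ∈ posRoots α := by
    refine ⟨Q.length, (mem_posRoots_or_neg hα (hroot _)).resolve_left fun h => ?_⟩
    rw [hI.prefixElt_length] at h
    have := hw₀.neg_apply hα h
    rw [isom_apply_inv_self] at this
    exact neg_notMem_posRoots hγ this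
  have hle : Nat.find hend ≤ Q.length := by
    refine Nat.find_min' hend ((mem_posRoots_or_neg hα (hroot _)).resolve_left fun h => ?_)
    rw [hI.prefixElt_length] at h
    have := hw₀.neg_apply hα h
    rw [isom_apply_inv_self] at this
    exact neg_notMem_posRoots hγ this
  have hmin : ∀ k < Nat.find hend, (prefixElt α Q I k)⁻¹ γ ∈ posRoots α := fun k hk =>
    (mem_posRoots_or_neg hα (hroot _)).resolve_right (Nat.find_min hend hk)
  have hspec := Nat.find_spec hend
  generalize Nat.find hend = n at hle hmin hspec
  obtain _ | n := n
  · rw [prefixElt_zero, inv_one, isom_one_apply] at hspec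
    exact absurd hspec (neg_notMem_posRoots hγ)
  have hj1 := hmin n (Nat.lt_succ_self n)
  set j : Fin Q.length := ⟨n, hle⟩ with hj
  have hjI : j ∉ I := by
    intro h
    have := prefixElt_succ_of_mem (α := α) h
    simp only [hj] at this
    rw [this] at hspec
    exact neg_notMem_posRoots hj1 hspec
  have hrt : (prefixElt α Q I n)⁻¹ γ = α (Q.get j) := by
    have := prefixElt_succ_of_notMem (α := α) hjI
    rw [show (j : ℕ) = n from rfl] at this
    rw [this, mul_simpleReflection_inv_apply] at hspec
    exact eq_simple_of_neg_simpleReflection hα hj1 hspec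
  refine ⟨j, hjI, ?_, fun k hk => hmin k (Nat.lt_succ_of_le hk), ?_⟩
  · rw [rootFn_eq, ← hrt, isom_apply_inv_self]
  · intro k hk
    induction k, Nat.succ_le_of_lt hk using Nat.le_induction with
    | base => exact fun _ => hspec
    | succ k hk' ih =>
      intro hkQ
      have ih' := ih hk' (by omega)
      set k' : Fin Q.length := ⟨k, hkQ⟩
      by_cases hkI : k' ∈ I
      · have := prefixElt_succ_of_mem (α := α) hkI
        rw [show (k' : ℕ) = k from rfl] at this
        rwa [this]
      · have := prefixElt_succ_of_notMem (α := α) hkI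
        rw [show (k' : ℕ) = k from rfl] at this
        rw [this, mul_simpleReflection_inv_apply, ← map_neg]
        -- If `γ` turned positive again, the letter responsible would have root `-γ`, while letters
        -- outside a facet have positive roots.
        refine simpleReflection_mem_posRoots hα ih' fun e => ?_
        have h2 := hI.rootFn_pos hα hkI
        rw [rootFn_eq, ← e, map_neg, isom_apply_inv_self] at h2
        exact neg_notMem_posRoots hγ h2

/-- This form also covers the positions inside the facet: root `γ` can occur only up to `j`, and
root `-γ` only after it. -/
theorem IsFacet.exists_position' (hα : IsSimpleSystem α) (hw₀ : IsLongest α w₀)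
    (hI : IsFacet α w₀ Q I) {γ : V} (hγ : γ ∈ posRoots α) :
    ∃ j ∉ I, rootFn α Q I j = γ ∧ (∀ k, rootFn α Q I k = γ → k ≤ j) ∧
      (∀ k, rootFn α Q I k = -γ → j < k) ∧
      ∀ k ∉ I, rootFn α Q I k = γ ∨ rootFn α Q I k = -γ → k = j := by
  obtain ⟨j, hj, h1, h2, h3⟩ := hI.exists_position hα hw₀ hγ
  have h4 : ∀ k, rootFn α Q I k = γ → k ≤ j := by
    intro k hk
    by_contra! hlt
    have := h3 k hlt k.2.le
    rw [← hk, rootFn_eq, isom_inv_apply_self] at this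
    exact neg_notMem_posRoots (simple_mem_posRoots α _) this
  refine ⟨j, hj, h1, h4, ?_, ?_⟩
  · intro k hk
    by_contra! hle
    have := h2 k hle
    rw [← neg_neg γ, ← hk, rootFn_eq, map_neg, isom_inv_apply_self] at this
    exact neg_notMem_posRoots (simple_mem_posRoots α _) this
  · rintro k hkI (hk | hk)
    · refine le_antisymm (h4 k hk) ?_
      by_contra! hlt
      have := h2 (k + 1) hlt
      rw [prefixElt_succ_of_notMem hkI, mul_simpleReflection_inv_apply, ← hk, rootFn_eq,
        isom_inv_apply_self, simpleReflection_self] at this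
      exact neg_notMem_posRoots (simple_mem_posRoots α _) this
    · have := hI.rootFn_pos hα hkI
      rw [hk] at this
      exact absurd this (neg_notMem_posRoots hγ)

/-! ### Flips -/

/-- Change the membership of the positions `a` and `b` (if they are distinct). -/
def toggle (I : Finset (Fin Q.length)) (a b : Fin Q.length) : Finset (Fin Q.length) :=
  symmDiff I (symmDiff {a} {b})

theorem mem_toggle {a b k : Fin Q.length} :
    k ∈ toggle I a b ↔ (k ∈ I ∧ (k = a ↔ k = b)) ∨ (k ∉ I ∧ ¬(k = a ↔ k = b)) := by
  simp only [toggle, Finset.mem_symmDiff, Finset.mem_singleton]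
  tauto

theorem toggle_toggle (a b : Fin Q.length) : toggle (toggle I a b) a b = I :=
  symmDiff_symmDiff_cancel_right _ _

theorem toggle_self (a : Fin Q.length) : toggle I a a = I := by
  simp [toggle]

theorem toggle_comm (a b : Fin Q.length) : toggle I a b = toggle I b a := by
  rw [toggle, toggle, symmDiff_comm ({a} : Finset (Fin Q.length))]

theorem mem_toggle_of_ne {a b k : Fin Q.length} (ha : k ≠ a) (hb : k ≠ b) :
    k ∈ toggle I a b ↔ k ∈ I := by
  simp [mem_toggle, ha, hb]

theorem mem_toggle_left {a b : Fin Q.length} (h : a ≠ b) : a ∈ toggle I a b ↔ a ∉ I := by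
  simp [mem_toggle, h]

theorem mem_toggle_right {a b : Fin Q.length} (h : a ≠ b) : b ∈ toggle I a b ↔ b ∉ I := by
  simp [mem_toggle, h.symm]

theorem toggle_eq_insert {a b : Fin Q.length} (ha : a ∈ I) (hb : b ∉ I) :
    toggle I a b = insert b (I.erase a) := by
  have hab : a ≠ b := fun e => hb (e ▸ ha)
  ext k
  by_cases h1 : k = a
  · subst h1; simp [mem_toggle_left hab, ha, hab]
  · by_cases h2 : k = b
    · subst h2; simp [mem_toggle_right hab, hb]
    · simp [mem_toggle_of_ne h1 h2, h1, h2]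

/-- Inserting or deleting the letter at `a` multiplies the later prefix products on the left by the
reflection in its root. The change at `b` brings in the same reflection and cancels it. -/
theorem prefixElt_toggle_of_le {a b : Fin Q.length} (hab : a ≤ b)
    (h : rootReflection (rootFn α Q I b) = rootReflection (rootFn α Q I a)) {k : ℕ}
    (hk : k ≤ Q.length) :
    prefixElt α Q (toggle I a b) k = if a < k ∧ k ≤ b then
      rootReflection (rootFn α Q I a) * prefixElt α Q I k else prefixElt α Q I k := by
  rcases hab.eq_or_lt with rfl | hab
  · rw [toggle_self, if_neg (by omega)]
  have hne : a ≠ b := hab.ne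
  induction k with
  | zero => rw [if_neg (by omega), prefixElt_zero, prefixElt_zero]
  | succ k ih =>
    have ih := ih (by omega)
    obtain ⟨k', rfl⟩ : ∃ k' : Fin Q.length, k' = k := ⟨⟨k, hk⟩, rfl⟩
    have hρ := rootReflection_mul_self (rootFn α Q I a)
    by_cases hka : k' = a
    · subst hka
      rw [if_neg (by omega)] at ih
      rw [if_pos (by omega)]
      by_cases hI : k' ∈ I
      · rw [prefixElt_succ_of_notMem (by rw [mem_toggle_left hne]; simpa using hI), ih,
          prefixElt_succ_of_mem hI, mul_simpleReflection, rootFn_eq]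
      · rw [prefixElt_succ_of_mem ((mem_toggle_left hne).2 hI), ih, prefixElt_succ_of_notMem' hI,
          ← mul_assoc, hρ, one_mul]
    by_cases hkb : k' = b
    · subst hkb
      rw [if_pos (by omega)] at ih
      rw [if_neg (by omega)]
      by_cases hI : k' ∈ I
      · rw [prefixElt_succ_of_notMem (by rw [mem_toggle_right hne]; simpa using hI), ih,
          prefixElt_succ_of_mem hI, mul_assoc, mul_simpleReflection, ← rootFn_eq, h, ← mul_assoc,
          hρ, one_mul]
      · rw [prefixElt_succ_of_mem ((mem_toggle_right hne).2 hI), ih, prefixElt_succ_of_notMem' hI,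
          h]
    have hmem := mem_toggle_of_ne (I := I) hka hkb
    have h1 : ((a : ℕ) < k' + 1 ∧ (k' : ℕ) + 1 ≤ b) ↔ ((a : ℕ) < k' ∧ (k' : ℕ) ≤ b) := by
      rw [Fin.ext_iff] at hka hkb; omega
    by_cases hI : k' ∈ I
    · rw [prefixElt_succ_of_mem (hmem.2 hI), ih, prefixElt_succ_of_mem hI]
      simp only [h1]
    · rw [prefixElt_succ_of_notMem (mt hmem.1 hI), ih, prefixElt_succ_of_notMem hI]
      simp only [h1]
      split_ifs
      · rw [mul_assoc]
      · rfl

theorem prefixElt_toggle {a b : Fin Q.length}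
    (h : rootReflection (rootFn α Q I b) = rootReflection (rootFn α Q I a)) {k : ℕ}
    (hk : k ≤ Q.length) :
    prefixElt α Q (toggle I a b) k = if (min a b : Fin Q.length) < k ∧ k ≤ (max a b : Fin Q.length)
      then rootReflection (rootFn α Q I a) * prefixElt α Q I k else prefixElt α Q I k := by
  rcases le_total a b with hab | hab
  · rw [min_eq_left hab, max_eq_right hab, prefixElt_toggle_of_le hab h hk]
  · rw [min_eq_right hab, max_eq_left hab, toggle_comm, prefixElt_toggle_of_le hab h.symm hk, h]

theorem rootFn_toggle {a b : Fin Q.length}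
    (h : rootReflection (rootFn α Q I b) = rootReflection (rootFn α Q I a)) (k : Fin Q.length) :
    rootFn α Q (toggle I a b) k = if min a b < k ∧ k ≤ max a b
      then rootReflection (rootFn α Q I a) (rootFn α Q I k) else rootFn α Q I k := by
  rw [rootFn_eq, prefixElt_toggle h k.2.le]
  simp only [Fin.val_fin_lt, Fin.val_fin_le]
  rw [rootFn_eq k]
  split_ifs <;> rfl

theorem weightFn_toggle {a b : Fin Q.length}
    (h : rootReflection (rootFn α Q I b) = rootReflection (rootFn α Q I a)) (k : Fin Q.length) :
    weightFn α Q (toggle I a b) k = if min a b < k ∧ k ≤ max a b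
      then rootReflection (rootFn α Q I a) (weightFn α Q I k) else weightFn α Q I k := by
  rw [weightFn_eq, prefixElt_toggle h k.2.le]
  simp only [Fin.val_fin_lt, Fin.val_fin_le]
  rw [weightFn_eq k]
  split_ifs <;> rfl

/-- The product beyond both positions is unchanged, and so is the number of remaining letters, hence
the new complement is again a reduced expression of `w₀`. -/
theorem IsFacet.isFacet_toggle (hI : IsFacet α w₀ Q I) {a b : Fin Q.length}
    (h : rootReflection (rootFn α Q I b) = rootReflection (rootFn α Q I a))
    (hab : (a ∈ I ∧ b ∉ I) ∨ (a ∉ I ∧ b ∈ I)) : IsFacet α w₀ Q (toggle I a b) := by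
  have hcard : (toggle I a b).card = I.card := by
    rcases hab with ⟨ha, hb⟩ | ⟨hb, ha⟩
    · rw [toggle_eq_insert ha hb, Finset.card_insert_of_notMem (by simp [hb]),
        Finset.card_erase_add_one ha]
    · rw [toggle_comm, toggle_eq_insert ha hb, Finset.card_insert_of_notMem (by simp [hb]),
        Finset.card_erase_add_one ha]
  constructor
  · rw [← prefixWord_length]
    have := prefixElt_toggle h le_rfl
    rw [if_neg (by have := (max a b).2; omega), hI.prefixElt_length] at this
    exact this
  · have h1 := complementWord_length_add_card (I := toggle I a b)
    have h2 := hI.card_add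
    omega

/-- Every position of a facet can be flipped. -/
theorem IsFacet.exists_flip (hα : IsSimpleSystem α) (hw₀ : IsLongest α w₀)
    (hI : IsFacet α w₀ Q I) {i : Fin Q.length} :
    ∃ j ∉ I, ((i ≤ j ∧ rootFn α Q I j = rootFn α Q I i ∧ rootFn α Q I i ∈ posRoots α) ∨
      (j < i ∧ rootFn α Q I j = -rootFn α Q I i ∧ -rootFn α Q I i ∈ posRoots α)) ∧
      ∀ k : Fin Q.length, min i j < k → k ≤ max i j →
        (prefixElt α Q I k)⁻¹ (rootFn α Q I i) ∈ posRoots α := by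
  rcases mem_posRoots_or_neg hα (rootFn_mem_roots (α := α) (I := I) i) with hp | hp
  · obtain ⟨j, hj, h1, h2, h3⟩ := hI.exists_position hα hw₀ hp
    have hij : i ≤ j := by
      by_contra! hlt
      have := h3 i hlt i.2.le
      rw [rootFn_eq, isom_inv_apply_self] at this
      exact neg_notMem_posRoots (simple_mem_posRoots α _) this
    refine ⟨j, hj, Or.inl ⟨hij, h1, hp⟩, fun k _ hk => h2 k ?_⟩
    rw [max_eq_right hij] at hk
    exact hk
  · obtain ⟨j, hj, h1, h2, h3⟩ := hI.exists_position hα hw₀ hp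
    have hij : j < i := by
      by_contra! hle
      have := h2 i hle
      rw [rootFn_eq, map_neg, isom_inv_apply_self] at this
      exact neg_notMem_posRoots (simple_mem_posRoots α _) this
    refine ⟨j, hj, Or.inr ⟨hij, h1, hp⟩, fun k hk _ => ?_⟩
    rw [min_eq_right hij.le] at hk
    have := h3 k hk k.2.le
    rwa [map_neg, neg_neg] at this

theorem rootReflection_eq_of_eq_or_neg {β γ : V} (h : β = γ ∨ β = -γ) :
    rootReflection β = rootReflection γ := by
  rcases h with rfl | rfl
  · rfl
  · exact rootReflection_neg γ

/-- The flip at `i` reflects in `β`, the root of `i`, the weights strictly after the left and up to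
the right of the two exchanged positions. There the prefix products pull `β` back to a positive
root, so every such weight loses a nonnegative multiple of `β`, and the one at the right end loses a
positive multiple. -/
theorem IsFacet.exists_brickVector_sub (hα : IsSimpleSystem α) (hw₀ : IsLongest α w₀)
    (hI : IsFacet α w₀ Q I) {i : Fin Q.length} (hi : i ∈ I) :
    ∃ J, IsFacet α w₀ Q J ∧ ∃ a : ℝ, 0 < a ∧
      brickVector α Q J - brickVector α Q I = -(a • rootFn α Q I i) := by
  obtain ⟨j, hj, h1, h2⟩ := hI.exists_flip hα hw₀ (i := i)
  have hρ : rootReflection (rootFn α Q I j) = rootReflection (rootFn α Q I i) :=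
    rootReflection_eq_of_eq_or_neg (h1.imp (fun h => h.2.1) (fun h => h.2.1))
  have hne : i ≠ j := fun e => hj (e ▸ hi)
  refine ⟨toggle I i j, hI.isFacet_toggle hρ (Or.inl ⟨hi, hj⟩), ?_⟩
  set β := rootFn α Q I i with hβ
  have hββ : 0 < ⟪β, β⟫ := real_inner_self_pos.2 (ne_zero_of_mem_roots (rootFn_mem_roots i))
  have hnn : ∀ k, min i j < k ∧ k ≤ max i j → 0 ≤ ⟪β, weightFn α Q I k⟫ := by
    rintro k ⟨hk1, hk2⟩
    rw [weightFn_eq, real_inner_comm, inner_isom_left, real_inner_comm]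
    exact inner_weight_nonneg (h2 k hk1 hk2).2 _
  refine ⟨∑ k, if min i j < k ∧ k ≤ max i j then 2 * ⟪β, weightFn α Q I k⟫ / ⟪β, β⟫ else 0, ?_, ?_⟩
  · refine Finset.sum_pos' (fun k _ => ?_) ⟨max i j, Finset.mem_univ _, ?_⟩
    · split_ifs with h
      · have := hnn k h
        positivity
      · exact le_rfl
    · rw [if_pos ⟨min_lt_max.2 hne, le_rfl⟩]
      have : 0 < ⟪β, weightFn α Q I (max i j)⟫ := by
        rcases h1 with ⟨hij, h, _⟩ | ⟨hij, h, _⟩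
        · rw [max_eq_right hij, ← h]
          exact inner_weightFn_rootFn_pos _
        · rw [max_eq_left hij.le]
          exact inner_weightFn_rootFn_pos _
      positivity
  · rw [brickVector, brickVector, ← Finset.sum_sub_distrib, Finset.sum_smul,
      ← Finset.sum_neg_distrib]
    refine Finset.sum_congr rfl fun k _ => ?_
    rw [weightFn_toggle hρ, ← hβ]
    split_ifs
    · rw [rootReflection_apply]; abel
    · simp

/-! ### Uniqueness of the facet with positive root configuration -/

/-- The facet with positive root configuration is unique; more generally, this holds for facets
with prescribed membership on a set of positions and positive roots elsewhere. -/
theorem IsFacet.eq_of_forall_pos (hα : IsSimpleSystem α) (hI : IsFacet α w₀ Q I)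
    (hJ : IsFacet α w₀ Q J) (X : Set (Fin Q.length)) (hX : ∀ k ∈ X, k ∈ I ↔ k ∈ J)
    (hIp : ∀ k ∈ I, k ∉ X → rootFn α Q I k ∈ posRoots α)
    (hJp : ∀ k ∈ J, k ∉ X → rootFn α Q J k ∈ posRoots α) : I = J := by
  -- Under the positivity assumption, the product up to and including position `k` decides whether
  -- `k` is in the facet: a letter that was used has just made its own root negative.
  have key : ∀ {I : Finset (Fin Q.length)}, IsFacet α w₀ Q I → ∀ k,
      (k ∈ I → rootFn α Q I k ∈ posRoots α) →
      (k ∈ I ↔ prefixElt α Q I (k + 1) (α (Q.get k)) ∈ posRoots α) := by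
    intro I hI k hk
    by_cases h : k ∈ I
    · rw [prefixElt_succ_of_mem h, ← rootFn_eq]
      exact iff_of_true h (hk h)
    · rw [prefixElt_succ_of_notMem h, isom_mul_apply, simpleReflection_self, map_neg, ← rootFn_eq]
      exact iff_of_false h (neg_notMem_posRoots (hI.rootFn_pos hα h))
  -- Both products start from `w₀` at the right end; `d` counts the positions already compared from
  -- there.
  have main : ∀ d ≤ Q.length,
      prefixElt α Q I (Q.length - d) = prefixElt α Q J (Q.length - d) ∧
      ∀ k : Fin Q.length, Q.length - d ≤ k → (k ∈ I ↔ k ∈ J) := by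
    intro d
    induction d with
    | zero =>
      intro _
      rw [Nat.sub_zero, hI.prefixElt_length, hJ.prefixElt_length]
      exact ⟨rfl, fun k hk => absurd k.2 (not_lt.2 hk)⟩
    | succ d ih =>
      intro hd
      obtain ⟨h1, h2⟩ := ih (by omega)
      set k : Fin Q.length := ⟨Q.length - (d + 1), by omega⟩ with hk
      have hk1 : Q.length - d = k + 1 := by simp only [hk]; omega
      have hk2 : Q.length - (d + 1) = k := rfl
      rw [hk1] at h1
      have hmem : k ∈ I ↔ k ∈ J := by
        by_cases hx : k ∈ X
        · exact hX k hx
        · rw [key hI k fun h => hIp k h hx, key hJ k fun h => hJp k h hx, h1]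
      refine ⟨?_, fun k' hk' => ?_⟩
      · rw [hk2]
        by_cases h : k ∈ I
        · rwa [prefixElt_succ_of_mem h, prefixElt_succ_of_mem (hmem.1 h)] at h1
        · rw [prefixElt_succ_of_notMem h, prefixElt_succ_of_notMem (mt hmem.2 h)] at h1
          exact mul_right_cancel h1
      · rcases eq_or_ne k' k with rfl | hne
        · exact hmem
        · rw [Ne, Fin.ext_iff] at hne
          exact h2 k' (by omega)
  ext k
  exact (main Q.length le_rfl).2 k (by omega)

/-- The facets containing the position `j` are connected by flips that do not move `j`. -/
theorem IsFacet.link_induction (hα : IsSimpleSystem α) (hw₀ : IsLongest α w₀) {j : Fin Q.length}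
    {M : Finset (Fin Q.length) → Prop}
    (hM : ∀ I, IsFacet α w₀ Q I → j ∈ I → M I → ∀ i ∈ I, i ≠ j → ∀ i' ∉ I,
      rootFn α Q I i' = rootFn α Q I i ∨ rootFn α Q I i' = -rootFn α Q I i → M (toggle I i i'))
    (hI : IsFacet α w₀ Q I) (hJ : IsFacet α w₀ Q J) (hjI : j ∈ I) (hjJ : j ∈ J) (h : M I) :
    M J := by
  -- Undoing a flip is a flip of the same kind, so `M` is invariant in both directions.
  have hM' : ∀ I, IsFacet α w₀ Q I → j ∈ I → ∀ i ∈ I, i ≠ j → ∀ i' ∉ I,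
      rootFn α Q I i' = rootFn α Q I i ∨ rootFn α Q I i' = -rootFn α Q I i →
        (M I ↔ M (toggle I i i')) := by
    intro I hI hj i hi hij i' hi' hr
    refine ⟨fun h => hM I hI hj h i hi hij i' hi' hr, fun h => ?_⟩
    have hρ := rootReflection_eq_of_eq_or_neg hr
    have hne : i ≠ i' := fun e => hi' (e ▸ hi)
    have hji' : j ≠ i' := fun e => hi' (e ▸ hj)
    have hpm : ∀ k, rootFn α Q I k = rootFn α Q I i ∨ rootFn α Q I k = -rootFn α Q I i →
        rootFn α Q (toggle I i i') k = rootFn α Q I i ∨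
        rootFn α Q (toggle I i i') k = -rootFn α Q I i := by
      intro k hk
      rw [rootFn_toggle hρ]
      split_ifs
      · rcases hk with hk | hk <;> rw [hk]
        · exact Or.inr (rootReflection_self _)
        · left; rw [map_neg, rootReflection_self, neg_neg]
      · exact hk
    have := hM _ (hI.isFacet_toggle hρ (Or.inl ⟨hi, hi'⟩)) ((mem_toggle_of_ne hij.symm hji').2 hj) h
      i' ((mem_toggle_right hne).2 hi') hji'.symm i
      (by rw [mem_toggle_left hne]; simpa using hi) (by
        rcases hpm i (Or.inl rfl) with h1 | h1 <;> rcases hpm i' hr with h2 | h2 <;>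
        rw [h1, h2] <;> simp)
    rwa [toggle_comm, toggle_toggle] at this
  -- A flip at a position with negative root moves it to the left and lowers the sum of the
  -- positions. The process ends at a facet whose roots away from `j` are positive, and there is
  -- only one such facet containing `j`.
  have main : ∀ n : ℕ, ∀ I, IsFacet α w₀ Q I → j ∈ I → ∑ i ∈ I, (i : ℕ) = n →
      ∃ G, IsFacet α w₀ Q G ∧ j ∈ G ∧ (M I ↔ M G) ∧
        ∀ i ∈ G, i ∉ ({j} : Set (Fin Q.length)) → rootFn α Q G i ∈ posRoots α := by
    intro n
    induction n using Nat.strong_induction_on with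
    | _ n ih =>
      intro I hI hj hn
      by_cases hpos : ∀ i ∈ I, i ∉ ({j} : Set (Fin Q.length)) → rootFn α Q I i ∈ posRoots α
      · exact ⟨I, hI, hj, Iff.rfl, hpos⟩
      push Not at hpos
      obtain ⟨i, hi, hij, hneg⟩ := hpos
      rw [Set.mem_singleton_iff] at hij
      obtain ⟨i', hi', h1, -⟩ := hI.exists_flip hα hw₀ (i := i)
      rcases h1 with ⟨_, _, h1⟩ | ⟨hlt, h1, _⟩
      · exact absurd h1 hneg
      have hρ := rootReflection_eq_of_eq_or_neg (Or.inr h1)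
      have hji' : j ≠ i' := fun e => hi' (e ▸ hj)
      have hsum : ∑ k ∈ toggle I i i', (k : ℕ) < n := by
        rw [toggle_eq_insert hi hi', Finset.sum_insert (by simp [hi']), ← hn,
          ← Finset.add_sum_erase I (fun k : Fin Q.length => (k : ℕ)) hi]
        exact Nat.add_lt_add_right hlt _
      obtain ⟨G, hG, hjG, hMG, hGp⟩ := ih _ hsum _ (hI.isFacet_toggle hρ (Or.inl ⟨hi, hi'⟩))
        ((mem_toggle_of_ne (Ne.symm hij) hji').2 hj) rfl
      exact ⟨G, hG, hjG, (hM' I hI hj i hi hij i' hi' (Or.inr h1)).trans hMG, hGp⟩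
  obtain ⟨G, hG, hjG, hMG, hGp⟩ := main _ I hI hjI rfl
  obtain ⟨G', hG', hjG', hMG', hGp'⟩ := main _ J hJ hjJ rfl
  have : G = G' := hG.eq_of_forall_pos hα hG' {j} (by
    rintro k rfl; exact iff_of_true hjG hjG') hGp hGp'
  exact hMG'.2 (this ▸ hMG.1 h)

/-! ### The map `κ` -/

/-- `I` is a facet whose root configuration is contained in `w(Φ⁺)`. -/
def IsPositiveFacet (α : Module.Basis S ℝ V) (w₀ : V ≃ₗᵢ[ℝ] V) (Q : List S) (w : V ≃ₗᵢ[ℝ] V)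
    (I : Finset (Fin Q.length)) : Prop :=
  IsFacet α w₀ Q I ∧ ∀ i ∈ I, rootFn α Q I i ∈ w '' posRoots α

theorem isProjection_iff {w : reflectionGroup α} :
    IsProjection α w₀ Q w I ↔ IsPositiveFacet α w₀ Q w I := by
  simp [IsProjection, IsPositiveFacet, rootConfig]

theorem neg_notMem_image_posRoots {w : V ≃ₗᵢ[ℝ] V} {β : V} (h : β ∈ w '' posRoots α) :
    -β ∉ w '' posRoots α := by
  obtain ⟨γ, hγ, rfl⟩ := h
  rintro ⟨δ, hδ, e⟩
  rw [← map_neg] at e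
  exact neg_notMem_posRoots hγ (w.injective e ▸ hδ)

theorem mem_image_mul_simpleReflection (hα : IsSimpleSystem α) {w : V ≃ₗᵢ[ℝ] V} {s : S} {β : V}
    (h : β ∈ w '' posRoots α) (hne : β ≠ w (α s)) :
    β ∈ (w * simpleReflection α s) '' posRoots α ∧
      rootReflection (w (α s)) β ∈ (w * simpleReflection α s) '' posRoots α := by
  obtain ⟨γ, hγ, rfl⟩ := h
  refine ⟨⟨simpleReflection α s γ, simpleReflection_mem_posRoots hα hγ fun e => hne (e ▸ rfl), ?_⟩,
    γ, hγ, ?_⟩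
  · rw [isom_mul_apply, simpleReflection_apply_apply]
  · rw [mul_simpleReflection]; rfl

/-- Exchanging the first and the last position with root `± w(α_s)` maps the facets for `w` to the
facets for `w s`. -/
theorem IsPositiveFacet.exists_toggle (hα : IsSimpleSystem α) (hw₀ : IsLongest α w₀) {w : V ≃ₗᵢ[ℝ] V}
    (hw : w ∈ reflectionGroup α) {s : S} (hI : IsPositiveFacet α w₀ Q w I) :
    ∃ a b : Fin Q.length, IsPositiveFacet α w₀ Q (w * simpleReflection α s) (toggle I a b) ∧
      (∀ k, (rootFn α Q (toggle I a b) k = w (α s) ∨ rootFn α Q (toggle I a b) k = -w (α s)) ↔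
        (rootFn α Q I k = w (α s) ∨ rootFn α Q I k = -w (α s))) ∧
      (rootFn α Q I a = w (α s) ∨ rootFn α Q I a = -w (α s)) ∧
      (rootFn α Q I b = w (α s) ∨ rootFn α Q I b = -w (α s)) ∧
      ∀ k, (rootFn α Q I k = w (α s) ∨ rootFn α Q I k = -w (α s)) → a ≤ k ∧ k ≤ b := by
  classical
  obtain ⟨hI, hIw⟩ := hI
  set β := w (α s) with hβ
  have hβr : β ∈ roots α := apply_mem_roots hw (simple_mem_roots α s)
  have hβw : β ∈ w '' posRoots α := ⟨_, simple_mem_posRoots α s, rfl⟩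
  have hpm : ∀ k ∈ I, rootFn α Q I k = β ∨ rootFn α Q I k = -β → rootFn α Q I k = β := by
    rintro k hk (h | h)
    · exact h
    · exact absurd (h ▸ hIw k hk) (neg_notMem_image_posRoots hβw)
  -- the position `j` outside `I` with root `±β` is the last or the first one
  obtain ⟨j, hj, hjβ, hone, hend⟩ : ∃ j ∉ I, (rootFn α Q I j = β ∨ rootFn α Q I j = -β) ∧
      (∀ k ∉ I, (rootFn α Q I k = β ∨ rootFn α Q I k = -β) → k = j) ∧
      ((rootFn α Q I j = β ∧ ∀ k, (rootFn α Q I k = β ∨ rootFn α Q I k = -β) → k ≤ j) ∨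
        ∀ k, (rootFn α Q I k = β ∨ rootFn α Q I k = -β) → j ≤ k) := by
    rcases mem_posRoots_or_neg hα hβr with hp | hp
    · obtain ⟨j, hj, h1, h2, h3, h4⟩ := hI.exists_position' hα hw₀ hp
      refine ⟨j, hj, Or.inl h1, h4, Or.inl ⟨h1, fun k hk => ?_⟩⟩
      by_cases hkI : k ∈ I
      · exact h2 k (hpm k hkI hk)
      · exact (h4 k hkI hk).le
    · obtain ⟨j, hj, h1, h2, h3, h4⟩ := hI.exists_position' hα hw₀ hp
      rw [neg_neg] at h4 h3
      refine ⟨j, hj, Or.inr h1, fun k hkI hk => h4 k hkI hk.symm, Or.inr fun k hk => ?_⟩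
      by_cases hkI : k ∈ I
      · exact (h3 k (hpm k hkI hk)).le
      · exact (h4 k hkI hk.symm).ge
  set K := Finset.univ.filter fun k => rootFn α Q I k = β ∨ rootFn α Q I k = -β with hK
  have hKne : K.Nonempty := ⟨j, by simp [hK, hjβ]⟩
  have hKm : ∀ k, k ∈ K ↔ rootFn α Q I k = β ∨ rootFn α Q I k = -β := fun k => by simp [hK]
  obtain ⟨a, ha, hamin⟩ : ∃ a ∈ K, ∀ k ∈ K, a ≤ k := ⟨_, K.min'_mem hKne, fun k => K.min'_le k⟩
  obtain ⟨b, hb, hbmax⟩ : ∃ b ∈ K, ∀ k ∈ K, k ≤ b := ⟨_, K.max'_mem hKne, fun k => K.le_max' k⟩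
  rw [hKm] at ha hb
  have hρa : rootReflection (rootFn α Q I a) = rootReflection β := rootReflection_eq_of_eq_or_neg ha
  have hρ : rootReflection (rootFn α Q I b) = rootReflection (rootFn α Q I a) :=
    (rootReflection_eq_of_eq_or_neg hb).trans hρa.symm
  have hab : a ≤ b := hamin b ((hKm b).2 hb)
  have hmin : min a b = a := min_eq_left hab
  have hmax : max a b = b := max_eq_right hab
  have hrt : ∀ k, rootFn α Q (toggle I a b) k = if a < k ∧ k ≤ b then
      rootReflection β (rootFn α Q I k) else rootFn α Q I k := by
    intro k; rw [rootFn_toggle hρ, hmin, hmax, hρa]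
  have hK' : ∀ k, (rootFn α Q (toggle I a b) k = β ∨
      rootFn α Q (toggle I a b) k = -β) ↔
      (rootFn α Q I k = β ∨ rootFn α Q I k = -β) := by
    intro k
    rw [hrt]
    split_ifs
    · have h1 : ∀ x, rootReflection β x = β ↔ x = -β := fun x =>
        ⟨fun h => by rw [← rootReflection_apply_apply β x, h, rootReflection_self],
          fun h => by rw [h, map_neg, rootReflection_self, neg_neg]⟩
      have h2 : ∀ x, rootReflection β x = -β ↔ x = β := fun x =>
        ⟨fun h => by rw [← rootReflection_apply_apply β x, h, map_neg, rootReflection_self,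
          neg_neg], fun h => by rw [h, rootReflection_self]⟩
      rw [h1, h2, or_comm]
    · rfl
  -- The only unused-by-the-facet position with root `±β` is at the right end if `β` is positive and
  -- at the left end if `β` is negative; toggling moves it to the other end.
  have hjab : (j = b ∧ rootFn α Q I j = β) ∨ j = a := by
    rcases hend with ⟨h1, h⟩ | h
    · exact Or.inl ⟨le_antisymm (hbmax j ((hKm j).2 hjβ)) (h b hb), h1⟩
    · exact Or.inr (le_antisymm (h a ha) (hamin j ((hKm j).2 hjβ)))
  have hJf : IsFacet α w₀ Q (toggle I a b) := by
    rcases eq_or_ne a b with e | hne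
    · rw [e, toggle_self]; exact hI
    refine hI.isFacet_toggle hρ ?_
    rcases hjab with ⟨rfl, -⟩ | rfl
    · exact Or.inl ⟨by_contra fun h => hne (hone a h ha), hj⟩
    · exact Or.inr ⟨hj, by_contra fun h => hne (hone b h hb).symm⟩
  refine ⟨a, b, ⟨hJf, fun k hk => ?_⟩, hK', ha, hb,
    fun k hk => ⟨hamin k ((hKm k).2 hk), hbmax k ((hKm k).2 hk)⟩⟩
  by_cases hkK : rootFn α Q I k = β ∨ rootFn α Q I k = -β
  · have hka := hamin k ((hKm k).2 hkK)
    have hkb := hbmax k ((hKm k).2 hkK)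
    -- The vector `-β` is the image of `α s` under `w * simpleReflection α s`, which is the sign
    -- required of the new facet.
    suffices rootFn α Q (toggle I a b) k = -β by
      rw [this]
      refine ⟨α s, simple_mem_posRoots α s, ?_⟩
      rw [isom_mul_apply, simpleReflection_self, map_neg]
    have hab' : a ≠ b := by
      rintro rfl
      rw [toggle_self] at hk
      have hkj : k = j := by
        rcases hjab with ⟨e, -⟩ | e
        · exact (le_antisymm hkb hka).trans e.symm
        · exact (le_antisymm hkb hka).trans e.symm
      exact hj (hkj ▸ hk)
    rw [hrt]
    rcases hjab with ⟨rfl, hjr⟩ | rfl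
    · have hne : k ≠ a := by
        rintro rfl
        rw [mem_toggle_left hab'] at hk
        exact hab' (hone k hk hkK)
      have hkr : rootFn α Q I k = β := by
        by_cases hkI : k ∈ I
        · exact hpm k hkI hkK
        · rw [hone k hkI hkK, hjr]
      rw [if_pos ⟨lt_of_le_of_ne hka (Ne.symm hne), hkb⟩, hkr, rootReflection_self]
    · have hkb' : k ≠ b := by
        rintro rfl
        rw [mem_toggle_right hab'] at hk
        exact hab' (hone k hk hkK).symm
      by_cases hkj : k = j
      · rw [hkj, if_neg (by simp)]
        refine hjβ.resolve_left fun h => ?_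
        -- A letter outside the facet with positive root `β` would be the last position with this
        -- root, but `b` is further right and has root `β` too.
        by_cases hjp : β ∈ posRoots α
        · obtain ⟨j', hj', h1, h2, h3, h4⟩ := hI.exists_position' hα hw₀ hjp
          have hbI : b ∈ I := by_contra fun h => hab' (hone b h hb).symm
          have h5 := h4 j hj (Or.inl h)
          have h6 := h2 b (hpm b hbI hb)
          exact hab' (le_antisymm hab (h5 ▸ h6))
        · exact hjp (h ▸ hI.rootFn_pos hα hj)
      · rw [mem_toggle_of_ne hkj hkb'] at hk
        rw [if_pos ⟨lt_of_le_of_ne hka (Ne.symm hkj), hkb⟩, hpm k hk hkK, rootReflection_self]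
  · have hka : k ≠ a := fun e => hkK (e ▸ ha)
    have hkb : k ≠ b := fun e => hkK (e ▸ hb)
    rw [mem_toggle_of_ne hka hkb] at hk
    obtain ⟨h1, h2⟩ := mem_image_mul_simpleReflection hα (s := s) (hIw k hk)
      (fun h => hkK (Or.inl h))
    rw [hrt]
    split_ifs
    · exact h2
    · exact h1

/-- Induction on a word for `w`. Toggling preserves the set of positions with root `±w(α_s)`, hence
also its two ends, so the same exchange leads back from `ws` to `w` and uniqueness is transported
along it. -/
theorem existsUnique_isPositiveFacet (hα : IsSimpleSystem α) (hw₀ : IsLongest α w₀)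
    (hbase : ∃ I, IsPositiveFacet α w₀ Q 1 I) {w : V ≃ₗᵢ[ℝ] V} (hw : w ∈ reflectionGroup α) :
    ∃! I, IsPositiveFacet α w₀ Q w I := by
  obtain ⟨l, rfl⟩ := exists_wordProd hw
  clear hw
  induction l using List.reverseRecOn with
  | nil =>
    obtain ⟨I, hI⟩ := hbase
    have himg : ∀ β : V, β ∈ (1 : V ≃ₗᵢ[ℝ] V) '' posRoots α → β ∈ posRoots α := by
      rintro _ ⟨γ, hγ, rfl⟩; exact hγ
    refine ⟨I, hI, fun J hJ => ?_⟩
    exact hJ.1.eq_of_forall_pos hα hI.1 ∅ (by simp) (fun k hk _ => himg _ (hJ.2 k hk))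
      (fun k hk _ => himg _ (hI.2 k hk))
  | append_singleton l s ih =>
    rw [wordProd_concat]
    obtain ⟨I, hI, huniq⟩ := ih
    have hw := wordProd_mem α l
    obtain ⟨a, b, hab, -⟩ := hI.exists_toggle hα hw₀ hw (s := s)
    refine ⟨_, hab, ?_⟩
    have key : ∀ J, IsPositiveFacet α w₀ Q (wordProd α l * simpleReflection α s) J →
        ∃ a b : Fin Q.length, toggle J a b = I ∧
          (rootFn α Q I a = wordProd α l (α s) ∨ rootFn α Q I a = -wordProd α l (α s)) ∧
          (rootFn α Q I b = wordProd α l (α s) ∨ rootFn α Q I b = -wordProd α l (α s)) ∧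
          ∀ k, (rootFn α Q I k = wordProd α l (α s) ∨ rootFn α Q I k = -wordProd α l (α s)) →
            a ≤ k ∧ k ≤ b := by
      intro J hJ
      obtain ⟨a, b, h1, h2, h3, h4, h5⟩ := hJ.exists_toggle hα hw₀ (mul_mem hw (simpleReflection_mem α s))
        (s := s)
      rw [mul_assoc, simpleReflection_mul_self, mul_one] at h1
      have e := huniq _ h1
      have hneg : (wordProd α l * simpleReflection α s) (α s) = -wordProd α l (α s) := by
        rw [isom_mul_apply, simpleReflection_self, map_neg]
      rw [hneg] at h2 h3 h4 h5
      simp only [neg_neg] at h2 h3 h4 h5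
      simp only [or_comm (b := _ = wordProd α l (α s))] at h2 h3 h4 h5
      refine ⟨a, b, e, ?_, ?_, fun k hk => h5 k ?_⟩
      · rw [← e]; exact (h2 a).2 h3
      · rw [← e]; exact (h2 b).2 h4
      · rw [← e] at hk; exact (h2 k).1 hk
    have hinj : ∀ J J', IsPositiveFacet α w₀ Q (wordProd α l * simpleReflection α s) J →
        IsPositiveFacet α w₀ Q (wordProd α l * simpleReflection α s) J' → J = J' := by
      intro J J' hJ hJ'
      obtain ⟨a, b, h1, h2, h3, h4⟩ := key J hJ
      obtain ⟨a', b', h1', h2', h3', h4'⟩ := key J' hJ'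
      have ea : a = a' := le_antisymm (h4 a' h2').1 (h4' a h2).1
      have eb : b = b' := le_antisymm (h4' b h3).2 (h4 b' h3').2
      rw [← toggle_toggle (I := J) a b, h1, ea, eb, ← h1', toggle_toggle]
    exact fun J hJ => hinj J _ hJ hab

/-- The facet for `w` maximizes every linear functional in the chamber `w(C)`. -/
theorem IsPositiveFacet.inner_brickVector_le (hα : IsSimpleSystem α) (hw₀ : IsLongest α w₀)
    {w : V ≃ₗᵢ[ℝ] V} (hI : IsPositiveFacet α w₀ Q w I) (hw : w ∈ reflectionGroup α)
    (huniq : ∀ J, IsPositiveFacet α w₀ Q w J → J = I) {v : V}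
    (hv : ∀ s, 0 ≤ ⟪w (α s), v⟫) (hJ : IsFacet α w₀ Q J) :
    ⟪brickVector α Q J, v⟫ ≤ ⟪brickVector α Q I, v⟫ := by
  -- For `v` inside `w(C)`, a facet maximizing the pairing cannot be improved by flips, so its roots
  -- pair nonnegatively with `v` and lie in `w(Φ⁺)`; it is therefore `I`.
  have generic : ∀ v : V, (∀ s, 0 < ⟪w (α s), v⟫) →
      ⟪brickVector α Q J, v⟫ ≤ ⟪brickVector α Q I, v⟫ := by
    intro v hv
    obtain ⟨G, hG, hmax⟩ := Set.exists_max_image {J | IsFacet α w₀ Q J}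
      (fun J => ⟪brickVector α Q J, v⟫) (Set.toFinite _) ⟨I, hI.1⟩
    have hGw : IsPositiveFacet α w₀ Q w G := by
      refine ⟨hG, fun i hi => ?_⟩
      obtain ⟨J', hJ', a, ha, e⟩ := IsFacet.exists_brickVector_sub hα hw₀ hG hi
      have h1 := hmax J' hJ'
      have h2 : ⟪brickVector α Q J' - brickVector α Q G, v⟫ ≤ 0 := by
        rw [inner_sub_left]; exact sub_nonpos.2 h1
      rw [e, inner_neg_left, real_inner_smul_left, neg_nonpos] at h2
      have h3 : 0 ≤ ⟪rootFn α Q G i, v⟫ := nonneg_of_mul_nonneg_right h2 ha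
      refine ⟨w⁻¹ (rootFn α Q G i), ?_, isom_apply_inv_self _ _⟩
      refine (mem_posRoots_or_neg hα (apply_mem_roots (inv_mem hw)
        (rootFn_mem_roots i))).resolve_right fun h4 => ?_
      have h5 := inner_pos_of_posRoot h4 (y := w⁻¹ v) fun s => by
        rw [← inner_isom_left]; exact hv s
      rw [inner_neg_left, ← inner_isom_left, isom_apply_inv_self] at h5
      linarith
    exact huniq G hGw ▸ hmax J hJ
  -- A boundary vector `v` is pushed into the interior of `w(C)` by a small multiple of `w(q)`, and
  -- then `ε` tends to `0`.
  have h1 : ∀ ε : ℝ, 0 < ε → ⟪brickVector α Q J - brickVector α Q I, v⟫ +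
      ε * ⟪brickVector α Q J - brickVector α Q I, w (balancedPoint α)⟫ ≤ 0 := by
    intro ε hε
    have := generic (v + ε • w (balancedPoint α)) fun s => by
      rw [inner_add_right, real_inner_smul_right, LinearIsometryEquiv.inner_map_map,
        inner_balancedPoint]
      have h1 := inner_simple_self_pos α s
      have h2 := hv s
      positivity
    rw [← real_inner_smul_right, ← inner_add_right, inner_sub_left]
    linarith
  have h2 : Filter.Tendsto (fun ε : ℝ => ⟪brickVector α Q J - brickVector α Q I, v⟫ +
      ε * ⟪brickVector α Q J - brickVector α Q I, w (balancedPoint α)⟫) (nhdsWithin 0 (Set.Ioi 0))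
      (nhds (⟪brickVector α Q J - brickVector α Q I, v⟫ +
      0 * ⟪brickVector α Q J - brickVector α Q I, w (balancedPoint α)⟫)) :=
    (Continuous.tendsto (by fun_prop) 0).mono_left nhdsWithin_le_nhds
  have h3 := le_of_tendsto h2 (Filter.eventually_of_mem self_mem_nhdsWithin h1)
  rw [zero_mul, add_zero, inner_sub_left] at h3
  linarith

end Facets

/-! ### Words in which adjacent letters of the Coxeter graph alternate -/

section Alternating

variable {S V : Type*} [Fintype S] [DecidableEq S] [NormedAddCommGroup V] [InnerProductSpace ℝ V]
variable {α : Module.Basis S ℝ V}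

/-- Adjacency in the Coxeter graph. -/
def Adj (α : Module.Basis S ℝ V) (s t : S) : Prop := s ≠ t ∧ ⟪α s, α t⟫ ≠ 0

theorem Adj.symm {s t : S} (h : Adj α s t) : Adj α t s :=
  ⟨h.1.symm, by rw [real_inner_comm]; exact h.2⟩

theorem commute_of_not_adj {s t : S} (h : ¬Adj α s t) :
    simpleReflection α s * simpleReflection α t = simpleReflection α t * simpleReflection α s := by
  by_cases hst : s = t
  · rw [hst]
  have h0 : ⟪α t, α s⟫ = 0 := by
    by_contra h1
    exact h ⟨hst, by rwa [real_inner_comm]⟩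
  rw [mul_simpleReflection, simpleReflection_eq (s := s),
    rootReflection_of_inner_eq_zero (by rwa [real_inner_comm]), simpleReflection_eq]

theorem not_adj_of_commute {s t : S}
    (h : simpleReflection α s * simpleReflection α t =
      simpleReflection α t * simpleReflection α s) : ¬Adj α s t := by
  rintro ⟨hst, h0⟩
  -- At `α t`, the coordinates at `s` of the two sides are opposite multiples of the inner product
  -- of the two simple roots.
  have h1 := congrArg (fun f : V ≃ₗᵢ[ℝ] V => α.repr (f (α t)) s) h
  simp only [isom_mul_apply, simpleReflection_self, map_neg] at h1
  rw [repr_simpleReflection_of_ne hst, simpleReflection_eq, rootReflection_apply] at h1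
  simp only [map_sub, map_smul, Module.Basis.repr_self, Finsupp.coe_neg, Pi.neg_apply,
    Finsupp.coe_sub, Pi.sub_apply, Finsupp.coe_smul, Pi.smul_apply, Finsupp.single_eq_same,
    Finsupp.single_eq_of_ne hst, smul_eq_mul] at h1
  have h2 := (inner_simple_self_pos α s).ne'
  have h3 : 2 * ⟪α s, α t⟫ / ⟪α s, α s⟫ = 0 := by linarith
  rw [div_eq_zero_iff] at h3
  rcases h3 with h3 | h3
  · exact h0 (by linarith)
  · exact h2 h3

theorem CommutationEquiv.perm {u v : List S} (h : CommutationEquiv α u v) : u.Perm v := by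
  induction h with
  | refl => exact List.Perm.refl _
  | tail _ h ih =>
    obtain ⟨x, y, s, t, _⟩ := h
    exact ih.trans ((List.Perm.swap t s y).append_left x)

theorem CommutationEquiv.cons {u v : List S} (a : S) (h : CommutationEquiv α u v) :
    CommutationEquiv α (a :: u) (a :: v) := by
  induction h with
  | refl => exact Relation.ReflTransGen.refl
  | tail _ h ih =>
    obtain ⟨x, y, s, t, hst⟩ := h
    exact ih.tail (CommutationStep.swap (a :: x) y s t hst)

theorem commutationEquiv_move {s : S} {x : List S} (y : List S) (h : ∀ t ∈ x, ¬Adj α s t) :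
    CommutationEquiv α (s :: (x ++ y)) (x ++ s :: y) := by
  induction x with
  | nil => exact Relation.ReflTransGen.refl
  | cons t x ih =>
    simp only [List.mem_cons, forall_eq_or_imp] at h
    exact Relation.ReflTransGen.head
      (CommutationStep.swap [] (x ++ y) s t (commute_of_not_adj h.1)) ((ih h.2).cons t)

/-- Count one more letter `s`. -/
def incr (k : S → ℕ) (s : S) : S → ℕ := fun t => k t + if s = t then 1 else 0

/-- Add the letter counts of a word. -/
def addCount (k : S → ℕ) (l : List S) : S → ℕ := fun t => k t + l.count t

theorem addCount_cons (k : S → ℕ) (s : S) (l : List S) :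
    addCount k (s :: l) = addCount (incr k s) l := by
  ext t
  simp only [addCount, incr, List.count_cons, beq_iff_eq]
  ring

theorem addCount_nil (k : S → ℕ) : addCount k [] = k := by
  ext t; simp [addCount]

/-- A word `l`, read after a word with letter counts `k`, in which adjacent letters `s` and `t`
alternate: whenever `s` occurs, `t` has occurred `e t s` times more often than `s`. -/
def AltFrom (α : Module.Basis S ℝ V) (e : S → S → ℕ) : (S → ℕ) → List S → Prop
  | _, [] => True
  | k, s :: l => (∀ t, Adj α s t → k t = k s + e t s) ∧ AltFrom α e (incr k s) l

variable {e : S → S → ℕ}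

theorem altFrom_append {k : S → ℕ} {u v : List S} :
    AltFrom α e k (u ++ v) ↔ AltFrom α e k u ∧ AltFrom α e (addCount k u) v := by
  induction u generalizing k with
  | nil => simp [AltFrom, addCount_nil]
  | cons s u ih => simp only [List.cons_append, AltFrom, ih, addCount_cons, and_assoc]

theorem AltFrom.apply {k : S → ℕ} {u v : List S} {s t : S} (h : AltFrom α e k (u ++ s :: v))
    (hst : Adj α s t) : k t + u.count t = k s + u.count s + e t s :=
  (altFrom_append.1 h).2.1 t hst

theorem altFrom_of_forall {k : S → ℕ} {l : List S}
    (h : ∀ u s v, l = u ++ s :: v → ∀ t, Adj α s t →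
      k t + u.count t = k s + u.count s + e t s) : AltFrom α e k l := by
  induction l generalizing k with
  | nil => trivial
  | cons s l ih =>
    refine ⟨fun t ht => by simpa using h [] s l rfl t ht, ih fun u r v hl t ht => ?_⟩
    have := h (s :: u) r v (by rw [hl]; rfl) t ht
    simp only [List.count_cons, beq_iff_eq] at this
    simp only [incr]
    omega

theorem AltFrom.shift {k : S → ℕ} {l : List S} (h : AltFrom α e k l) (n : ℕ) :
    AltFrom α e (fun t => k t + n) l :=
  altFrom_of_forall fun u s v hl t ht => by
    have := (hl ▸ h).apply ht
    omega

theorem incr_comm (k : S → ℕ) (s t : S) : incr (incr k s) t = incr (incr k t) s := by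
  ext r; simp only [incr]; ring

theorem AltFrom.swap {k : S → ℕ} {u v : List S} {s t : S} (hst : ¬Adj α s t)
    (h : AltFrom α e k (u ++ s :: t :: v)) : AltFrom α e k (u ++ t :: s :: v) := by
  rw [altFrom_append] at h ⊢
  by_cases hne : s = t
  · subst hne; exact h
  obtain ⟨h1, h2, h3, h4⟩ := h
  refine ⟨h1, fun r hr => ?_, fun r hr => ?_, incr_comm _ s t ▸ h4⟩
  · have h5 : s ≠ r := by rintro rfl; exact hst hr.symm
    have := h3 r hr
    simpa [incr, h5, hne] using this
  · have h5 : t ≠ r := by rintro rfl; exact hst hr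
    simpa [incr, h5, Ne.symm hne] using h2 r hr

theorem AltFrom.of_commutationEquiv {k : S → ℕ} {u v : List S} (h : AltFrom α e k u)
    (huv : CommutationEquiv α u v) : AltFrom α e k v := by
  induction huv with
  | refl => exact h
  | tail _ hstep ih =>
    obtain ⟨x, y, s, t, hst⟩ := hstep
    exact ih.swap (not_adj_of_commute hst)

/-- Alternating words with the same letter counts are equal up to commutations. -/
theorem AltFrom.commutationEquiv (he : ∀ s t, Adj α s t → e s t + e t s = 1) {k : S → ℕ}
    {u v : List S} (hu : AltFrom α e k u) (hv : AltFrom α e k v)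
    (huv : ∀ t, u.count t = v.count t) : CommutationEquiv α u v := by
  induction u generalizing k v with
  | nil =>
    have : v = [] := List.eq_nil_iff_forall_not_mem.2 fun t ht => by
      have h1 := huv t
      have h2 := List.count_pos_iff.2 ht
      simp at h1
      exact (h1 ▸ h2).ne rfl
    rw [this]
    exact Relation.ReflTransGen.refl
  | cons s u ih =>
    have hs : s ∈ v := by
      rw [← List.count_pos_iff, ← huv s, List.count_pos_iff]; exact List.mem_cons_self
    obtain ⟨x, y, rfl, hx⟩ := List.eq_append_cons_of_mem hs
    -- The word `u` can start with `s`, whereas an adjacent `t` before the first `s` of `v` would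
    -- require `t` to be allowed before `s` from the same counts; this contradicts `e s t + e t s =
    -- 1`.
    have hadj : ∀ t ∈ x, ¬Adj α s t := by
      intro t ht hst
      obtain ⟨x₁, x₂, rfl⟩ := List.append_of_mem ht
      have h1 := hu.1 t hst
      have h2 := (by simpa using hv : AltFrom α e k (x₁ ++ t :: (x₂ ++ s :: y))).apply hst.symm
      have h3 : x₁.count s = 0 := List.count_eq_zero.2 fun h => hx (by simp [h])
      have := he s t hst
      omega
    have hv' : AltFrom α e k (s :: (x ++ y)) := by
      clear ih hu huv hs hx
      induction x generalizing k with
      | nil => exact hv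
      | cons t x ihx =>
        simp only [List.mem_cons, forall_eq_or_imp] at hadj
        have h1 := ihx hv.2 hadj.2
        exact AltFrom.swap (u := []) (fun h => hadj.1 h.symm) ⟨hv.1, h1⟩
    refine ((ih hu.2 hv'.2 fun t => ?_).cons s).trans (commutationEquiv_move y hadj)
    have := huv t
    simp only [List.count_cons, List.count_append] at this ⊢
    omega

/-- The letter counts of alternating words. -/
def IsAltCount (α : Module.Basis S ℝ V) (e : S → S → ℕ) (p : S → ℕ) : Prop :=
  ∀ s t, Adj α s t → e s t = 1 → p t ≤ p s ∧ p s ≤ p t + 1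

theorem AltFrom.isAltCount (he : ∀ s t, Adj α s t → e s t + e t s = 1) {k : S → ℕ} {l : List S}
    (h : AltFrom α e k l) (hk : IsAltCount α e k) : IsAltCount α e (addCount k l) := by
  induction l generalizing k with
  | nil => rwa [addCount_nil]
  | cons r l ih =>
    rw [addCount_cons]
    refine ih h.2 fun s t hst h1 => ?_
    have h2 := hk s t hst h1
    have h3 := he s t hst
    simp only [incr]
    by_cases hr : r = s
    · subst hr
      have := h.1 t hst
      simp only [if_true, if_neg hst.1]
      omega
    · by_cases hr' : r = t
      · subst hr'
        have := h.1 s hst.symm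
        simp only [if_true, if_neg hr]
        omega
      · simp only [if_neg hr, if_neg hr']
        omega

/-- The subword of the first `p s` letters `s`, for all `s`. -/
def lowPart (p : S → ℕ) : (S → ℕ) → List S → List S
  | _, [] => []
  | k, s :: l => if k s < p s then s :: lowPart p (incr k s) l else lowPart p (incr k s) l

/-- The subword complementary to `lowPart`. -/
def highPart (p : S → ℕ) : (S → ℕ) → List S → List S
  | _, [] => []
  | k, s :: l => if k s < p s then highPart p (incr k s) l else s :: highPart p (incr k s) l

theorem lowPart_append (p k : S → ℕ) (u v : List S) :
    lowPart p k (u ++ v) = lowPart p k u ++ lowPart p (addCount k u) v := by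
  induction u generalizing k with
  | nil => simp [lowPart, addCount_nil]
  | cons s u ih =>
    simp only [List.cons_append, lowPart, ih, addCount_cons]
    split_ifs <;> simp

theorem count_lowPart (p k : S → ℕ) (l : List S) (t : S) :
    (lowPart p k l).count t + min (p t) (k t) = min (p t) (k t + l.count t) := by
  induction l generalizing k with
  | nil => simp [lowPart]
  | cons s l ih =>
    have := ih (incr k s)
    rw [lowPart]
    by_cases h : s = t
    · subst h
      simp only [incr, if_true] at this
      split_ifs <;> simp <;> omega
    · simp only [incr, if_neg h] at this
      split_ifs <;> simp [h] <;> omega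

theorem count_highPart (p k : S → ℕ) (l : List S) (t : S) :
    (highPart p k l).count t + max (p t) (k t) = max (p t) (k t + l.count t) := by
  induction l generalizing k with
  | nil => simp [highPart]
  | cons s l ih =>
    have := ih (incr k s)
    rw [highPart]
    by_cases h : s = t
    · subst h
      simp only [incr, if_true] at this
      split_ifs <;> simp <;> omega
    · simp only [incr, if_neg h] at this
      split_ifs <;> simp [h] <;> omega

/-- Cutting the letter counts off at an alternating `p` keeps the alternation. With the dual
statement for `highPart`, an alternating word can be rearranged into its first `p s` letters `s`
followed by the rest. -/
theorem AltFrom.lowPart (he : ∀ s t, Adj α s t → e s t + e t s = 1) {p k : S → ℕ}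
    (hp : IsAltCount α e p) {l : List S} (h : AltFrom α e k l) :
    AltFrom α e (fun t => min (p t) (k t)) (lowPart p k l) := by
  induction l generalizing k with
  | nil => trivial
  | cons s l ih =>
    rw [BrickPolytope.lowPart]
    have ih := ih h.2
    split_ifs with hs
    · refine ⟨fun t ht => ?_, ?_⟩
      · have h1 := h.1 t ht
        have h2 := he s t ht
        have h3 := hp s t ht
        have h4 := hp t s ht.symm
        simp only
        omega
      · convert ih using 1
        ext t
        simp only [incr]
        split_ifs with h1
        · subst h1; omega
        · rfl
    · convert ih using 1
      ext t
      simp only [incr]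
      split_ifs with h1
      · subst h1; omega
      · rfl

theorem AltFrom.highPart (he : ∀ s t, Adj α s t → e s t + e t s = 1) {p k : S → ℕ}
    (hp : IsAltCount α e p) {l : List S} (h : AltFrom α e k l) :
    AltFrom α e (fun t => max (p t) (k t)) (highPart p k l) := by
  induction l generalizing k with
  | nil => trivial
  | cons s l ih =>
    rw [BrickPolytope.highPart]
    have ih := ih h.2
    split_ifs with hs
    · convert ih using 1
      ext t
      simp only [incr]
      split_ifs with h1
      · subst h1; omega
      · rfl
    · refine ⟨fun t ht => ?_, ?_⟩
      · have h1 := h.1 t ht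
        have h2 := he s t ht
        have h3 := hp s t ht
        have h4 := hp t s ht.symm
        simp only
        omega
      · convert ih using 1
        ext t
        simp only [incr]
        split_ifs with h1
        · subst h1; omega
        · rfl

end Alternating

/-! ### Powers of the Coxeter element, and the sorting word of the longest element -/

section Coxeter

variable {S V : Type*} [Fintype S] [DecidableEq S] [NormedAddCommGroup V] [InnerProductSpace ℝ V]
variable {α : Module.Basis S ℝ V} {c : V ≃ₗᵢ[ℝ] V} {cw : List S}

theorem repr_wordProd_of_notMem {t : S} {l : List S} (h : t ∉ l) (x : V) :
    α.repr (wordProd α l x) t = α.repr x t := by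
  induction l with
  | nil => rfl
  | cons s l ih =>
    simp only [List.mem_cons, not_or] at h
    rw [wordProd_cons, isom_mul_apply, repr_simpleReflection_of_ne h.1, ih h.2]

/-- With distinct letters, only the first letter `s` changes the coordinate at `s`. A fixed vector
is thus fixed by the rest of the word and orthogonal to `α s`, and induction applies. -/
theorem inner_eq_zero_of_wordProd_eq {l : List S} (hl : l.Nodup) {x : V}
    (h : wordProd α l x = x) : ∀ s ∈ l, ⟪α s, x⟫ = 0 := by
  induction l with
  | nil => simp
  | cons s l ih =>
    obtain ⟨hs, hl⟩ := List.nodup_cons.1 hl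
    rw [wordProd_cons, isom_mul_apply, simpleReflection_eq, rootReflection_apply] at h
    have h1 := congrArg (fun y => α.repr y s) h
    simp only [map_sub, map_smul, Finsupp.coe_sub, Pi.sub_apply, repr_wordProd_of_notMem hs,
      Module.Basis.repr_self, Finsupp.coe_smul, Pi.smul_apply, Finsupp.single_eq_same,
      smul_eq_mul, mul_one, sub_eq_self] at h1
    rw [h1, zero_smul, sub_zero] at h
    rw [h, div_eq_zero_iff] at h1
    have h2 : ⟪α s, x⟫ = 0 := by
      rcases h1 with h1 | h1
      · linarith
      · exact absurd h1 (inner_simple_self_pos α s).ne'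
    simp only [List.mem_cons, forall_eq_or_imp]
    exact ⟨h2, ih hl h⟩

theorem eq_zero_of_coxeter_apply_eq (hc : IsCoxeterElement α c) {x : V} (h : c x = x) : x = 0 := by
  obtain ⟨l, hl, hall, rfl⟩ := hc
  refine eq_of_inner_simple_eq (α := α) fun s => ?_
  rw [inner_eq_zero_of_wordProd_eq hl h s (hall s), inner_zero_right]

/-- If a letter `s` were missing, `c` would fix `ω_s`, but it fixes no nonzero vector. Being no
longer than the defining word, a reduced expression then has no room for repetitions. -/
theorem IsCoxeterElement.nodup_and_mem (hc : IsCoxeterElement α c) (hcw : IsReducedExpr α cw c) :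
    cw.Nodup ∧ ∀ s, s ∈ cw := by
  have hmem : ∀ s, s ∈ cw := by
    intro s
    by_contra hs
    have h1 := wordProd_weight_of_notMem (α := α) hs
    rw [hcw.1] at h1
    have h2 := eq_zero_of_coxeter_apply_eq hc h1
    have h3 := inner_weight_self_pos (α := α) s
    rw [h2, inner_zero_right] at h3
    exact lt_irrefl _ h3
  refine ⟨?_, hmem⟩
  obtain ⟨l, hl, hall, rfl⟩ := hc
  have h1 : cw.length ≤ l.length := hcw.2 ▸ length_wordProd_le l
  have h2 : cw.toFinset = l.toFinset := by ext s; simp [hmem, hall]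
  have h3 := List.toFinset_card_of_nodup hl
  rw [← h2] at h3
  have h4 := List.toFinset_card_le cw
  have h5 : (cw : Multiset S).toFinset.card = (cw : Multiset S).card :=
    le_antisymm h4 (by simpa using h1.trans h3.ge)
  exact Multiset.coe_nodup.1 (Multiset.toFinset_card_eq_card_iff_nodup.1 h5)

theorem repr_wordProd_simple_self {s : S} {x : List S} (h : s ∉ x) :
    α.repr (wordProd α x (α s)) s = 1 := by
  rw [repr_wordProd_of_notMem h]; simp

theorem repr_wordProd_simple_of_notMem {s t : S} {x : List S} (h : t ∉ x) (hts : t ≠ s) :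
    α.repr (wordProd α x (α s)) t = 0 := by
  rw [repr_wordProd_of_notMem h]; simp [hts]

theorem wordProd_simple_mem_posRoots (hα : IsSimpleSystem α) {s : S} {x : List S} (h : s ∉ x) :
    wordProd α x (α s) ∈ posRoots α :=
  mem_posRoots_of_repr_pos hα (apply_mem_roots (wordProd_mem α x) (simple_mem_roots α s))
    (by rw [repr_wordProd_simple_self h]; exact one_pos)

/-- With disjoint supports, only products of distinct simple roots contribute; all of these are
nonpositive, and the adjacent pair `i`, `j` contributes strictly. -/
theorem inner_neg_of_disjoint (hα : IsSimpleSystem α) {u v : V} (hu : ∀ s, 0 ≤ α.repr u s)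
    (hv : ∀ s, 0 ≤ α.repr v s) (huv : ∀ s, α.repr u s = 0 ∨ α.repr v s = 0) {i j : S}
    (hi : 0 < α.repr u i) (hj : 0 < α.repr v j) (hij : Adj α i j) : ⟪u, v⟫ < 0 := by
  have h : ∀ s t, α.repr u s * (α.repr v t * ⟪α s, α t⟫) ≤ 0 := by
    intro s t
    by_cases hst : s = t
    · subst hst
      rcases huv s with h | h <;> simp [h]
    · exact mul_nonpos_of_nonneg_of_nonpos (hu s)
        (mul_nonpos_of_nonneg_of_nonpos (hv t) (inner_simple_nonpos hα hst))
  rw [← α.sum_repr u, ← α.sum_repr v]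
  simp only [sum_inner, inner_sum, real_inner_smul_left, real_inner_smul_right]
  have h' : ∀ t s, α.repr v t * (α.repr u s * ⟪α s, α t⟫) ≤ 0 := fun t s =>
    (mul_left_comm _ _ _).trans_le (h s t)
  refine Finset.sum_neg' (fun t _ => Finset.sum_nonpos fun s _ => h' t s) ⟨j, Finset.mem_univ _, ?_⟩
  refine Finset.sum_neg' (fun s _ => h' j s) ⟨i, Finset.mem_univ _, ?_⟩
  rw [mul_left_comm]
  exact mul_neg_of_pos_of_neg hi
    (mul_neg_of_pos_of_neg hj (lt_of_le_of_ne (inner_simple_nonpos hα hij.1) hij.2))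

/-- The root `(1 - c)(ω_s)`, i.e. `s₁ ⋯ sᵢ₋₁(α_{sᵢ})` for `c = s₁ ⋯ sₙ` and `s = sᵢ`. -/
noncomputable def coxRoot (α : Module.Basis S ℝ V) (c : V ≃ₗᵢ[ℝ] V) (s : S) : V :=
  weight α s - c (weight α s)

open Classical in
/-- For adjacent letters, this is `1` if `t` comes before `s` in `c` and `0` otherwise. -/
noncomputable def coxBefore (α : Module.Basis S ℝ V) (c : V ≃ₗᵢ[ℝ] V) (t s : S) : ℕ :=
  if 0 < α.repr (coxRoot α c s) t then 1 else 0

theorem coxRoot_eq {x y : List S} {s : S} (hc : wordProd α (x ++ s :: y) = c)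
    (hnd : (x ++ s :: y).Nodup) : coxRoot α c s = wordProd α x (α s) := by
  have hx : s ∉ x := fun h => (List.disjoint_of_nodup_append hnd) h List.mem_cons_self
  have hy : s ∉ y := (List.nodup_cons.1 hnd.of_append_right).1
  rw [coxRoot, ← hc, wordProd_append, wordProd_cons, isom_mul_apply, isom_mul_apply,
    wordProd_weight_of_notMem hy, simpleReflection_weight_self, map_sub,
    wordProd_weight_of_notMem hx, sub_sub_cancel]

/-- Shows that `coxBefore` reads the order of adjacent letters off any such word for `c`. If `x = x₁
t x₂`, then `x₂(α_s)` has no coordinate at `t` but a negative product with `α t`, so the letter `t`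
creates a positive coordinate, which `x₁` leaves alone. -/
theorem coxBefore_eq (hα : IsSimpleSystem α) {x y : List S} {s t : S}
    (hc : wordProd α (x ++ s :: y) = c) (hnd : (x ++ s :: y).Nodup) (hst : Adj α s t) :
    coxBefore α c t s = if t ∈ x then 1 else 0 := by
  have hx : s ∉ x := fun h => (List.disjoint_of_nodup_append hnd) h List.mem_cons_self
  rw [coxBefore, coxRoot_eq hc hnd]
  by_cases ht : t ∈ x
  · rw [if_pos ht, if_pos]
    obtain ⟨x₁, x₂, rfl⟩ := List.append_of_mem ht
    have hnd' := (List.nodup_append.1 hnd).1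
    have ht1 : t ∉ x₁ := fun h => (List.disjoint_of_nodup_append hnd') h List.mem_cons_self
    have ht2 : t ∉ x₂ := (List.nodup_cons.1 hnd'.of_append_right).1
    have hs2 : s ∉ x₂ := fun h => hx (by simp [h])
    rw [wordProd_append, isom_mul_apply, repr_wordProd_of_notMem ht1, wordProd_cons,
      isom_mul_apply, simpleReflection_eq, rootReflection_apply]
    have h1 : ⟪α t, wordProd α x₂ (α s)⟫ < 0 := by
      refine inner_neg_of_disjoint hα (simple_mem_posRoots α t).2
        (wordProd_simple_mem_posRoots hα hs2).2 (i := t) (j := s) (fun r => ?_) (by simp)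
        (by rw [repr_wordProd_simple_self hs2]; exact one_pos) hst.symm
      by_cases hr : r = t
      · subst hr
        exact Or.inr (repr_wordProd_simple_of_notMem ht2 hst.1.symm)
      · left; simp [hr]
    have h2 := inner_simple_self_pos α t
    simp only [map_sub, map_smul, Finsupp.coe_sub, Pi.sub_apply,
      repr_wordProd_simple_of_notMem ht2 hst.1.symm, Module.Basis.repr_self, Finsupp.coe_smul,
      Pi.smul_apply, Finsupp.single_eq_same, smul_eq_mul, mul_one, zero_sub, neg_pos]
    exact div_neg_of_neg_of_pos (by linarith) h2
  · rw [if_neg ht, if_neg]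
    rw [repr_wordProd_simple_of_notMem ht hst.1.symm]
    exact lt_irrefl _

theorem coxBefore_add (hα : IsSimpleSystem α) (hc : IsCoxeterElement α c) (s t : S)
    (hst : Adj α s t) : coxBefore α c s t + coxBefore α c t s = 1 := by
  obtain ⟨l, hl, hall, rfl⟩ := hc
  obtain ⟨x, y, rfl⟩ := List.append_of_mem (hall s)
  have ht := hall t
  simp only [List.mem_append, List.mem_cons, hst.1.symm, false_or] at ht
  rw [coxBefore_eq (t := t) hα rfl hl hst]
  rcases ht with ht | ht
  · obtain ⟨x₁, x₂, rfl⟩ := List.append_of_mem ht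
    have e : x₁ ++ t :: x₂ ++ s :: y = x₁ ++ t :: (x₂ ++ s :: y) := by simp
    rw [e] at hl ⊢
    rw [if_pos ht, coxBefore_eq (t := s) hα rfl hl hst.symm, if_neg]
    intro h
    exact (List.disjoint_of_nodup_append hl) h (by simp)
  · have htx : t ∉ x := fun h => (List.disjoint_of_nodup_append hl) h (by simp [ht])
    obtain ⟨y₁, y₂, rfl⟩ := List.append_of_mem ht
    have e : x ++ s :: (y₁ ++ t :: y₂) = (x ++ s :: y₁) ++ t :: y₂ := by simp
    rw [e] at hl ⊢
    rw [if_neg htx, coxBefore_eq (t := s) hα rfl hl hst.symm, if_pos (by simp)]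

theorem altFrom_coxeterWord (hα : IsSimpleSystem α) (hc : wordProd α cw = c) (hnd : cw.Nodup) :
    AltFrom α (coxBefore α c) (fun _ => 0) cw := by
  refine altFrom_of_forall fun u s v hl t ht => ?_
  subst hl
  rw [coxBefore_eq hα hc hnd ht]
  have hs : s ∉ u := fun h => (List.disjoint_of_nodup_append hnd) h List.mem_cons_self
  rw [List.count_eq_zero.2 hs, (List.nodup_append.1 hnd).1.count]

theorem coxRoot_mem_posRoots (hα : IsSimpleSystem α) (hc : IsCoxeterElement α c) (s : S) :
    coxRoot α c s ∈ posRoots α := by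
  obtain ⟨l, hl, hall, rfl⟩ := hc
  obtain ⟨x, y, rfl⟩ := List.append_of_mem (hall s)
  rw [coxRoot_eq rfl hl]
  exact wordProd_simple_mem_posRoots hα fun h =>
    (List.disjoint_of_nodup_append hl) h List.mem_cons_self

theorem isom_mul_pow_apply (c : V ≃ₗᵢ[ℝ] V) (m n : ℕ) (x : V) :
    (c ^ m) ((c ^ n) x) = (c ^ (m + n)) x := by
  rw [pow_add, isom_mul_apply]

/-- The root of a letter from the weights of this letter and the adjacent ones. -/
theorem apply_simple_eq_of_apply_weight (hα : IsSimpleSystem α) (hc : IsCoxeterElement α c)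
    {σ : V →ₗ[ℝ] V} {s : S} {n : ℕ} (hs : σ (weight α s) = (c ^ n) (weight α s))
    (ht : ∀ t, Adj α s t → σ (weight α t) = (c ^ (n + coxBefore α c t s)) (weight α t)) :
    σ (α s) = (c ^ n) (coxRoot α c s) := by
  obtain ⟨l, hl, hall, rfl⟩ := hc
  obtain ⟨x, y, rfl⟩ := List.append_of_mem (hall s)
  rw [coxRoot_eq rfl hl]
  -- In the basis of weights, `α s` involves only `ω_s` and the weights of letters adjacent to `s`,
  -- whose images are prescribed.
  conv_lhs => rw [eq_sum_weight α (α s)]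
  conv_rhs => rw [eq_sum_weight α (α s)]
  simp only [map_sum, map_smul]
  refine Finset.sum_congr rfl fun t _ => ?_
  by_cases hts : t = s
  · subst hts
    rw [hs, wordProd_weight_of_notMem fun h =>
      (List.disjoint_of_nodup_append hl) h List.mem_cons_self]
  by_cases hadj : Adj α s t
  · rw [ht t hadj, coxBefore_eq hα rfl hl hadj]
    congr 1
    split_ifs with htx
    · rw [← isom_mul_pow_apply, pow_one]
      congr 1
      rw [wordProd_append, isom_mul_apply, wordProd_weight_of_notMem fun h =>
        (List.disjoint_of_nodup_append hl) htx h]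
    · rw [add_zero, wordProd_weight_of_notMem htx]
  · have : ⟪α t, α s⟫ = 0 := by
      by_contra h
      exact hadj ⟨Ne.symm hts, by rwa [real_inner_comm]⟩
    simp [this]

/-- A further letter `s` affects only `ω_s`, replacing it by `ω_s - α s`. Alternation fixes the
exponents at the adjacent letters, so the word before it sends `α s` to `c^n(1 - c)ω_s`, and the
exponent at `s` rises from `n` to `n + 1`. -/
theorem AltFrom.wordProd_weight (hα : IsSimpleSystem α) (hc : IsCoxeterElement α c) {l : List S}
    (h : AltFrom α (coxBefore α c) (fun _ => 0) l) (t : S) :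
    wordProd α l (weight α t) = (c ^ l.count t) (weight α t) := by
  induction l using List.reverseRecOn generalizing t with
  | nil => simp [isom_one_apply]
  | append_singleton l s ih =>
    have ih := ih (altFrom_append.1 h).1
    rw [wordProd_concat, isom_mul_apply]
    by_cases hst : s = t
    · subst hst
      have h1 := apply_simple_eq_of_apply_weight hα hc (s := s)
        (σ := (wordProd α l).toLinearEquiv.toLinearMap) (n := l.count s) (ih s) fun t ht => by
        have := h.apply ht
        simp only [zero_add] at this
        rw [← this]
        exact ih t
      have h1' : wordProd α l (α s) = (c ^ l.count s) (coxRoot α c s) := h1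
      rw [simpleReflection_weight_self, map_sub, ih, h1', coxRoot, map_sub, sub_sub_cancel]
      simp [pow_succ, isom_mul_apply]
    · rw [simpleReflection_weight_of_ne hst, ih]
      simp [hst]

theorem AltFrom.wordProd_simple (hα : IsSimpleSystem α) (hc : IsCoxeterElement α c)
    {u v : List S} {s : S} (h : AltFrom α (coxBefore α c) (fun _ => 0) (u ++ s :: v)) :
    wordProd α u (α s) = (c ^ u.count s) (coxRoot α c s) := by
  have hu := (altFrom_append.1 h).1
  refine apply_simple_eq_of_apply_weight hα hc
    (σ := (wordProd α u).toLinearEquiv.toLinearMap) (hu.wordProd_weight hα hc s) fun t ht => ?_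
  have := h.apply ht
  simp only [zero_add] at this
  rw [← this]
  exact hu.wordProd_weight hα hc t

/-! ### The numbers of letters in the sorting word -/

/-- The least `k` such that the root `cᵏ(1 - c)(ω_s)` is negative. -/
noncomputable def coxHeight (α : Module.Basis S ℝ V) (c : V ≃ₗᵢ[ℝ] V) (s : S) : ℕ :=
  sInf {k | (c ^ k) (coxRoot α c s) ∉ posRoots α}

theorem pow_coxRoot_mem_posRoots {s : S} {k : ℕ} (h : k < coxHeight α c s) :
    (c ^ k) (coxRoot α c s) ∈ posRoots α :=
  not_not.1 (Nat.notMem_of_lt_sInf h)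

theorem IsCoxeterElement.mem (hc : IsCoxeterElement α c) : c ∈ reflectionGroup α := by
  obtain ⟨l, -, -, rfl⟩ := hc
  exact wordProd_mem α l

theorem sum_pow_coxRoot (s : S) (n : ℕ) :
    ∑ k ∈ Finset.range n, (c ^ k) (coxRoot α c s) = weight α s - (c ^ n) (weight α s) := by
  induction n with
  | zero => simp [isom_one_apply]
  | succ n ih =>
    rw [Finset.sum_range_succ, ih, coxRoot, map_sub, pow_succ, isom_mul_apply]
    abel

/-- Over a period of `c` the sum of these roots telescopes to `0`, but positive roots have positive
product with `q`. -/
theorem exists_pow_coxRoot_notMem (hα : IsSimpleSystem α) (hc : IsCoxeterElement α c) (s : S) :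
    ∃ k, (c ^ k) (coxRoot α c s) ∉ posRoots α := by
  by_contra! h
  have : Finite (reflectionGroup α) := hα.finite
  obtain ⟨n, hn, hcn⟩ := (isOfFinOrder_of_finite
    (⟨c, hc.mem⟩ : reflectionGroup α)).exists_pow_eq_one
  have hcn' : c ^ n = 1 := congrArg Subtype.val hcn
  have h1 := sum_pow_coxRoot (α := α) (c := c) s n
  rw [hcn', isom_one_apply, sub_self] at h1
  have h2 := congrArg (fun x => ⟪x, balancedPoint α⟫) h1
  simp only [sum_inner, inner_zero_left] at h2
  have h3 : ∀ β ∈ posRoots α, 0 < ⟪β, balancedPoint α⟫ := fun β hβ =>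
    inner_pos_of_posRoot hβ fun s => by
      rw [inner_balancedPoint]; exact half_pos (inner_simple_self_pos α s)
  exact (Finset.sum_pos (fun k _ => h3 _ (h k)) (by simp; omega)).ne' h2

theorem inversions_wordProd_subset (hα : IsSimpleSystem α) {l : List S} {β : V}
    (h : β ∈ inversions α (wordProd α l)) :
    ∃ u s v, l = u ++ s :: v ∧ β = wordProd α u (α s) := by
  induction l using List.reverseRecOn with
  | nil => exact absurd h.2 (neg_notMem_posRoots h.1)
  | append_singleton l s ih =>
    rw [wordProd_concat] at h
    rcases inversions_mul_subset hα (wordProd_mem α l) s h with h | h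
    · exact ⟨l, s, [], rfl, h⟩
    · obtain ⟨u, t, v, rfl, h1⟩ := ih h
      exact ⟨u, t, v ++ [s], by simp, h1⟩

/-- At the first negative power, the negated root is an inversion of `c`, hence equal to `(1 -
c)ω_t` for some `t`. So `c^k(ω_s) + ω_t`, with `k` the height, is fixed by `c` and vanishes. -/
theorem exists_pow_coxHeight_weight (hα : IsSimpleSystem α) (hc : IsCoxeterElement α c) (s : S) :
    ∃ t, (c ^ coxHeight α c s) (weight α s) = -weight α t := by
  have h1 : (c ^ coxHeight α c s) (coxRoot α c s) ∉ posRoots α :=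
    Nat.sInf_mem (exists_pow_coxRoot_notMem hα hc s)
  have hr := apply_mem_roots (pow_mem hc.mem (coxHeight α c s)) (coxRoot_mem_posRoots hα hc s).1
  rw [notMem_posRoots_iff hα hr] at h1
  obtain ⟨m, hm⟩ : ∃ m, coxHeight α c s = m + 1 := by
    refine Nat.exists_eq_succ_of_ne_zero fun h0 => ?_
    rw [h0, pow_zero, isom_one_apply] at h1
    exact neg_notMem_posRoots (coxRoot_mem_posRoots hα hc s) h1
  have h2 := pow_coxRoot_mem_posRoots (α := α) (c := c) (s := s) (k := m) (by omega)
  have h3 : -(c ^ coxHeight α c s) (coxRoot α c s) ∈ inversions α c := by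
    refine ⟨h1, ?_⟩
    rw [hm, pow_succ', isom_mul_apply, map_neg, isom_inv_apply_self, neg_neg]
    exact h2
  obtain ⟨l, hl, hall, hlc⟩ := hc
  rw [← hlc] at h3
  obtain ⟨u, t, v, rfl, h4⟩ := inversions_wordProd_subset hα h3
  rw [hlc, ← coxRoot_eq hlc hl] at h4
  refine ⟨t, eq_neg_of_add_eq_zero_left
    (eq_zero_of_coxeter_apply_eq ⟨_, hl, hall, hlc⟩ ?_)⟩
  rw [coxRoot, coxRoot, map_sub, neg_sub] at h4
  have h5 : c ((c ^ coxHeight α c s) (weight α s)) =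
      (c ^ coxHeight α c s) (c (weight α s)) := by
    rw [← isom_mul_apply, ← isom_mul_apply, ← pow_succ, ← pow_succ']
  rw [map_add, h5, sub_eq_sub_iff_add_eq_add.1 h4, add_comm]

theorem inner_coxRoot_weight_pos {s t : S} (h : coxBefore α c s t = 1) :
    0 < ⟪coxRoot α c t, weight α s⟫ := by
  rw [inner_weight_pos_iff]
  by_contra hn
  rw [coxBefore, if_neg hn] at h
  exact zero_ne_one h

/-- Move `c` to the other factor: `c⁻¹ω_t` is `ω_t` minus a positive root supported on `t` and the
letters after it. The root of `s` is supported on `s` and the letters before it, so the supports are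
disjoint and joined by the edge from `s` to `t`. -/
theorem inner_apply_coxRoot_weight_pos (hα : IsSimpleSystem α) (hc : IsCoxeterElement α c)
    {s t : S} (hst : Adj α s t) (h : coxBefore α c s t = 1) :
    0 < ⟪c (coxRoot α c s), weight α t⟫ := by
  obtain ⟨l, hl, hall, rfl⟩ := hc
  obtain ⟨z, z', rfl⟩ := List.append_of_mem (hall t)
  rw [coxBefore_eq hα rfl hl hst.symm] at h
  have hs : s ∈ z := by by_contra hs; rw [if_neg hs] at h; exact zero_ne_one h
  obtain ⟨x, z₂, rfl⟩ := List.append_of_mem hs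
  have e : x ++ s :: z₂ ++ t :: z' = x ++ s :: (z₂ ++ t :: z') := by simp
  have hroot : coxRoot α (wordProd α (x ++ s :: z₂ ++ t :: z')) s = wordProd α x (α s) :=
    coxRoot_eq (by rw [e]) (e ▸ hl)
  have htz : t ∉ x ++ s :: z₂ := fun h =>
    (List.disjoint_of_nodup_append hl) h List.mem_cons_self
  have htz' : t ∉ z' := (List.nodup_cons.1 hl.of_append_right).1
  have htx : t ∉ x := fun h => htz (by simp [h])
  have hsx : s ∉ x := fun h =>
    (List.disjoint_of_nodup_append (List.nodup_append.1 hl).1) h List.mem_cons_self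
  have hrev : ∀ l : List S, (wordProd α l)⁻¹ = wordProd α l.reverse := by
    intro l
    induction l with
    | nil => simp
    | cons r l ih => rw [wordProd_cons, mul_inv_rev, ih, simpleReflection_inv, List.reverse_cons,
        wordProd_concat]
  have hinv : (wordProd α (x ++ s :: z₂ ++ t :: z'))⁻¹ (weight α t) =
      weight α t - wordProd α z'.reverse (α t) := by
    rw [wordProd_append, mul_inv_rev, isom_mul_apply, hrev (x ++ s :: z₂),
      wordProd_weight_of_notMem (by rwa [List.mem_reverse]), wordProd_cons, mul_inv_rev, isom_mul_apply,
      simpleReflection_inv, simpleReflection_weight_self, hrev, map_sub,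
      wordProd_weight_of_notMem (by simpa using htz')]
  rw [hroot, inner_isom_left, hinv, inner_sub_right, inner_weight_right,
    repr_wordProd_simple_of_notMem htx hst.1.symm, zero_mul, zero_sub, neg_pos]
  refine inner_neg_of_disjoint hα (wordProd_simple_mem_posRoots hα hsx).2
    (wordProd_simple_mem_posRoots hα (by simpa using htz')).2 (i := s) (j := t) (fun r => ?_)
    (by rw [repr_wordProd_simple_self hsx]; exact one_pos)
    (by rw [repr_wordProd_simple_self (by simpa using htz')]; exact one_pos) hst
  by_cases hr : r ∈ x ++ s :: z₂
  · right
    refine repr_wordProd_simple_of_notMem ?_ (fun h => htz (h ▸ hr))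
    rw [List.mem_reverse]
    exact fun h => (List.disjoint_of_nodup_append hl) hr (List.mem_cons_of_mem _ h)
  · left
    exact repr_wordProd_simple_of_notMem (fun h => hr (by simp [h])) (fun h => hr (by simp [h]))

/-- If the height of `t` exceeded the height `k` of `s`, then `c^k(1 - c)ω_t` would be positive and
pair nonnegatively with the fundamental weight `-c^k(ω_s)`. Cancelling `c^k` contradicts the
positivity of the coordinate at `s`. The other bound uses one more power of `c`. -/
theorem isAltCount_coxHeight (hα : IsSimpleSystem α) (hc : IsCoxeterElement α c) :
    IsAltCount α (coxBefore α c) (coxHeight α c) := by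
  intro s t hst h
  constructor
  · by_contra! hlt
    obtain ⟨r, hr⟩ := exists_pow_coxHeight_weight hα hc s
    have h1 := inner_weight_nonneg (pow_coxRoot_mem_posRoots hlt).2 r
    rw [← neg_neg (weight α r), ← hr, inner_neg_right, LinearIsometryEquiv.inner_map_map] at h1
    have := inner_coxRoot_weight_pos h
    linarith
  · by_contra! hlt
    obtain ⟨r, hr⟩ := exists_pow_coxHeight_weight hα hc t
    have h1 := inner_weight_nonneg (pow_coxRoot_mem_posRoots hlt).2 r
    rw [← neg_neg (weight α r), ← hr, inner_neg_right, pow_succ, isom_mul_apply,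
      LinearIsometryEquiv.inner_map_map] at h1
    have := inner_apply_coxRoot_weight_pos hα hc hst h
    linarith

theorem AltFrom.isPosWord (hα : IsSimpleSystem α) (hc : IsCoxeterElement α c) {l : List S}
    (h : AltFrom α (coxBefore α c) (fun _ => 0) l) (hl : ∀ t, l.count t ≤ coxHeight α c t) :
    IsPosWord α l := by
  intro u s v huv
  rw [huv] at h
  rw [h.wordProd_simple hα hc]
  refine pow_coxRoot_mem_posRoots (lt_of_lt_of_le ?_ (hl s))
  rw [huv]
  simp

theorem neg_apply_simple_mem_posRoots (hα : IsSimpleSystem α) {w : V ≃ₗᵢ[ℝ] V}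
    (hw : w ∈ reflectionGroup α) {s t : S} (h : w (weight α s) = -weight α t) :
    -w (α s) ∈ posRoots α := by
  refine (mem_posRoots_or_neg hα (apply_mem_roots hw (simple_mem_roots α s))).resolve_left
    fun h1 => ?_
  have h2 := inner_weight_nonneg h1.2 t
  rw [← neg_neg (weight α t), ← h, inner_neg_right, LinearIsometryEquiv.inner_map_map] at h2
  have := inner_weight_self_pos (α := α) s
  linarith

theorem AltFrom.isReducedExpr (hα : IsSimpleSystem α) (hc : IsCoxeterElement α c)
    {w₀ : V ≃ₗᵢ[ℝ] V} (hw₀ : IsLongest α w₀) {l : List S}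
    (h : AltFrom α (coxBefore α c) (fun _ => 0) l) (hl : ∀ t, l.count t = coxHeight α c t) :
    IsReducedExpr α l w₀ := by
  refine hw₀.isReducedExpr hα (h.isPosWord hα hc fun t => (hl t).le) fun s => ?_
  obtain ⟨t, ht⟩ := exists_pow_coxHeight_weight hα hc s
  refine neg_apply_simple_mem_posRoots hα (wordProd_mem α l) (t := t) ?_
  rw [h.wordProd_weight hα hc, hl, ht]

/-! ### The sorting word of the longest element -/

theorem lex_lt_decomposition {l₁ l₂ : List ℕ} (h : List.Lex (· < ·) l₁ l₂) :
    (∃ u a v b v', l₁ = u ++ a :: v ∧ l₂ = u ++ b :: v' ∧ a < b) ∨ l₁.length < l₂.length := by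
  induction h with
  | nil => right; simp
  | @cons a l₁ l₂ h ih =>
    rcases ih with ⟨u, x, v, y, v', rfl, rfl, hxy⟩ | ih
    · exact Or.inl ⟨a :: u, x, v, y, v', rfl, rfl, hxy⟩
    · right; simpa using ih
  | @rel a l₁ b l₂ h => exact Or.inl ⟨[], a, l₁, b, l₂, rfl, rfl, h⟩

theorem lowPart_map_range (p : S → ℕ) (L : ℕ → S) (K : ℕ) :
    lowPart p (fun _ => 0) ((List.range K).map L) =
      ((List.range K).filter
        (fun k => ((List.range k).map L).count (L k) < p (L k))).map L := by
  induction K with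
  | zero => rfl
  | succ K ih =>
    rw [List.range_succ, List.map_append, lowPart_append, ih, List.filter_append, List.map_append]
    congr 1
    simp only [List.map_cons, List.map_nil, lowPart, addCount, zero_add, List.filter_cons,
      List.filter_nil, decide_eq_true_eq]
    split_ifs <;> rfl

theorem map_range_mul {L : ℕ → S} {cw : List S}
    (hL : ∀ k, cw[k % cw.length]? = some (L k)) (M : ℕ) :
    (List.range ((M + 1) * cw.length)).map L = (List.range (M * cw.length)).map L ++ cw := by
  rw [add_mul, one_mul, List.range_add, List.map_append, List.map_map]
  congr 1
  refine List.ext_getElem (by simp) fun i h1 h2 => ?_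
  have := hL (M * cw.length + i)
  rw [Nat.mul_add_mod_self_right, Nat.mod_eq_of_lt h2, List.getElem?_eq_getElem h2] at this
  simpa using (Option.some.inj this).symm

theorem altFrom_map_range (hα : IsSimpleSystem α) (hc : wordProd α cw = c) (hnd : cw.Nodup)
    (hall : ∀ s, s ∈ cw) {L : ℕ → S} (hL : ∀ k, cw[k % cw.length]? = some (L k))
    (M : ℕ) :
    AltFrom α (coxBefore α c) (fun _ => 0) ((List.range (M * cw.length)).map L) ∧
      ∀ t, ((List.range (M * cw.length)).map L).count t = M := by
  induction M with
  | zero => simp [AltFrom]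
  | succ M ih =>
    rw [map_range_mul hL]
    refine ⟨altFrom_append.2 ⟨ih.1, ?_⟩, fun t => ?_⟩
    · have := (altFrom_coxeterWord hα hc hnd).shift M
      convert this using 1
      ext t
      simp [addCount, ih.2 t]
    · rw [List.count_append, ih.2, List.count_eq_one_of_mem hnd (hall t)]

/-- The greedy subword of `c c c ⋯` takes each letter `s` the first `m s` times; it alternates and
is a reduced expression of `w₀`. No reduced subword is lexicographically earlier, as it would use
some letter once too often. -/
theorem IsSortingWord.altFrom (hα : IsSimpleSystem α) (hc : IsCoxeterElement α c)
    (hcw : IsReducedExpr α cw c) {w₀ : V ≃ₗᵢ[ℝ] V} (hw₀ : IsLongest α w₀) {wo : List S}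
    (hwo : IsSortingWord α cw w₀ wo) :
    AltFrom α (coxBefore α c) (fun _ => 0) wo ∧ ∀ t, wo.count t = coxHeight α c t := by
  obtain ⟨hnd, hall⟩ := hc.nodup_and_mem hcw
  rcases isEmpty_or_nonempty S with hS | ⟨⟨s₀⟩⟩
  · have : wo = [] := List.eq_nil_iff_forall_not_mem.2 fun s => isEmptyElim s
    subst this
    exact ⟨trivial, fun t => isEmptyElim t⟩
  have hn : 0 < cw.length := List.length_pos_of_mem (hall s₀)
  obtain ⟨L, hL⟩ : ∃ L : ℕ → S, ∀ k, cw[k % cw.length]? = some (L k) :=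
    ⟨fun k => cw[k % cw.length]'(Nat.mod_lt _ hn), fun k => List.getElem?_eq_getElem _⟩
  have he := coxBefore_add hα hc
  have hm := isAltCount_coxHeight hα hc
  set m := coxHeight α c with hmdef
  set f : ℕ → Bool := fun k => ((List.range k).map L).count (L k) < m (L k) with hf
  have hword : ∀ K, lowPart m (fun _ => 0) ((List.range K).map L) =
      ((List.range K).filter f).map L := lowPart_map_range m L
  have halt : ∀ K, AltFrom α (coxBefore α c) (fun _ => 0) ((List.range K).map L) := by
    intro K
    have h1 := (altFrom_map_range hα hcw.1 hnd hall hL K).1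
    have h2 : K * cw.length = K + (K * cw.length - K) := by
      have := Nat.le_mul_of_pos_right K hn
      omega
    rw [h2, List.range_add, List.map_append] at h1
    exact (altFrom_append.1 h1).1
  have hlow : ∀ K, AltFrom α (coxBefore α c) (fun _ => 0)
      (lowPart m (fun _ => 0) ((List.range K).map L)) := by
    intro K
    have := (halt K).lowPart he hm
    simpa using this
  have hcount : ∀ K t, (lowPart m (fun _ => 0) ((List.range K).map L)).count t =
      min (m t) (((List.range K).map L).count t) := by
    intro K t
    have := count_lowPart m (fun _ => 0) ((List.range K).map L) t
    simpa using this
  -- The sum of the heights bounds each of them, so this many copies of `c` contain enough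
  -- occurrences of every letter.
  set K := (∑ s, m s) * cw.length with hK
  set P := (List.range K).filter f with hP
  have hPcount : ∀ t, (P.map L).count t = m t := by
    intro t
    rw [hP, ← hword, hcount, (altFrom_map_range hα hcw.1 hnd hall hL _).2]
    exact min_eq_left (Finset.single_le_sum (f := m) (fun _ _ => Nat.zero_le _) (Finset.mem_univ t))
  have hPalt : AltFrom α (coxBefore α c) (fun _ => 0) (P.map L) := by
    rw [hP, ← hword]; exact hlow K
  have hPred := hPalt.isReducedExpr hα hc hw₀ hPcount
  have hPsort : P.Pairwise (· < ·) := List.Pairwise.filter _ List.pairwise_lt_range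
  have hmap : ∀ P : List ℕ, P.map (fun k => cw[k % cw.length]?) = (P.map L).map some := by
    intro P
    rw [List.map_map]
    exact List.map_congr_left fun k _ => hL k
  obtain ⟨P', ⟨hP's, hP'm, hP'r⟩, hlex⟩ := hwo
  have hwoP : wo = P'.map L := by
    have : wo.map some = (P'.map L).map some := hP'm.symm.trans (hmap P')
    exact List.map_injective_iff.2 (Option.some_injective S) this
  rcases hlex P (P.map L) ⟨hPsort, hmap P, hPred⟩ with rfl | hlt
  · rw [hwoP]; exact ⟨hPalt, hPcount⟩
  exfalso
  rcases lex_lt_decomposition hlt with ⟨u, y, v, a, v', h1, h2, hya⟩ | hlen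
  -- Up to the first difference the two position lists coincide, so `u` consists of all greedy
  -- positions below `y`.
  · have hu : u = (List.range y).filter f := by
      rw [h1] at hP's
      have h3 : P.Pairwise (· < ·) := hPsort
      rw [h2] at h3
      refine List.Pairwise.eq_of_mem_iff (List.pairwise_append.1 hP's).1
        (List.Pairwise.filter _ List.pairwise_lt_range) fun z => ?_
      have hmemP : ∀ z, z ∈ u ++ a :: v' ↔ z < K ∧ f z := by
        intro z; rw [← h2, hP]; simp
      rw [List.mem_filter, List.mem_range]
      constructor
      · intro hz
        exact ⟨(List.pairwise_append.1 hP's).2.2 z hz y List.mem_cons_self,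
          ((hmemP z).1 (by simp [hz])).2⟩
      · rintro ⟨hzy, hfz⟩
        have haK := ((hmemP a).1 (by simp)).1
        have := (hmemP z).2 ⟨by omega, hfz⟩
        simp only [List.mem_append, List.mem_cons] at this
        rcases this with h | rfl | h
        · exact h
        · omega
        · have := List.rel_of_pairwise_cons (List.pairwise_append.1 h3).2.1 h
          omega
    -- The greedy list jumps over `y` to `a`, so the letter at `y` has already been taken as often
    -- as its height allows.
    have hfy : f y = false := by
      by_contra hfy
      rw [Bool.not_eq_false] at hfy
      have hz : y ∈ P := by
        have haK : a ∈ P := by rw [h2]; simp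
        rw [hP, List.mem_filter, List.mem_range] at haK ⊢
        exact ⟨hya.trans haK.1, hfy⟩
      rw [h1] at hP's
      rw [h2] at hz hPsort
      simp only [List.mem_append, List.mem_cons] at hz
      rcases hz with h | rfl | h
      · exact lt_irrefl _ ((List.pairwise_append.1 hP's).2.2 y h y List.mem_cons_self)
      · exact lt_irrefl _ hya
      · exact lt_asymm hya (List.rel_of_pairwise_cons (List.pairwise_append.1 hPsort).2.1 h)
    -- The prefix `u` sends the weight of the letter at `y` to the negative of a fundamental weight,
    -- so the root of that letter is negative, against reducedness.
    have hpos := hP'r.isPosWord hα (u.map L) (L y) (v.map L) (by rw [hwoP, h1]; simp)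
    obtain ⟨t, ht⟩ := exists_pow_coxHeight_weight hα hc (L y)
    refine neg_notMem_posRoots hpos (neg_apply_simple_mem_posRoots hα (wordProd_mem α _)
      (t := t) ?_)
    rw [hu, ← hword, (hlow y).wordProd_weight hα hc, hcount, ← ht]
    congr 2
    rw [hf] at hfy
    simp only [decide_eq_false_iff_not, not_lt] at hfy
    rw [min_eq_left hfy]
  · have h3 := hP'r.2.trans hPred.2.symm
    rw [hwoP] at h3
    simp at h3
    omega

end Coxeter

/-! ### Facets with one occurrence of each letter, and weights of general facets -/

section AlternatingFacets

variable {S V : Type*} [Fintype S] [DecidableEq S] [NormedAddCommGroup V] [InnerProductSpace ℝ V]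
variable {α : Module.Basis S ℝ V} {c : V ≃ₗᵢ[ℝ] V} {w₀ : V ≃ₗᵢ[ℝ] V}
variable {Q wo : List S} {I J : Finset (Fin Q.length)} {p : S → ℕ}

/-! ### Sums of weights along words -/

theorem translation_cons (s : S) (l : List S) :
    translation α (s :: l) = weight α s + simpleReflection α s (translation α l) := by
  rw [translation, translation, map_sum]
  refine (Fin.sum_univ_succ (n := l.length) _).trans ?_
  simp [isom_one_apply, isom_mul_apply]

theorem translation_concat (l : List S) (s : S) :
    translation α (l ++ [s]) = translation α l + wordProd α l (weight α s) := by
  induction l with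
  | nil => rw [List.nil_append, translation_cons]; simp [translation, isom_one_apply]
  | cons t l ih =>
    rw [List.cons_append, translation_cons, ih, translation_cons, wordProd_cons, isom_mul_apply,
      map_add, add_assoc]

/-- The sum depends on the letter counts alone, so the complement of a singleton facet contributes
the same vector as the sorting word. -/
theorem AltFrom.translation (hα : IsSimpleSystem α) (hc : IsCoxeterElement α c) {l : List S}
    (h : AltFrom α (coxBefore α c) (fun _ => 0) l) :
    translation α l = ∑ t, ∑ j ∈ Finset.range (l.count t), (c ^ j) (weight α t) := by
  induction l using List.reverseRecOn with
  | nil => simp [BrickPolytope.translation]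
  | append_singleton l s ih =>
    have hl := (altFrom_append.1 h).1
    rw [translation_concat, ih hl, hl.wordProd_weight hα hc,
      ← Finset.add_sum_erase _ _ (Finset.mem_univ s),
      ← Finset.add_sum_erase Finset.univ
        (fun t => ∑ j ∈ Finset.range ((l ++ [s]).count t), (c ^ j) (weight α t))
        (Finset.mem_univ s)]
    have h1 : ∀ t ∈ Finset.univ.erase s, (l ++ [s]).count t = l.count t := by
      intro t ht
      simp [(Finset.ne_of_mem_erase ht).symm]
    have h2 : ∑ t ∈ Finset.univ.erase s,
        ∑ j ∈ Finset.range ((l ++ [s]).count t), (c ^ j) (weight α t) =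
        ∑ t ∈ Finset.univ.erase s, ∑ j ∈ Finset.range (l.count t), (c ^ j) (weight α t) :=
      Finset.sum_congr rfl fun t ht => by rw [h1 t ht]
    rw [h2, List.count_append, List.count_singleton_self, Finset.sum_range_succ]
    abel

theorem sum_weightFn_notMem (n : ℕ) (hn : n ≤ Q.length) :
    ∑ k : Fin Q.length, (if (k : ℕ) < n ∧ k ∉ I then weightFn α Q I k else 0) =
      translation α (prefixWord Q I n) := by
  induction n with
  | zero => rw [prefixWord_zero]; simp [translation]
  | succ n ih =>
    obtain ⟨k, rfl⟩ : ∃ k : Fin Q.length, k = n := ⟨⟨n, hn⟩, rfl⟩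
    rw [prefixWord_succ]
    have h1 : ∀ j : Fin Q.length, (if (j : ℕ) < k + 1 ∧ j ∉ I then weightFn α Q I j else 0) =
        (if (j : ℕ) < k ∧ j ∉ I then weightFn α Q I j else 0) +
          if j = k then (if k ∈ I then 0 else weightFn α Q I k) else 0 := by
      intro j
      by_cases hjk : j = k
      · subst hjk
        by_cases hj : j ∈ I <;> simp [hj]
      · have : (j : ℕ) ≠ k := fun h => hjk (Fin.ext h)
        simp only [hjk, if_false, add_zero]
        exact if_congr (and_congr_left fun _ => by omega) rfl rfl
    simp only [h1]
    rw [Finset.sum_add_distrib, ih (by omega), Finset.sum_ite_eq' Finset.univ k,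
      if_pos (Finset.mem_univ _)]
    split_ifs with hk
    · simp
    · rw [translation_concat, weightFn_eq, prefixElt]

theorem brickVector_eq (I : Finset (Fin Q.length)) :
    brickVector α Q I = ∑ k ∈ I, weightFn α Q I k + translation α (complementWord Q I) := by
  rw [← prefixWord_length, ← sum_weightFn_notMem _ le_rfl, brickVector,
    ← Finset.sum_add_sum_compl I]
  congr 1
  rw [← Finset.sum_filter]
  refine Finset.sum_congr ?_ fun _ _ => rfl
  ext k
  simp

/-! ### Counting letters -/

theorem take_succ_eq (k : Fin Q.length) : Q.take (k + 1) = Q.take k ++ [Q.get k] := by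
  simp

theorem eq_take_append (k : Fin Q.length) : Q = Q.take k ++ Q.get k :: Q.drop (k + 1) := by
  conv_lhs => rw [← List.take_append_drop k Q, List.drop_eq_getElem_cons k.2]
  rfl

theorem count_take_succ (k : Fin Q.length) (t : S) :
    (Q.take (k + 1)).count t = (Q.take k).count t + if Q.get k = t then 1 else 0 := by
  rw [take_succ_eq, List.count_append, List.count_singleton]
  simp

theorem count_take_mono {m n : ℕ} (h : m ≤ n) (t : S) :
    (Q.take m).count t ≤ (Q.take n).count t :=
  (List.take_prefix_take_left h).sublist.count_le t

theorem count_take_lt (k : Fin Q.length) : (Q.take k).count (Q.get k) < Q.count (Q.get k) := by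
  have h1 := count_take_succ k (Q.get k)
  rw [if_pos rfl] at h1
  have h2 := (List.take_prefix (k + 1) Q).sublist.count_le (Q.get k)
  omega

theorem exists_count_take_eq {s : S} {n : ℕ} (h : n < Q.count s) :
    ∃ k : Fin Q.length, Q.get k = s ∧ (Q.take k).count s = n := by
  have hex : ∃ j, n < (Q.take j).count s := ⟨Q.length, by rwa [List.take_length]⟩
  have hle : Nat.find hex ≤ Q.length := Nat.find_min' hex (by rwa [List.take_length])
  have hspec := Nat.find_spec hex
  have hmin := fun j (hj : j < Nat.find hex) => Nat.find_min hex hj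
  generalize Nat.find hex = j at hle hspec hmin
  obtain _ | j := j
  · simp at hspec
  obtain ⟨k, rfl⟩ : ∃ k : Fin Q.length, k = j := ⟨⟨j, hle⟩, rfl⟩
  have h1 := hmin k (Nat.lt_succ_self _)
  rw [count_take_succ] at hspec
  split_ifs at hspec with hk
  · exact ⟨k, hk, by omega⟩
  · omega

theorem eq_of_count_take_eq {k k' : Fin Q.length} (h : Q.get k = Q.get k')
    (hc : (Q.take k).count (Q.get k) = (Q.take k').count (Q.get k')) : k = k' := by
  have key : ∀ k k' : Fin Q.length, Q.get k = Q.get k' → k < k' →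
      (Q.take k).count (Q.get k) < (Q.take k').count (Q.get k') := by
    intro k k' h hlt
    have h1 := count_take_succ k (Q.get k)
    rw [if_pos rfl] at h1
    have h2 := count_take_mono (Q := Q) (show (k : ℕ) + 1 ≤ k' from hlt) (Q.get k)
    rw [← h]
    omega
  rcases lt_trichotomy k k' with hlt | rfl | hlt
  · exact absurd hc (key k k' h hlt).ne
  · rfl
  · exact absurd hc (key k' k h.symm hlt).ne'

/-- The set of the positions in `Q` where `s` occurs for the `p s`-th time (counted from `0`). -/
def occurrences (Q : List S) (p : S → ℕ) : Finset (Fin Q.length) :=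
  Finset.univ.filter fun k => (Q.take k).count (Q.get k) = p (Q.get k)

theorem mem_occurrences {k : Fin Q.length} :
    k ∈ occurrences Q p ↔ (Q.take k).count (Q.get k) = p (Q.get k) := by
  simp [occurrences]

theorem map_get_occurrences (hp : ∀ s, p s < Q.count s) :
    (occurrences Q p).val.map Q.get = Finset.univ.val := by
  refine (Multiset.Nodup.ext (Multiset.Nodup.map_on ?_ (occurrences Q p).nodup)
    Finset.univ.nodup).2 fun s => ?_
  · intro k hk k' hk' h
    rw [Finset.mem_val, mem_occurrences] at hk hk'
    exact eq_of_count_take_eq h (by rw [hk, hk', h])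
  · simp only [Multiset.mem_map, Finset.mem_val, mem_occurrences, Finset.mem_univ, iff_true]
    obtain ⟨k, rfl, hk⟩ := exists_count_take_eq (hp s)
    exact ⟨k, hk, rfl⟩

theorem eq_occurrences {i : S → Fin Q.length} (hi : ∀ s, Q.get (i s) = s)
    (hI : ∀ k, k ∈ I ↔ k = i (Q.get k)) : I = occurrences Q fun s => (Q.take (i s)).count s := by
  ext k
  rw [hI, mem_occurrences]
  constructor
  · intro h
    conv_lhs => rw [h, hi]
  · intro h
    refine eq_of_count_take_eq (hi _).symm ?_
    rw [h, hi]

theorem count_prefixWord_occurrences (p : S → ℕ) {n : ℕ} (hn : n ≤ Q.length) (t : S) :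
    (prefixWord Q (occurrences Q p) n).count t =
      (Q.take n).count t - if p t < (Q.take n).count t then 1 else 0 := by
  induction n with
  | zero => simp [prefixWord_zero]
  | succ n ih =>
    obtain ⟨k, rfl⟩ : ∃ k : Fin Q.length, k = n := ⟨⟨n, hn⟩, rfl⟩
    have ih := ih (by omega)
    have h1 := count_take_succ k t
    have hk := mem_occurrences (p := p) (k := k)
    rw [prefixWord_succ, List.count_append, ih, h1]
    by_cases ht : Q.get k = t
    · subst ht
      by_cases h2 : k ∈ occurrences Q p
      · rw [if_pos h2]
        have := hk.1 h2
        simp only [List.count_nil, if_true]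
        split_ifs <;> omega
      · rw [if_neg h2]
        have : ¬ _ := mt hk.2 h2
        simp only [List.count_singleton_self, if_true]
        split_ifs <;> omega
    · rw [if_neg ht, add_zero]
      by_cases h2 : k ∈ occurrences Q p
      · rw [if_pos h2, List.count_nil, add_zero]
      · rw [if_neg h2, List.count_eq_zero.2 (show t ∉ [Q.get k] by simpa using Ne.symm ht), add_zero]

theorem count_complementWord_add (t : S) :
    (complementWord Q I).count t + (I.filter fun k => Q.get k = t).card = Q.count t := by
  have h1 : ∀ n ≤ Q.length, (prefixWord Q I n).count t +
      (I.filter fun k : Fin Q.length => (k : ℕ) < n ∧ Q.get k = t).card = (Q.take n).count t := by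
    intro n
    induction n with
    | zero => simp [prefixWord_zero]
    | succ n ih =>
      intro hn
      obtain ⟨k, rfl⟩ : ∃ k : Fin Q.length, k = n := ⟨⟨n, hn⟩, rfl⟩
      have ih := ih (by omega)
      rw [prefixWord_succ, List.count_append, count_take_succ, ← ih]
      by_cases hk : k ∈ I ∧ Q.get k = t
      · have h2 : I.filter (fun j : Fin Q.length => (j : ℕ) < k + 1 ∧ Q.get j = t) =
            insert k (I.filter fun j : Fin Q.length => (j : ℕ) < k ∧ Q.get j = t) := by
          ext j
          simp only [Finset.mem_filter, Finset.mem_insert]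
          rcases eq_or_ne j k with rfl | hj
          · simpa [hk.1] using hk.2
          · have : (j : ℕ) ≠ k := fun h => hj (Fin.ext h)
            simp only [hj, false_or]
            refine and_congr_right fun _ => and_congr_left fun _ => by omega
        rw [h2, Finset.card_insert_of_notMem (by simp), if_pos hk.1, if_pos hk.2]
        simp
        omega
      · have h2 : I.filter (fun j : Fin Q.length => (j : ℕ) < k + 1 ∧ Q.get j = t) =
            I.filter fun j : Fin Q.length => (j : ℕ) < k ∧ Q.get j = t := by
          refine Finset.filter_congr fun j hjI => ?_
          rcases eq_or_ne j k with rfl | hj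
          · simp only [not_and] at hk
            simpa using hk hjI
          · have : (j : ℕ) ≠ k := fun h => hj (Fin.ext h)
            refine and_congr_left fun _ => by omega
        rw [h2]
        by_cases hkI : k ∈ I
        · have : Q.get k ≠ t := fun h => hk ⟨hkI, h⟩
          rw [if_pos hkI, if_neg this]
          simp
        · rw [if_neg hkI, List.count_singleton]
          simp only [beq_iff_eq]
          omega
  have := h1 Q.length le_rfl
  rw [prefixWord_length, List.take_length] at this
  rw [← this]
  congr 2
  refine Finset.filter_congr fun k _ => ?_
  simp

/-! ### Facets consisting of one occurrence of each letter -/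

theorem apply_simple_congr {σ τ : V ≃ₗᵢ[ℝ] V} {s : S} (hs : σ (weight α s) = τ (weight α s))
    (h : ∀ t, Adj α s t → σ (weight α t) = τ (weight α t)) : σ (α s) = τ (α s) := by
  rw [eq_sum_weight α (α s)]
  simp only [map_sum, map_smul]
  refine Finset.sum_congr rfl fun t _ => ?_
  by_cases hts : t = s
  · subst hts; rw [hs]
  by_cases hadj : Adj α s t
  · rw [h t hadj]
  · have : ⟪α t, α s⟫ = 0 := by
      by_contra h
      exact hadj ⟨Ne.symm hts, by rwa [real_inner_comm]⟩
    simp [this]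

theorem AltFrom.count_take (hQ : AltFrom α (coxBefore α c) (fun _ => 0) Q) (k : Fin Q.length)
    {t : S} (ht : Adj α (Q.get k) t) :
    (Q.take k).count t = (Q.take k).count (Q.get k) + coxBefore α c t (Q.get k) := by
  have h := hQ
  rw [eq_take_append k] at h
  simpa using h.apply ht

/-- Between adjacent letters, alternating `p` make the two deleted occurrences consecutive, so the
remaining letters still alternate. -/
theorem altFrom_prefixWord_occurrences (hα : IsSimpleSystem α) (hc : IsCoxeterElement α c)
    (hQ : AltFrom α (coxBefore α c) (fun _ => 0) Q) (hp : IsAltCount α (coxBefore α c) p)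
    {n : ℕ} (hn : n ≤ Q.length) :
    AltFrom α (coxBefore α c) (fun _ => 0) (prefixWord Q (occurrences Q p) n) := by
  induction n with
  | zero => rw [prefixWord_zero]; trivial
  | succ n ih =>
    obtain ⟨k, rfl⟩ : ∃ k : Fin Q.length, k = n := ⟨⟨n, hn⟩, rfl⟩
    rw [prefixWord_succ, altFrom_append]
    refine ⟨ih (by omega), ?_⟩
    split_ifs with hk
    · trivial
    refine ⟨fun t ht => ?_, trivial⟩
    rw [mem_occurrences] at hk
    simp only [addCount, zero_add]
    rw [count_prefixWord_occurrences p k.2.le, count_prefixWord_occurrences p k.2.le]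
    have h1 := hQ.count_take k ht
    have h2 := coxBefore_add hα hc _ _ ht
    have h3 := hp _ _ ht
    have h4 := hp _ _ ht.symm
    split_ifs <;> omega

theorem CommutationEquiv.symm {u v : List S} (h : CommutationEquiv α u v) :
    CommutationEquiv α v u := by
  induction h with
  | refl => exact Relation.ReflTransGen.refl
  | tail _ h ih =>
    obtain ⟨x, y, s, t, hst⟩ := h
    exact Relation.ReflTransGen.head (CommutationStep.swap x y t s hst.symm) ih

/-- A facet whose complement is the sorting word, with its root and weight configurations. -/
structure IsSingletonFacet (α : Module.Basis S ℝ V) (w₀ : V ≃ₗᵢ[ℝ] V) (Q wo : List S)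
    (I : Finset (Fin Q.length)) (w : V ≃ₗᵢ[ℝ] V) : Prop where
  isFacet : IsFacet α w₀ Q I
  complement : CommutationEquiv α (complementWord Q I) wo
  mem : w ∈ reflectionGroup α
  rootFn : ∀ k ∈ I, rootFn α Q I k = w (α (Q.get k))
  weightFn : ∀ k ∈ I, weightFn α Q I k = w (weight α (Q.get k))
  map_get : I.val.map Q.get = Finset.univ.val
  brickVector : brickVector α Q I = translation α wo + w (balancedPoint α)

/-- The situation of a Coxeter element `c` and of alternating words `wo` and `Q` with the letter
counts of the sorting word of `w₀` and of this word preceded by a word for `c`. -/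
structure IsSortingPair (α : Module.Basis S ℝ V) (c w₀ : V ≃ₗᵢ[ℝ] V) (Q wo : List S) : Prop where
  simple : IsSimpleSystem α
  coxeter : IsCoxeterElement α c
  longest : IsLongest α w₀
  alt_wo : AltFrom α (coxBefore α c) (fun _ => 0) wo
  count_wo : ∀ t, wo.count t = coxHeight α c t
  alt_Q : AltFrom α (coxBefore α c) (fun _ => 0) Q
  count_Q : ∀ t, Q.count t = coxHeight α c t + 1

/-- The complement alternates and has the letter counts of the sorting word. Before a deleted
position with letter `s`, it contains exactly `p t` letters `t`, for `t = s` and for `t` adjacent to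
`s`; so the prefix product agrees with `w` on `ω_s` and on `α s`. -/
theorem isSingletonFacet_occurrences (H : IsSortingPair α c w₀ Q wo)
    (hp : IsAltCount α (coxBefore α c) p)
    (hpm : ∀ s, p s ≤ coxHeight α c s) {w : V ≃ₗᵢ[ℝ] V} (hw : w ∈ reflectionGroup α)
    (hwp : ∀ t, w (weight α t) = (c ^ p t) (weight α t)) :
    IsSingletonFacet α w₀ Q wo (occurrences Q p) w := by
  have ⟨hα, hc, hw₀, hwo, hwoc, hQ, hQc⟩ := H
  have halt := fun {n} hn => altFrom_prefixWord_occurrences (n := n) hα hc hQ hp hn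
  have hcalt := halt le_rfl
  rw [prefixWord_length] at hcalt
  have hcount : ∀ t, (complementWord Q (occurrences Q p)).count t = coxHeight α c t := by
    intro t
    rw [← prefixWord_length, count_prefixWord_occurrences p le_rfl, List.take_length, hQc,
      if_pos (Nat.lt_succ_of_le (hpm t))]
    rfl
  have hcomp : CommutationEquiv α (complementWord Q (occurrences Q p)) wo :=
    hcalt.commutationEquiv (coxBefore_add hα hc) hwo fun t => (hcount t).trans (hwoc t).symm
  have hget := map_get_occurrences (Q := Q) (p := p) fun s => by
    rw [hQc]; exact Nat.lt_succ_of_le (hpm s)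
  have hwt : ∀ (k : Fin Q.length) t,
      (prefixWord Q (occurrences Q p) k).count t = p t →
      prefixElt α Q (occurrences Q p) k (weight α t) = w (weight α t) := by
    intro k t h
    rw [prefixElt, (halt k.2.le).wordProd_weight hα hc, h, hwp]
  have hself : ∀ k ∈ occurrences Q p,
      (prefixWord Q (occurrences Q p) k).count (Q.get k) = p (Q.get k) := by
    intro k hk
    rw [count_prefixWord_occurrences p k.2.le, mem_occurrences.1 hk]
    simp
  have hweight : ∀ k ∈ occurrences Q p,
      weightFn α Q (occurrences Q p) k = w (weight α (Q.get k)) := by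
    intro k hk
    rw [weightFn_eq, hwt k _ (hself k hk)]
  refine ⟨hcalt.isReducedExpr hα hc hw₀ hcount, hcomp, hw, fun k hk => ?_, hweight, hget, ?_⟩
  · rw [rootFn_eq]
    refine apply_simple_congr (hwt k _ (hself k hk)) fun t ht => hwt k t ?_
    rw [count_prefixWord_occurrences p k.2.le]
    have h1 := hQ.count_take k ht
    have h2 := coxBefore_add hα hc _ _ ht
    have h3 := hp _ _ ht
    have h4 := hp _ _ ht.symm
    have h5 := mem_occurrences.1 hk
    split_ifs <;> omega
  · rw [brickVector_eq, Finset.sum_congr rfl hweight, hcalt.translation hα hc,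
      hwo.translation hα hc, add_comm]
    simp only [hcount, hwoc]
    congr 1
    rw [balancedPoint, map_sum]
    change ((occurrences Q p).val.map ((fun t => w (weight α t)) ∘ Q.get)).sum = _
    rw [← Multiset.map_map, hget]
    rfl

/-- Alternating counts below the heights are realized by a group element: rearrange the sorting word
into its low and high parts with respect to `p` and take the product of the low part. -/
theorem exists_apply_weight_eq_pow (H : IsSortingPair α c w₀ Q wo)
    (hp : IsAltCount α (coxBefore α c) p)
    (hpm : ∀ s, p s ≤ coxHeight α c s) :
    ∃ u v, CommutationEquiv α wo (u ++ v) ∧ IsPosWord α u ∧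
      ∀ t, wordProd α u (weight α t) = (c ^ p t) (weight α t) := by
  have ⟨hα, hc, hw₀, hwo, hwoc, hQ, hQc⟩ := H
  have he := coxBefore_add hα hc
  have hlow : AltFrom α (coxBefore α c) (fun _ => 0) (lowPart p (fun _ => 0) wo) := by
    simpa using hwo.lowPart he hp
  have hhigh : AltFrom α (coxBefore α c) p (highPart p (fun _ => 0) wo) := by
    simpa using hwo.highPart he hp
  have hlc : ∀ t, (lowPart p (fun _ => 0) wo).count t = p t := by
    intro t
    have := count_lowPart p (fun _ => 0) wo t
    have h2 := hpm t
    rw [hwoc] at this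
    omega
  have hhc : ∀ t, (highPart p (fun _ => 0) wo).count t + p t = coxHeight α c t := by
    intro t
    have := count_highPart p (fun _ => 0) wo t
    have h2 := hpm t
    rw [hwoc] at this
    omega
  have hpe : addCount (fun _ => 0) (lowPart p (fun _ => 0) wo) = p := by
    ext t; simp [addCount, hlc]
  refine ⟨lowPart p (fun _ => 0) wo, highPart p (fun _ => 0) wo, ?_, ?_, fun t => ?_⟩
  · refine hwo.commutationEquiv he (altFrom_append.2 ⟨hlow, by rwa [hpe]⟩) fun t => ?_
    rw [List.count_append, hlc, hwoc, ← hhc, add_comm]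
  · exact hlow.isPosWord hα hc fun t => by rw [hlc]; exact hpm t
  · rw [hlow.wordProd_weight hα hc, hlc]

/-- The weight of a position does not depend on the facet, it is orthogonal to the other roots of
the facet, and it is constant on the brick vectors of the facets containing this position. -/
theorem IsFacet.weightFn_spec (H : IsSortingPair α c w₀ Q wo) (hI : IsFacet α w₀ Q I)
    {j : Fin Q.length} (hj : j ∈ I) :
    weightFn α Q I j = (c ^ (Q.take j).count (Q.get j)) (weight α (Q.get j)) ∧
    (∀ i ∈ I, i ≠ j → ⟪rootFn α Q I i, weightFn α Q I j⟫ = 0) ∧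
    ⟪brickVector α Q I, weightFn α Q I j⟫ = ⟪translation α wo, weightFn α Q I j⟫ +
      ⟪balancedPoint α, weight α (Q.get j)⟫ := by
  have ⟨hα, hc, hw₀, hwo, hwoc, hQ, hQc⟩ := H
  set ν := (c ^ (Q.take j).count (Q.get j)) (weight α (Q.get j)) with hν
  have he := coxBefore_add hα hc
  suffices weightFn α Q I j = ν ∧ (∀ i ∈ I, i ≠ j → ⟪rootFn α Q I i, ν⟫ = 0) ∧
      ⟪brickVector α Q I, ν⟫ = ⟪translation α wo, ν⟫ + ⟪balancedPoint α, weight α (Q.get j)⟫ by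
    obtain ⟨h1, h2, h3⟩ := this
    rw [h1]
    exact ⟨rfl, h2, h3⟩
  -- a facet containing `j`
  set p : S → ℕ := fun t => min (coxHeight α c t) ((Q.take j).count t) with hp
  have hpm : ∀ t, p t ≤ coxHeight α c t := fun t => min_le_left _ _
  -- The counts of the prefix before `j` alternate, and cutting them off at the heights preserves
  -- this. The count at the letter of `j` is not cut off, so `j` belongs to the resulting facet.
  have hpalt : IsAltCount α (coxBefore α c) p := by
    intro s t hst h
    have h1 := isAltCount_coxHeight hα hc s t hst h
    have hQj := hQ
    rw [← List.take_append_drop j Q] at hQj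
    have h2 := (altFrom_append.1 hQj).1.isAltCount he (fun _ _ _ _ => by simp) s t hst h
    simp only [addCount, zero_add] at h2
    simp only [hp]
    omega
  obtain ⟨u, v, -, -, hu⟩ := exists_apply_weight_eq_pow H hpalt hpm
  have hG := isSingletonFacet_occurrences H hpalt hpm
    (wordProd_mem α u) hu
  have hpj : p (Q.get j) = (Q.take j).count (Q.get j) := by
    have := count_take_lt j
    rw [hQc] at this
    exact min_eq_right (Nat.le_of_lt_succ this)
  have hjG : j ∈ occurrences Q p := mem_occurrences.2 hpj.symm
  have hνu : ν = wordProd α u (weight α (Q.get j)) := by rw [hu, hpj]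
  -- All three properties pass through flips away from `j`: the reflection involved is in a root
  -- orthogonal to `ν`, so it fixes `ν` and preserves products with `ν`.
  refine IsFacet.link_induction hα hw₀ (M := fun I => weightFn α Q I j = ν ∧
      (∀ i ∈ I, i ≠ j → ⟪rootFn α Q I i, ν⟫ = 0) ∧ ⟪brickVector α Q I, ν⟫ =
        ⟪translation α wo, ν⟫ + ⟪balancedPoint α, weight α (Q.get j)⟫)
    ?_ hG.isFacet hI hjG hj ⟨?_, fun i hi hij => ?_, ?_⟩
  · rintro I hI hj ⟨h1, h2, h3⟩ i hi hij i' hi' hr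
    have hρ := rootReflection_eq_of_eq_or_neg hr
    have hperp : ⟪rootFn α Q I i, ν⟫ = 0 := h2 i hi hij
    have hfix : rootReflection (rootFn α Q I i) ν = ν := rootReflection_of_inner_eq_zero hperp
    refine ⟨?_, fun k hk hkj => ?_, ?_⟩
    · rw [weightFn_toggle hρ, h1, hfix, ite_self]
    · have hk0 : ⟪rootFn α Q I k, ν⟫ = 0 := by
        by_cases hki' : k = i'
        · subst hki'
          rcases hr with hr | hr <;> rw [hr] <;> simp [hperp]
        · by_cases hki : k = i
          · exact hki ▸ hperp
          · exact h2 k ((mem_toggle_of_ne hki hki').1 hk) hkj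
      rw [rootFn_toggle hρ]
      split_ifs
      · rw [← hfix, LinearIsometryEquiv.inner_map_map, hk0]
      · exact hk0
    · rw [← h3, brickVector, brickVector, sum_inner, sum_inner]
      refine Finset.sum_congr rfl fun k _ => ?_
      rw [weightFn_toggle hρ]
      split_ifs
      · nth_rewrite 2 [← hfix]
        nth_rewrite 1 [← hfix]
        rw [LinearIsometryEquiv.inner_map_map, hfix]
      · rfl
  · rw [hG.weightFn j hjG, hνu]
  · rw [hG.rootFn i hi, hνu, LinearIsometryEquiv.inner_map_map]
    refine inner_weight_eq_zero fun h => hij ?_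
    refine eq_of_count_take_eq h ?_
    rw [mem_occurrences.1 hi, mem_occurrences.1 hjG, h]
  · rw [hG.brickVector, inner_add_left]
    nth_rewrite 2 [hνu]
    rw [LinearIsometryEquiv.inner_map_map]

/-- A facet whose weights form the orbit of the fundamental weights under `w`. -/
theorem IsFacet.isSingletonFacet_of_weightConfig (H : IsSortingPair α c w₀ Q wo)
    (hI : IsFacet α w₀ Q I) (hcard : I.card = Fintype.card S) {w : V ≃ₗᵢ[ℝ] V} (hw : w ∈ reflectionGroup α)
    (h : ∀ t, ∃ i ∈ I, weightFn α Q I i = w (weight α t)) :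
    IsSingletonFacet α w₀ Q wo I w ∧ ∃ p, IsAltCount α (coxBefore α c) p ∧
      (∀ s, p s ≤ coxHeight α c s) ∧ ∀ t, w (weight α t) = (c ^ p t) (weight α t) := by
  have ⟨hα, hc, hw₀, hwo, hwoc, hQ, hQc⟩ := H
  choose i hiI hi using h
  have hspec := fun t => (hI.weightFn_spec H (hiI t)).1
  have hget : ∀ t, Q.get (i t) = t := by
    intro t
    have h1 := (hi t).symm.trans (hspec t)
    exact (eq_of_apply_weight_eq hα hw (pow_mem hc.mem _) h1).symm
  have himage : Finset.univ.image i = I := by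
    refine Finset.eq_of_subset_of_card_le (fun k hk => ?_) ?_
    · obtain ⟨t, -, rfl⟩ := Finset.mem_image.1 hk
      exact hiI t
    · rw [Finset.card_image_of_injective _ fun s t h => by rw [← hget s, h, hget],
        Finset.card_univ, hcard]
  have hmem : ∀ k, k ∈ I ↔ k = i (Q.get k) := by
    intro k
    rw [← himage, Finset.mem_image]
    constructor
    · rintro ⟨t, -, rfl⟩
      rw [hget]
    · intro h
      exact ⟨_, Finset.mem_univ _, h.symm⟩
  have hIeq := eq_occurrences hget hmem
  set p : S → ℕ := fun s => (Q.take (i s)).count s with hp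
  have hwp : ∀ t, w (weight α t) = (c ^ p t) (weight α t) := by
    intro t
    have h1 := (hi t).symm.trans (hspec t)
    rwa [hget] at h1
  have hpm : ∀ s, p s ≤ coxHeight α c s := by
    intro s
    have := count_take_lt (i s)
    rw [hget, hQc] at this
    exact Nat.le_of_lt_succ this
  -- Since `w` is an isometry, `c^d(ω_t)` and `ω_t` have the same product with `ω_s`; their
  -- difference telescopes into roots, which are positive below the height.
  have hsum : ∀ s t d, p t = p s + d →
      ∑ k ∈ Finset.range d, ⟪(c ^ k) (coxRoot α c t), weight α s⟫ = 0 := by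
    intro s t d hd
    have h1 : ⟪w (weight α t), w (weight α s)⟫ = ⟪weight α t, weight α s⟫ :=
      LinearIsometryEquiv.inner_map_map _ _ _
    rw [hwp, hwp, hd, pow_add, isom_mul_apply, LinearIsometryEquiv.inner_map_map] at h1
    rw [← sum_inner, sum_pow_coxRoot, inner_sub_left, h1, sub_self]
  have hnn : ∀ s t d, p t = p s + d → ∀ k ∈ Finset.range d,
      0 ≤ ⟪(c ^ k) (coxRoot α c t), weight α s⟫ := by
    intro s t d hd k hk
    have := hpm t
    rw [Finset.mem_range] at hk
    exact inner_weight_nonneg (pow_coxRoot_mem_posRoots (by omega)).2 _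
  -- Each of these products vanishes. The term with exponent `0` excludes `p s < p t`, and the term
  -- with exponent `1` excludes `p t + 1 < p s`, because these two terms are positive for adjacent
  -- letters with `s` before `t`.
  have hpalt : IsAltCount α (coxBefore α c) p := by
    intro s t hst h
    constructor
    · by_contra! hlt
      obtain ⟨d, hd⟩ := Nat.exists_eq_add_of_lt hlt
      have h1 := (Finset.sum_eq_zero_iff_of_nonneg (hnn s t (d + 1) hd)).1
        (hsum s t (d + 1) hd) 0 (by simp)
      rw [pow_zero, isom_one_apply] at h1
      exact (inner_coxRoot_weight_pos h).ne' h1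
    · by_contra! hlt
      obtain ⟨d, hd⟩ := Nat.exists_eq_add_of_lt hlt
      have hd' : p s = p t + (d + 2) := by omega
      have h1 := (Finset.sum_eq_zero_iff_of_nonneg (hnn t s (d + 2) hd')).1
        (hsum t s (d + 2) hd') 1 (by simp)
      rw [pow_one] at h1
      exact (inner_apply_coxRoot_weight_pos hα hc hst h).ne' h1
  refine ⟨?_, p, hpalt, hpm, hwp⟩
  rw [hIeq]
  exact isSingletonFacet_occurrences H hpalt hpm hw hwp

/-- A facet whose complement is the sorting word up to commutations. -/
theorem isSingletonFacet_of_complement (H : IsSortingPair α c w₀ Q wo)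
    (h : CommutationEquiv α (complementWord Q I) wo) :
    ∃ w, IsSingletonFacet α w₀ Q wo I w := by
  have ⟨hα, hc, hw₀, hwo, hwoc, hQ, hQc⟩ := H
  have hcount : ∀ t, (complementWord Q I).count t = coxHeight α c t := fun t =>
    (h.perm.count_eq t).trans (hwoc t)
  -- `Q` has one more letter `t` than the complement, so the facet contains exactly one position
  -- with letter `t`.
  have hone : ∀ t, ∃ i, I.filter (fun k => Q.get k = t) = {i} := by
    intro t
    have := count_complementWord_add (I := I) t
    rw [hcount, hQc] at this
    exact Finset.card_eq_one.1 (by omega)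
  choose i hi using hone
  have hmem' : ∀ k t, k = i t ↔ k ∈ I ∧ Q.get k = t := by
    intro k t
    rw [← Finset.mem_singleton, ← hi, Finset.mem_filter]
  have hget : ∀ t, Q.get (i t) = t := fun t => ((hmem' _ t).1 rfl).2
  have hIeq := eq_occurrences (I := I) hget fun k => by rw [hmem']; simp
  set p : S → ℕ := fun s => (Q.take (i s)).count s with hp
  have hpm : ∀ s, p s ≤ coxHeight α c s := by
    intro s
    have := count_take_lt (i s)
    rw [hget, hQc] at this
    exact Nat.le_of_lt_succ this
  have halt : ∀ k : Fin Q.length, k ∉ I → ∀ t, Adj α (Q.get k) t →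
      (prefixWord Q I k).count t =
        (prefixWord Q I k).count (Q.get k) + coxBefore α c t (Q.get k) := by
    intro k hk t ht
    have h1 : AltFrom α (coxBefore α c) (fun _ => 0) (complementWord Q I) := by
      exact hwo.of_commutationEquiv h.symm
    obtain ⟨r, hr⟩ := prefixWord_prefix (I := I) (Nat.succ_le_of_lt k.2) le_rfl
    rw [← prefixWord_length, ← hr, Nat.succ_eq_add_one, prefixWord_succ, if_neg hk] at h1
    simpa using (altFrom_append.1 h1).1.apply ht
  rw [hIeq] at halt
  -- If `p` fails to alternate, look at the surviving occurrence number `p s` of `t`, or number `p t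
  -- + 1` of `s`. The deleted letter of the other kind precedes it and its own kind has lost none
  -- yet, which breaks the alternation of the complement.
  have hpalt : IsAltCount α (coxBefore α c) p := by
    intro s t hst h
    have h0 := coxBefore_add hα hc s t hst
    constructor
    · by_contra! hlt
      obtain ⟨k, rfl, hk⟩ := exists_count_take_eq (Q := Q) (s := t) (n := p s) (by
        have := hpm t; rw [hQc]; omega)
      have h1 := halt k (by rw [mem_occurrences]; omega) s hst.symm
      have h2 := hQ.count_take k hst.symm
      rw [count_prefixWord_occurrences p k.2.le, count_prefixWord_occurrences p k.2.le] at h1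
      split_ifs at h1 <;> omega
    · by_contra! hlt
      obtain ⟨k, rfl, hk⟩ := exists_count_take_eq (Q := Q) (s := s) (n := p t + 1) (by
        have := hpm s; rw [hQc]; omega)
      have h1 := halt k (by rw [mem_occurrences]; omega) t hst
      have h2 := hQ.count_take k hst
      rw [count_prefixWord_occurrences p k.2.le, count_prefixWord_occurrences p k.2.le] at h1
      split_ifs at h1 <;> omega
  obtain ⟨u, v, -, -, hu⟩ := exists_apply_weight_eq_pow H hpalt hpm
  rw [hIeq]
  exact ⟨_, isSingletonFacet_occurrences H hpalt hpm
    (wordProd_mem α u) hu⟩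

end AlternatingFacets

/-! ### Cones, chambers and separable sets of roots -/

section Cones

variable {S V : Type*} [Fintype S] [DecidableEq S] [NormedAddCommGroup V] [InnerProductSpace ℝ V]
variable {α : Module.Basis S ℝ V} {w : V ≃ₗᵢ[ℝ] V}

theorem subset_cone (X : Set V) : X ⊆ cone X := Submodule.subset_span

theorem smul_mem_cone {X : Set V} {x : V} (hx : x ∈ cone X) {a : ℝ} (ha : 0 ≤ a) :
    a • x ∈ cone X :=
  Submodule.smul_mem (PointedCone.hull ℝ X) (⟨a, ha⟩ : {a : ℝ // 0 ≤ a}) hx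

theorem sum_mem_cone {ι : Type*} {X : Set V} (T : Finset ι) {f : ι → V}
    (h : ∀ i ∈ T, f i ∈ cone X) : ∑ i ∈ T, f i ∈ cone X :=
  Submodule.sum_mem (PointedCone.hull ℝ X) h

theorem cone_induction {X : Set V} {P : V → Prop} (hX : ∀ x ∈ X, P x) (h0 : P 0)
    (hadd : ∀ x y, P x → P y → P (x + y)) (hsmul : ∀ (a : ℝ) x, 0 ≤ a → P x → P (a • x))
    {x : V} (hx : x ∈ cone X) : P x :=
  Submodule.span_induction (p := fun x _ => P x) hX h0 (fun x y _ _ => hadd x y)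
    (fun (a : {a : ℝ // 0 ≤ a}) x _ => hsmul a.1 x a.2) hx

theorem inner_pos_or_eq_zero_of_mem_cone {X : Set V} {v : V} (hX : ∀ x ∈ X, 0 < ⟪x, v⟫) {x : V}
    (hx : x ∈ cone X) : 0 < ⟪x, v⟫ ∨ x = 0 := by
  refine cone_induction (P := fun x => 0 < ⟪x, v⟫ ∨ x = 0) (fun x h => Or.inl (hX x h))
    (Or.inr rfl) ?_ ?_ hx
  · rintro x y (hx | rfl) (hy | rfl)
    · left; rw [inner_add_left]; exact add_pos hx hy
    · left; rwa [add_zero]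
    · left; rwa [zero_add]
    · right; rw [add_zero]
  · rintro a x ha (hx | rfl)
    · rcases ha.eq_or_lt with rfl | ha
      · right; rw [zero_smul]
      · left; rw [real_inner_smul_left]; exact mul_pos ha hx
    · right; rw [smul_zero]

theorem mem_image_fundamentalChamber {x : V} :
    x ∈ w '' fundamentalChamber α ↔ ∀ s, 0 ≤ ⟪w (α s), x⟫ := by
  constructor
  · rintro ⟨y, hy, rfl⟩ s
    rw [LinearIsometryEquiv.inner_map_map]; exact hy s
  · intro h
    refine ⟨w⁻¹ x, fun s => ?_, isom_apply_inv_self w x⟩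
    rw [← inner_isom_left]; exact h s

theorem cone_image_weights : cone (w '' Set.range (weight α)) = w '' fundamentalChamber α := by
  refine Set.Subset.antisymm (fun x hx => ?_) ?_
  · rw [mem_image_fundamentalChamber]
    refine cone_induction (P := fun x => ∀ s, 0 ≤ ⟪w (α s), x⟫) ?_ (by simp) ?_ ?_ hx
    · rintro _ ⟨_, ⟨t, rfl⟩, rfl⟩ s
      rw [LinearIsometryEquiv.inner_map_map]
      exact weight_mem_chamber α t s
    · intro x y hx hy s
      rw [inner_add_right]; exact add_nonneg (hx s) (hy s)
    · intro a x ha hx s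
      rw [real_inner_smul_right]; exact mul_nonneg ha (hx s)
  · rintro _ ⟨x, hx, rfl⟩
    rw [eq_sum_weight α x, map_sum]
    refine sum_mem_cone _ fun t _ => ?_
    rw [map_smul]
    refine smul_mem_cone (subset_cone _ (Set.mem_image_of_mem w (Set.mem_range_self t))) ?_
    have h1 := hx t
    have h2 := inner_simple_self_pos α t
    positivity

theorem polarCone_image (w : V ≃ₗᵢ[ℝ] V) (K : Set V) :
    polarCone (w '' K) = w '' polarCone K := by
  ext x
  constructor
  · intro h
    refine ⟨w⁻¹ x, fun y hy => ?_, isom_apply_inv_self w x⟩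
    have := h (w y) ⟨y, hy, rfl⟩
    rwa [real_inner_comm, inner_isom_left, real_inner_comm] at this
  · rintro ⟨y, hy, rfl⟩ _ ⟨z, hz, rfl⟩
    rw [LinearIsometryEquiv.inner_map_map]
    exact hy z hz

theorem neg_simple_mem_polarCone (w : V ≃ₗᵢ[ℝ] V) (s : S) :
    -w (α s) ∈ polarCone (w '' fundamentalChamber α) := by
  intro y hy
  rw [inner_neg_left, neg_nonpos]
  exact mem_image_fundamentalChamber.1 hy s

/-! ### Chambers -/

theorem apply_simple_mem_roots (hw : w ∈ reflectionGroup α) (s : S) : w (α s) ∈ roots α :=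
  apply_mem_roots hw (simple_mem_roots α s)

/-- The open cone is convex and misses all hyperplanes; by the intermediate value theorem, a
connected set that leaves it meets some hyperplane orthogonal to `w (α s)`. -/
theorem connectedComponentIn_arrangementComplement (hα : IsSimpleSystem α)
    (hw : w ∈ reflectionGroup α) {x : V} (hx : ∀ s, 0 < ⟪w (α s), x⟫) :
    connectedComponentIn (arrangementComplement α) x = {y | ∀ s, 0 < ⟪w (α s), y⟫} := by
  have hsub : {y | ∀ s, 0 < ⟪w (α s), y⟫} ⊆ arrangementComplement α := by
    intro y hy β hβ
    have h1 : ∀ s, 0 < ⟪α s, w⁻¹ y⟫ := fun s => by rw [← inner_isom_left]; exact hy s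
    have e : ⟪β, y⟫ = ⟪w⁻¹ β, w⁻¹ y⟫ := (LinearIsometryEquiv.inner_map_map _ _ _).symm
    rw [e]
    rcases mem_posRoots_or_neg hα (apply_mem_roots (inv_mem hw) hβ) with h | h
    · exact (inner_pos_of_posRoot h h1).ne'
    · have := inner_pos_of_posRoot h h1
      rw [inner_neg_left] at this
      linarith
  have hxF : x ∈ arrangementComplement α := hsub hx
  refine Set.Subset.antisymm (fun y hy s => ?_) ?_
  · by_contra! hle
    obtain ⟨z, hz, h0⟩ := isPreconnected_connectedComponentIn.intermediate_value hy
      (mem_connectedComponentIn hxF) (f := fun z => ⟪w (α s), z⟫)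
      (Continuous.continuousOn (by fun_prop)) ⟨hle, (hx s).le⟩
    exact connectedComponentIn_subset _ _ hz _ (apply_simple_mem_roots hw s) h0
  · refine IsPreconnected.subset_connectedComponentIn ?_ hx hsub
    refine Convex.isPreconnected ?_
    intro y hy z hz a b ha hb hab s
    rw [inner_add_right, real_inner_smul_right, real_inner_smul_right]
    rcases ha.eq_or_lt with rfl | ha
    · rw [zero_add] at hab
      subst hab
      simpa using hz s
    · exact add_pos_of_pos_of_nonneg (mul_pos ha (hy s)) (mul_nonneg hb (hz s).le)

theorem closure_open_chamber (w : V ≃ₗᵢ[ℝ] V) :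
    closure {y | ∀ s, 0 < ⟪w (α s), y⟫} = w '' fundamentalChamber α := by
  refine Set.Subset.antisymm (closure_minimal (fun y hy => ?_) ?_) fun v hv => ?_
  · exact mem_image_fundamentalChamber.2 fun s => (hy s).le
  · have : w '' fundamentalChamber α = ⋂ s, {y | 0 ≤ ⟪w (α s), y⟫} := by
      ext y; rw [mem_image_fundamentalChamber]; simp
    rw [this]
    exact isClosed_iInter fun s => isClosed_le continuous_const (by fun_prop)
  · rw [mem_image_fundamentalChamber] at hv
    have h2 : Filter.Tendsto (fun ε : ℝ => v + ε • w (balancedPoint α))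
        (nhdsWithin 0 (Set.Ioi 0)) (nhds (v + (0 : ℝ) • w (balancedPoint α))) :=
      (Continuous.tendsto (by fun_prop) 0).mono_left nhdsWithin_le_nhds
    rw [zero_smul, add_zero] at h2
    refine mem_closure_of_tendsto h2 (Filter.eventually_of_mem self_mem_nhdsWithin ?_)
    intro ε hε s
    rw [inner_add_right, real_inner_smul_right, LinearIsometryEquiv.inner_map_map,
      inner_balancedPoint]
    have h1 := inner_simple_self_pos α s
    exact add_pos_of_nonneg_of_pos (hv s) (mul_pos hε (half_pos h1))

theorem isChamber_iff (hα : IsSimpleSystem α) {K : Set V} :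
    IsChamber α K ↔ ∃ w ∈ reflectionGroup α, K = w '' fundamentalChamber α := by
  constructor
  · rintro ⟨x, hx, rfl⟩
    obtain ⟨w, hw, h⟩ := exists_apply_mem_chamber hα x
    refine ⟨w, hw, ?_⟩
    rw [connectedComponentIn_arrangementComplement hα hw fun s =>
      lt_of_le_of_ne (h s) (hx _ (apply_simple_mem_roots hw s)).symm, closure_open_chamber]
  · rintro ⟨w, hw, rfl⟩
    have hx : ∀ s, 0 < ⟪w (α s), w (balancedPoint α)⟫ := fun s => by
      rw [LinearIsometryEquiv.inner_map_map, inner_balancedPoint]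
      exact half_pos (inner_simple_self_pos α s)
    have h := connectedComponentIn_arrangementComplement hα hw hx
    refine ⟨w (balancedPoint α), ?_, by rw [h, closure_open_chamber]⟩
    exact connectedComponentIn_nonempty_iff.1 (h ▸ ⟨_, hx⟩)

theorem eq_of_inner_simple_balancedPoint_nonneg (hα : IsSimpleSystem α) {w w' : V ≃ₗᵢ[ℝ] V}
    (hw : w ∈ reflectionGroup α) (hw' : w' ∈ reflectionGroup α)
    (h : ∀ s, 0 ≤ ⟪w (α s), w' (balancedPoint α)⟫) : w = w' := by
  refine eq_of_forall_mem_image hα hw' hw fun s => ⟨w'⁻¹ (w (α s)), ?_, isom_apply_inv_self _ _⟩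
  refine (mem_posRoots_or_neg hα
    (apply_mem_roots (inv_mem hw') (apply_simple_mem_roots hw s))).resolve_right fun h1 => ?_
  have h2 := inner_pos_of_posRoot h1 (y := balancedPoint α) fun s => by
    rw [inner_balancedPoint]; exact half_pos (inner_simple_self_pos α s)
  rw [inner_neg_left, real_inner_comm, ← inner_isom_left, real_inner_comm] at h2
  linarith [h s]

/-! ### Separable sets of roots -/

theorem isSeparableRootSet_image (hα : IsSimpleSystem α) (hw : w ∈ reflectionGroup α) :
    IsSeparableRootSet α (w '' posRoots α) := by
  have hq : ∀ β ∈ posRoots α, 0 < ⟪β, balancedPoint α⟫ := fun β hβ =>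
    inner_pos_of_posRoot hβ fun s => by
      rw [inner_balancedPoint]; exact half_pos (inner_simple_self_pos α s)
  refine ⟨?_, innerₗ V (w (balancedPoint α)), ?_, fun β hβ hβw => ?_⟩
  · rintro _ ⟨β, hβ, rfl⟩
    exact apply_mem_roots hw hβ.1
  · rintro _ ⟨β, hβ, rfl⟩
    rw [innerₗ_apply_apply, LinearIsometryEquiv.inner_map_map, real_inner_comm]
    exact hq β hβ
  · have h1 : -w⁻¹ β ∈ posRoots α :=
      (mem_posRoots_or_neg hα (apply_mem_roots (inv_mem hw) hβ)).resolve_left fun h =>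
        hβw ⟨_, h, isom_apply_inv_self w β⟩
    have h2 := hq _ h1
    rw [inner_neg_left, real_inner_comm, ← inner_isom_left] at h2
    rw [innerₗ_apply_apply]
    linarith

/-- The functional is the product with a vector `v` lying on no reflecting hyperplane, and `w` is
the element whose open chamber contains `v`. -/
theorem IsSeparableRootSet.exists_eq_image (hα : IsSimpleSystem α) {U : Set V}
    (h : IsSeparableRootSet α U) : ∃ w ∈ reflectionGroup α, U = w '' posRoots α := by
  obtain ⟨hU, f, hf1, hf2⟩ := h
  obtain ⟨v, hv⟩ : ∃ v, ∀ s, f (α s) = ⟪α s, v⟫ := by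
    refine ⟨∑ t, (2 * f (α t) / ⟪α t, α t⟫) • weight α t, fun s => ?_⟩
    have := (inner_simple_self_pos α s).ne'
    simp only [inner_sum, real_inner_smul_right, inner_root_weight]
    rw [Finset.sum_eq_single s (fun t _ h => by simp [h.symm]) (by simp), if_pos rfl]
    field_simp
  have hfv : ∀ x, f x = ⟪x, v⟫ := by
    intro x
    rw [← α.sum_repr x]
    simp only [map_sum, map_smul, sum_inner, real_inner_smul_left, hv, smul_eq_mul]
  have hUiff : ∀ β ∈ roots α, β ∈ U ↔ 0 < f β := fun β hβ =>
    ⟨hf1 β, fun h => by_contra fun h' => lt_asymm h (hf2 β hβ h')⟩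
  have hne : ∀ β ∈ roots α, f β ≠ 0 := by
    intro β hβ
    by_cases h : β ∈ U
    · exact (hf1 β h).ne'
    · exact (hf2 β hβ h).ne
  obtain ⟨w, hw, hwv⟩ := exists_apply_mem_chamber hα v
  have hpos : ∀ s, 0 < ⟪α s, w⁻¹ v⟫ := fun s => by
    rw [← inner_isom_left]
    refine lt_of_le_of_ne (hwv s) ?_
    rw [← hfv]
    exact (hne _ (apply_simple_mem_roots hw s)).symm
  refine ⟨w, hw, Set.Subset.antisymm (fun β hβ => ?_) ?_⟩
  · refine ⟨w⁻¹ β, (mem_posRoots_or_neg hα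
      (apply_mem_roots (inv_mem hw) (hU hβ))).resolve_right fun h => ?_, isom_apply_inv_self w β⟩
    have h1 := inner_pos_of_posRoot h hpos
    rw [inner_neg_left, LinearIsometryEquiv.inner_map_map, ← hfv] at h1
    linarith [hf1 β hβ]
  · rintro _ ⟨γ, hγ, rfl⟩
    rw [hUiff _ (apply_mem_roots hw hγ.1), hfv, inner_isom_left]
    exact inner_pos_of_posRoot hγ hpos

theorem extremalRoots_image_posRoots (hα : IsSimpleSystem α) (w : V ≃ₗᵢ[ℝ] V) :
    extremalRoots (w '' posRoots α) = Set.range fun s => w (α s) := by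
  ext β
  constructor
  · rintro ⟨⟨γ, hγ, rfl⟩, h⟩
    by_contra hβ
    have e : ∑ t, α.repr γ t • w (α t) = w γ := by
      simp only [← map_smul, ← map_sum, α.sum_repr]
    have h1 : ∑ t, α.repr γ t • w (α t) ∈ cone (w '' posRoots α \ {w γ}) := by
      refine sum_mem_cone _ fun t _ => ?_
      have ht : w (α t) ∈ w '' posRoots α \ {w γ} :=
        ⟨⟨_, simple_mem_posRoots α t, rfl⟩, fun e => hβ ⟨t, e⟩⟩
      exact smul_mem_cone (subset_cone _ ht) (hγ.2 t)
    exact h (e ▸ h1)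
  · rintro ⟨s, rfl⟩
    refine ⟨⟨_, simple_mem_posRoots α s, rfl⟩, fun h => ?_⟩
    -- The sum of the weights other than `ω_s` vanishes on `α s` and is positive on every other
    -- positive root, since no other positive root is a multiple of `α s`.
    have hX : ∀ x ∈ w '' posRoots α \ {w (α s)},
        0 < ⟪x, w (∑ t ∈ Finset.univ.erase s, weight α t)⟫ := by
      rintro _ ⟨⟨γ, hγ, rfl⟩, hne⟩
      rw [LinearIsometryEquiv.inner_map_map, inner_sum]
      have hγs : γ ≠ α s := fun e => hne (by rw [e]; rfl)
      refine Finset.sum_pos' (fun t _ => inner_weight_nonneg hγ.2 t) ?_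
      by_contra! hc
      have hc' : ∀ t, t ≠ s → α.repr γ t = 0 := by
        intro t ht
        by_contra h0
        have := inner_weight_pos_iff.2 (lt_of_le_of_ne (hγ.2 t) (Ne.symm h0))
        exact absurd (hc t (by simp [ht])) (not_le.2 this)
      have h1 := simpleReflection_mem_posRoots hα hγ hγs
      refine neg_notMem_posRoots h1 ⟨neg_mem_roots h1.1, fun t => ?_⟩
      have e : γ = (α.repr γ s) • α s := by
        apply α.repr.injective
        ext t
        by_cases hts : t = s
        · subst hts; simp
        · simp [hc' t hts, Ne.symm hts]
      rw [e, map_smul, simpleReflection_self, smul_neg, neg_neg, ← e]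
      exact hγ.2 t
    rcases inner_pos_or_eq_zero_of_mem_cone hX h with h1 | h1
    · rw [LinearIsometryEquiv.inner_map_map, inner_sum, Finset.sum_eq_zero fun t ht =>
        inner_weight_eq_zero (Finset.ne_of_mem_erase ht).symm] at h1
      exact lt_irrefl _ h1
    · exact ne_zero_of_mem_roots (simple_mem_roots α s) ((map_eq_zero_iff w w.injective).1 h1)

theorem eq_smul_weight_of_inner_eq_zero {x : V} {t : S}
    (h : ∀ s, s ≠ t → ⟪w (α s), x⟫ = 0) :
    x = (2 * ⟪w (α t), x⟫ / ⟪α t, α t⟫) • w (weight α t) := by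
  have h1 := eq_sum_weight α (w⁻¹ x)
  rw [Finset.sum_eq_single t (fun s _ hs => by
    rw [← inner_isom_left, h s hs, mul_zero, zero_div, zero_smul]) (by simp),
    ← inner_isom_left] at h1
  have h2 := congrArg w h1
  rwa [isom_apply_inv_self, map_smul] at h2

theorem isom_eq_of_weights {w w' : V ≃ₗᵢ[ℝ] V} (h : ∀ t, w (weight α t) = w' (weight α t)) :
    w = w' := by
  ext x
  rw [eq_sum_weight α x]
  simp [h]

end Cones

/-! ### Normal cones and brick cones, and recovering weights from geometric data -/

section BrickPolytopes

variable {S V : Type*} [Fintype S] [DecidableEq S] [NormedAddCommGroup V] [InnerProductSpace ℝ V]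
variable {α : Module.Basis S ℝ V} {c w₀ w : V ≃ₗᵢ[ℝ] V}
variable {Q wo : List S} {I : Finset (Fin Q.length)}

theorem mem_normalCone_iff {v : V} : v ∈ normalCone α w₀ Q I ↔
    ∀ J, IsFacet α w₀ Q J → ⟪brickVector α Q J, v⟫ ≤ ⟪brickVector α Q I, v⟫ := by
  constructor
  · intro h J hJ
    exact h _ (subset_convexHull ℝ _ ⟨J, hJ, rfl⟩)
  · intro h x hx
    have hconv : Convex ℝ {x : V | ⟪x, v⟫ ≤ ⟪brickVector α Q I, v⟫} :=
      convex_halfSpace_le (f := fun x : V => ⟪x, v⟫)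
        ⟨fun x y => inner_add_left x y v, fun a x => real_inner_smul_left x v a⟩ _
    refine convexHull_min ?_ hconv hx
    rintro _ ⟨J, hJ, rfl⟩
    exact h J hJ

theorem IsPositiveFacet.image_chamber_subset_normalCone (hα : IsSimpleSystem α)
    (hw₀ : IsLongest α w₀) (hI : IsPositiveFacet α w₀ Q w I) (hw : w ∈ reflectionGroup α)
    (huniq : ∀ J, IsPositiveFacet α w₀ Q w J → J = I) :
    w '' fundamentalChamber α ⊆ normalCone α w₀ Q I := fun _ hv =>
  mem_normalCone_iff.2 fun _ hJ =>
    hI.inner_brickVector_le hα hw₀ hw huniq (mem_image_fundamentalChamber.1 hv) hJ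

theorem inner_nonneg_of_mem_normalCone (hα : IsSimpleSystem α) (hw₀ : IsLongest α w₀)
    (hI : IsFacet α w₀ Q I) {v : V} (hv : v ∈ normalCone α w₀ Q I) {i : Fin Q.length}
    (hi : i ∈ I) : 0 ≤ ⟪rootFn α Q I i, v⟫ := by
  obtain ⟨J, hJ, a, ha, e⟩ := hI.exists_brickVector_sub hα hw₀ hi
  have h1 := mem_normalCone_iff.1 hv J hJ
  rw [← sub_nonpos, ← inner_sub_left, e, inner_neg_left, real_inner_smul_left, neg_nonpos] at h1
  exact nonneg_of_mul_nonneg_right h1 ha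

theorem neg_rootFn_mem_brickCone (hα : IsSimpleSystem α) (hw₀ : IsLongest α w₀)
    (hI : IsFacet α w₀ Q I) {i : Fin Q.length} (hi : i ∈ I) :
    -rootFn α Q I i ∈ brickCone α w₀ Q I := by
  obtain ⟨J, hJ, a, ha, e⟩ := hI.exists_brickVector_sub hα hw₀ hi
  have h1 : -(a • rootFn α Q I i) ∈ brickCone α w₀ Q I :=
    e ▸ subset_cone _ ⟨J, hJ, rfl⟩
  have h2 := smul_mem_cone h1 (inv_pos.2 ha).le
  rwa [smul_neg, smul_smul, inv_mul_cancel₀ ha.ne', one_smul] at h2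

theorem inner_nonpos_of_mem_brickCone {v : V}
    (hv : v ∈ normalCone α w₀ Q I) {x : V}
    (hx : x ∈ brickCone α w₀ Q I) : ⟪x, v⟫ ≤ 0 := by
  refine cone_induction (P := fun x => ⟪x, v⟫ ≤ 0) ?_ (by simp) ?_ ?_ hx
  · rintro _ ⟨J, hJ, rfl⟩
    rw [inner_sub_left, sub_nonpos]
    exact mem_normalCone_iff.1 hv J hJ
  · intro x y hx hy
    rw [inner_add_left]; exact add_nonpos hx hy
  · intro a x ha hx
    rw [real_inner_smul_left]; exact mul_nonpos_of_nonneg_of_nonpos ha hx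

/-- All `w'(α_s)` are roots of the facet and so lie in `w(Φ⁺)`; a group element is determined by the
positive system containing its simple roots. -/
theorem IsSingletonFacet.eq_of_isPositiveFacet (hα : IsSimpleSystem α) {w' : V ≃ₗᵢ[ℝ] V}
    (h : IsSingletonFacet α w₀ Q wo I w') (hw : w ∈ reflectionGroup α)
    (hI : IsPositiveFacet α w₀ Q w I) : w' = w := by
  refine eq_of_forall_mem_image hα hw h.mem fun s => ?_
  have hs : s ∈ I.val.map Q.get := by rw [h.map_get]; exact Finset.mem_univ s
  obtain ⟨k, hk, rfl⟩ := Multiset.mem_map.1 hs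
  rw [← h.rootFn k hk]
  exact hI.2 k hk

theorem IsSingletonFacet.isPositiveFacet (h : IsSingletonFacet α w₀ Q wo I w) :
    IsPositiveFacet α w₀ Q w I :=
  ⟨h.isFacet, fun k hk => by rw [h.rootFn k hk]; exact ⟨_, simple_mem_posRoots α _, rfl⟩⟩

theorem IsSingletonFacet.rootConfig_eq (h : IsSingletonFacet α w₀ Q wo I w) :
    rootConfig α Q I = Finset.univ.val.map fun s => w (α s) := by
  rw [rootConfig, Multiset.map_congr rfl h.rootFn, ← h.map_get, Multiset.map_map]
  rfl

theorem IsSingletonFacet.weightConfig_eq (h : IsSingletonFacet α w₀ Q wo I w) :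
    weightConfig α Q I = w '' Set.range (weight α) := by
  ext x
  constructor
  · rintro ⟨i, hi, rfl⟩
    exact ⟨_, ⟨_, rfl⟩, (h.weightFn i hi).symm⟩
  · rintro ⟨_, ⟨s, rfl⟩, rfl⟩
    have hs : s ∈ I.val.map Q.get := by rw [h.map_get]; exact Finset.mem_univ s
    obtain ⟨k, hk, rfl⟩ := Multiset.mem_map.1 hs
    exact ⟨k, hk, (h.weightFn k hk).symm⟩

/-- In a facet whose roots are the images of the simple roots, the weights are the images of the
fundamental weights. -/
theorem exists_weightFn_eq_of_rootConfig (H : IsSortingPair α c w₀ Q wo) (hI : IsFacet α w₀ Q I)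
    (hw : w ∈ reflectionGroup α)
    (hR : rootConfig α Q I = Finset.univ.val.map fun s => w (α s)) (t : S) :
    ∃ i ∈ I, weightFn α Q I i = w (weight α t) := by
  have hroot : ∀ s, ∃ i ∈ I, rootFn α Q I i = w (α s) := by
    intro s
    have : w (α s) ∈ rootConfig α Q I := by
      rw [hR]; exact Multiset.mem_map_of_mem _ (Finset.mem_univ s)
    exact Multiset.mem_map.1 this
  obtain ⟨i, hi, hit⟩ := hroot t
  have h1 := (hI.weightFn_spec H hi).2.1
  have h2 := eq_smul_weight_of_inner_eq_zero (w := w) (x := weightFn α Q I i) (t := t)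
    fun s hs => by
      obtain ⟨j, hj, hjs⟩ := hroot s
      rw [← hjs]
      refine h1 j hj ?_
      rintro rfl
      exact hs (α.injective (w.injective (hjs.symm.trans hit)))
  have h3 := inner_weightFn_rootFn_pos (α := α) (I := I) i
  rw [hit] at h3
  have h4 := inner_simple_self_pos α t
  set a := 2 * ⟪w (α t), weightFn α Q I i⟫ / ⟪α t, α t⟫
  -- The weight is a nonnegative multiple of `w(ω_t)` and lies in the orbit of a fundamental weight,
  -- which forces the factor to be `1`.
  have h5 : (w⁻¹ * prefixElt α Q I i) (weight α (Q.get i)) = a • weight α t := by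
    rw [isom_mul_apply, ← weightFn_eq, h2, map_smul, isom_inv_apply_self]
  have h6 := (eq_of_apply_weight_eq_smul H.simple
    (mul_mem (inv_mem hw) (prefixElt_mem _)) (by positivity) h5).2
  rw [h6, one_smul] at h2
  exact ⟨i, hi, h2⟩

/-- The vector `w(ω_t)` spans an extremal ray, exposed by the sum of the `w(α_s)` with `s ≠ t`. Some
generator must lie on this ray, and within orbits of weights it is `w(ω_t)` itself. -/
theorem exists_weightFn_eq_of_cone (H : IsSortingPair α c w₀ Q wo)
    (hw : w ∈ reflectionGroup α)
    (hW : cone (weightConfig α Q I) = w '' fundamentalChamber α) (t : S) :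
    ∃ i ∈ I, weightFn α Q I i = w (weight α t) := by
  have hmem : ∀ i ∈ I, ∀ s, 0 ≤ ⟪w (α s), weightFn α Q I i⟫ := fun i hi =>
    mem_image_fundamentalChamber.1 (hW ▸ subset_cone _ ⟨i, hi, rfl⟩)
  by_contra! hne
  have hpos : ∀ x ∈ weightConfig α Q I,
      0 < ⟪x, ∑ s ∈ Finset.univ.erase t, w (α s)⟫ := by
    rintro _ ⟨i, hi, rfl⟩
    rw [real_inner_comm, sum_inner]
    refine Finset.sum_pos' (fun s _ => hmem i hi s) ?_
    by_contra! hc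
    have h2 := eq_smul_weight_of_inner_eq_zero (w := w) (x := weightFn α Q I i) (t := t)
      fun s hs => le_antisymm (hc s (by simp [hs])) (hmem i hi s)
    have h3 := hmem i hi t
    have h4 := inner_simple_self_pos α t
    set a := 2 * ⟪w (α t), weightFn α Q I i⟫ / ⟪α t, α t⟫
    have h5 : (w⁻¹ * prefixElt α Q I i) (weight α (Q.get i)) = a • weight α t := by
      rw [isom_mul_apply, ← weightFn_eq, h2, map_smul, isom_inv_apply_self]
    have h6 := (eq_of_apply_weight_eq_smul H.simple
      (mul_mem (inv_mem hw) (prefixElt_mem _)) (by positivity) h5).2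
    rw [h6, one_smul] at h2
    exact hne i hi h2
  have ht : w (weight α t) ∈ cone (weightConfig α Q I) := by
    rw [hW]; exact ⟨_, weight_mem_chamber α t, rfl⟩
  rcases inner_pos_or_eq_zero_of_mem_cone hpos ht with h | h
  · rw [real_inner_comm, sum_inner, Finset.sum_eq_zero fun s hs => by
      rw [LinearIsometryEquiv.inner_map_map,
        inner_weight_eq_zero (Finset.ne_of_mem_erase hs)]] at h
    exact lt_irrefl _ h
  · have h1 := inner_weight_self_pos (α := α) t
    rw [(map_eq_zero_iff w w.injective).1 h, inner_zero_right] at h1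
    exact lt_irrefl _ h1

/-- Pairing the brick vector with the weight of `i` shows that `w⁻¹` of this weight has the same
product with `q` as the dominant weight in its orbit, so the two coincide. Orthogonality of weights
to the other roots makes the letters distinct, and counting then gives all letters. -/
theorem exists_weightFn_eq_of_brickVector (H : IsSortingPair α c w₀ Q wo)
    (hI : IsFacet α w₀ Q I) (hcard : I.card = Fintype.card S) (hw : w ∈ reflectionGroup α)
    (hB : brickVector α Q I = translation α wo + w (balancedPoint α)) (t : S) :
    ∃ i ∈ I, weightFn α Q I i = w (weight α t) := by
  have h1 : ∀ i ∈ I, weightFn α Q I i = w (weight α (Q.get i)) := by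
    intro i hi
    obtain ⟨-, -, h2⟩ := hI.weightFn_spec H hi
    rw [hB, inner_add_left, add_right_inj, inner_isom_left] at h2
    have h3 := apply_eq_of_inner_balancedPoint H.simple (weight_mem_chamber α (Q.get i))
      (mul_mem (inv_mem hw) (prefixElt_mem (α := α) (I := I) i)) (by
        rw [isom_mul_apply, ← weightFn_eq, real_inner_comm, ← h2, real_inner_comm])
    rw [isom_mul_apply, ← weightFn_eq] at h3
    rw [← h3, isom_apply_inv_self]
  have hinj : Set.InjOn Q.get I := by
    intro i hi j hj hij
    by_contra hne
    have h2 := (hI.weightFn_spec H hj).2.1 i hi hne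
    rw [h1 j hj, ← hij, ← h1 i hi] at h2
    exact (inner_weightFn_rootFn_pos (α := α) (I := I) i).ne' h2
  have himage : I.image Q.get = Finset.univ := by
    rw [← Finset.card_eq_iff_eq_univ, Finset.card_image_of_injOn hinj, hcard]
  have ht := Finset.mem_univ t
  rw [← himage, Finset.mem_image] at ht
  obtain ⟨i, hi, rfl⟩ := ht
  exact ⟨i, hi, h1 i hi⟩

end BrickPolytopes

/-! ### The equivalence of each condition with the singleton description -/

section Singletons

variable {S V : Type*} [Fintype S] [DecidableEq S] [NormedAddCommGroup V] [InnerProductSpace ℝ V]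
variable {α : Module.Basis S ℝ V} {c w₀ w : V ≃ₗᵢ[ℝ] V}
variable {Q wo cw : List S} {I : Finset (Fin Q.length)}

theorem isSortingPair_append (hα : IsSimpleSystem α) (hc : IsCoxeterElement α c)
    (hcw : IsReducedExpr α cw c) (hw₀ : IsLongest α w₀) (hwo : IsSortingWord α cw w₀ wo) :
    IsSortingPair α c w₀ (cw ++ wo) wo := by
  obtain ⟨hnd, hall⟩ := hc.nodup_and_mem hcw
  obtain ⟨h1, h2⟩ := hwo.altFrom hα hc hcw hw₀
  have hone : ∀ t, cw.count t = 1 := fun t => List.count_eq_one_of_mem hnd (hall t)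
  refine ⟨hα, hc, hw₀, h1, h2, altFrom_append.2 ⟨altFrom_coxeterWord hα hcw.1 hnd, ?_⟩, fun t => ?_⟩
  · have e : addCount (fun _ => 0) cw = fun _ => 0 + 1 := by
      ext t; simp [addCount, hone]
    rw [e]
    exact h1.shift 1
  · rw [List.count_append, hone, h2, add_comm]

theorem IsSortingPair.length_eq (H : IsSortingPair α c w₀ Q wo) :
    Q.length = length α w₀ + Fintype.card S := by
  have hred := H.alt_wo.isReducedExpr H.simple H.coxeter H.longest H.count_wo
  have hlen : ∀ l : List S, l.length = ∑ t, l.count t := fun l => by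
    simpa using (Multiset.sum_count_eq_card (s := Finset.univ) (m := (l : Multiset S))
      fun a _ => Finset.mem_univ a).symm
  rw [← hred.2, hlen Q, hlen wo]
  simp only [H.count_Q, H.count_wo, Finset.sum_add_distrib]
  simp

theorem IsFacet.card_eq (H : IsSortingPair α c w₀ Q wo) (hI : IsFacet α w₀ Q I) :
    I.card = Fintype.card S := by
  have h1 := hI.card_add
  have h2 := H.length_eq
  omega

theorem IsSortingPair.existsUnique_isPositiveFacet (H : IsSortingPair α c w₀ Q wo)
    (hw : w ∈ reflectionGroup α) : ∃! I, IsPositiveFacet α w₀ Q w I := by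
  -- The starting facet for the identity consists of the first occurrence of every letter, that is,
  -- `p = 0`.
  refine BrickPolytope.existsUnique_isPositiveFacet H.simple H.longest
    ⟨_, (isSingletonFacet_occurrences H (p := fun _ => 0) ?_ (fun _ => Nat.zero_le _)
      (one_mem _) fun t => ?_).isPositiveFacet⟩ hw
  · intro s t _ _; simp
  · rw [pow_zero]

theorem IsFacet.isSingletonFacet_of_rootConfig (H : IsSortingPair α c w₀ Q wo)
    (hI : IsFacet α w₀ Q I) (hw : w ∈ reflectionGroup α)
    (hR : rootConfig α Q I = Finset.univ.val.map fun s => w (α s)) :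
    IsSingletonFacet α w₀ Q wo I w :=
  (hI.isSingletonFacet_of_weightConfig H (hI.card_eq H) hw
    (exists_weightFn_eq_of_rootConfig H hI hw hR)).1

theorem nodup_map_simple (w : V ≃ₗᵢ[ℝ] V) :
    (Finset.univ.val.map fun s => w (α s)).Nodup :=
  Multiset.Nodup.map (w.injective.comp α.injective) Finset.univ.nodup

theorem mul_simpleReflection_ne (w : V ≃ₗᵢ[ℝ] V) (s : S) : w * simpleReflection α s ≠ w := by
  intro h
  have h1 := DFunLike.congr_fun (mul_eq_left.1 h) (α s)
  rw [simpleReflection_self, isom_one_apply] at h1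
  have := IsAddTorsionFree.of_isTorsionFree ℝ V
  exact α.ne_zero s (self_eq_neg.1 h1.symm)

/-- If `w(α_s)` is not a root of the facet, all its roots remain positive for `ws`, which then
belongs to the same fibre. A one-element fibre thus makes every `w(α_s)` a root, and there are as
many roots as letters. -/
theorem IsPositiveFacet.isSingletonFacet_iff_fiber (H : IsSortingPair α c w₀ Q wo)
    (hw : w ∈ reflectionGroup α) (hI : IsPositiveFacet α w₀ Q w I) :
    (∀ w' ∈ reflectionGroup α, IsPositiveFacet α w₀ Q w' I → w' = w) ↔
      IsSingletonFacet α w₀ Q wo I w := by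
  refine ⟨fun h => ?_, fun h w' hw' hI' => (h.eq_of_isPositiveFacet H.simple hw' hI').symm⟩
  refine hI.1.isSingletonFacet_of_rootConfig H hw (Multiset.eq_of_le_of_card_le
    ((Multiset.le_iff_subset (nodup_map_simple w)).2 ?_) ?_).symm
  · intro β hβ
    obtain ⟨s, -, rfl⟩ := Multiset.mem_map.1 hβ
    by_contra hs
    refine mul_simpleReflection_ne (α := α) w s
      (h _ (mul_mem hw (simpleReflection_mem α s)) ⟨hI.1, fun i hi => ?_⟩)
    exact (mem_image_mul_simpleReflection H.simple (hI.2 i hi) fun e =>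
      hs (Multiset.mem_map.2 ⟨i, hi, e⟩)).1
  · simp [rootConfig, hI.1.card_eq H]

/-- Common criterion for the two cone conditions: every `w'` in the fibre puts `w'(q)` into the
normal cone, and `w'(q)` lies in `w(C)` only for `w' = w`. -/
theorem IsPositiveFacet.isSingletonFacet_of_balancedPoint (H : IsSortingPair α c w₀ Q wo)
    (hw : w ∈ reflectionGroup α) (hI : IsPositiveFacet α w₀ Q w I)
    (h : ∀ w' : V ≃ₗᵢ[ℝ] V, w' (balancedPoint α) ∈ normalCone α w₀ Q I →
      ∀ s, 0 ≤ ⟪w (α s), w' (balancedPoint α)⟫) : IsSingletonFacet α w₀ Q wo I w := by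
  refine (hI.isSingletonFacet_iff_fiber H hw).1 fun w' hw' hI' => ?_
  refine (eq_of_inner_simple_balancedPoint_nonneg H.simple hw hw' (h w' ?_)).symm
  refine hI'.image_chamber_subset_normalCone H.simple H.longest hw'
    (fun J hJ => (H.existsUnique_isPositiveFacet hw').unique hJ hI') ⟨_, fun s => ?_, rfl⟩
  rw [inner_balancedPoint]
  exact (half_pos (inner_simple_self_pos α s)).le

theorem IsSingletonFacet.image_chamber_subset_normalCone (H : IsSortingPair α c w₀ Q wo)
    (h : IsSingletonFacet α w₀ Q wo I w) : w '' fundamentalChamber α ⊆ normalCone α w₀ Q I :=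
  h.isPositiveFacet.image_chamber_subset_normalCone H.simple H.longest h.mem
    fun _ hJ => (H.existsUnique_isPositiveFacet h.mem).unique hJ h.isPositiveFacet

theorem IsSingletonFacet.exists_rootFn_eq (h : IsSingletonFacet α w₀ Q wo I w) (s : S) :
    ∃ i ∈ I, BrickPolytope.rootFn α Q I i = w (α s) := by
  have : w (α s) ∈ rootConfig α Q I := by
    rw [h.rootConfig_eq]; exact Multiset.mem_map_of_mem _ (Finset.mem_univ s)
  exact Multiset.mem_map.1 this

theorem IsPositiveFacet.isSingletonFacet_iff_normalCone (H : IsSortingPair α c w₀ Q wo)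
    (hw : w ∈ reflectionGroup α) (hI : IsPositiveFacet α w₀ Q w I) :
    normalCone α w₀ Q I = w '' fundamentalChamber α ↔ IsSingletonFacet α w₀ Q wo I w := by
  refine ⟨fun h => hI.isSingletonFacet_of_balancedPoint H hw fun w' hw' =>
    mem_image_fundamentalChamber.1 (h ▸ hw'), fun h =>
    Set.Subset.antisymm (fun v hv => mem_image_fundamentalChamber.2 fun s => ?_)
      (h.image_chamber_subset_normalCone H)⟩
  obtain ⟨i, hi, e⟩ := h.exists_rootFn_eq s
  rw [← e]
  exact inner_nonneg_of_mem_normalCone H.simple H.longest hI.1 hv hi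

theorem IsPositiveFacet.isSingletonFacet_iff_brickCone (H : IsSortingPair α c w₀ Q wo)
    (hw : w ∈ reflectionGroup α) (hI : IsPositiveFacet α w₀ Q w I) :
    brickCone α w₀ Q I = polarCone (w '' fundamentalChamber α) ↔
      IsSingletonFacet α w₀ Q wo I w := by
  refine ⟨fun h => hI.isSingletonFacet_of_balancedPoint H hw fun w' hw' s => ?_, fun h =>
    Set.Subset.antisymm (fun x hx y hy => inner_nonpos_of_mem_brickCone
      (h.image_chamber_subset_normalCone H hy) hx) fun x hx => ?_⟩
  · have h1 := inner_nonpos_of_mem_brickCone hw' (h ▸ neg_simple_mem_polarCone w s)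
    rwa [inner_neg_left, neg_nonpos] at h1
  -- Membership in the polar cone, tested on the `w(ω_t)`, says that the coordinates of `x` on the
  -- `-w(α_t)` are nonnegative; flips place these vectors in the brick cone.
  · have e : x = ∑ t, (-α.repr (w⁻¹ x) t) • -w (α t) := by
      simp only [neg_smul_neg, ← map_smul, ← map_sum, α.sum_repr, isom_apply_inv_self]
    rw [e]
    refine sum_mem_cone _ fun t _ => smul_mem_cone ?_ ?_
    · obtain ⟨i, hi, e⟩ := h.exists_rootFn_eq t
      rw [← e]
      exact neg_rootFn_mem_brickCone H.simple H.longest hI.1 hi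
    · have h1 := hx _ ⟨_, weight_mem_chamber α t, rfl⟩
      rw [real_inner_comm, inner_isom_left, real_inner_comm] at h1
      rw [neg_nonneg]
      by_contra! hpos
      exact absurd h1 (not_le.2 (inner_weight_pos_iff.2 hpos))

theorem IsPositiveFacet.isSingletonFacet_iff_extremalRoots (H : IsSortingPair α c w₀ Q wo)
    (hw : w ∈ reflectionGroup α) (hI : IsPositiveFacet α w₀ Q w I) :
    (∃ U, IsSeparableRootSet α U ∧ (rootConfig α Q I).Nodup ∧
      {β | β ∈ rootConfig α Q I} = extremalRoots U) ↔ IsSingletonFacet α w₀ Q wo I w := by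
  constructor
  · rintro ⟨U, hU, hnd, hR⟩
    obtain ⟨w', hw', rfl⟩ := hU.exists_eq_image H.simple
    rw [extremalRoots_image_posRoots H.simple] at hR
    have h := hI.1.isSingletonFacet_of_rootConfig H hw'
      ((Multiset.Nodup.ext hnd (nodup_map_simple w')).2 fun β => by
        rw [show β ∈ rootConfig α Q I ↔ β ∈ Set.range fun s => w' (α s) from Set.ext_iff.1 hR β]
        simp)
    obtain rfl := h.eq_of_isPositiveFacet H.simple hw hI
    exact h
  · intro h
    refine ⟨_, isSeparableRootSet_image H.simple hw, ?_, ?_⟩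
    · rw [h.rootConfig_eq]; exact nodup_map_simple w
    · rw [extremalRoots_image_posRoots H.simple, h.rootConfig_eq]
      ext β
      simp

theorem IsPositiveFacet.isSingletonFacet_iff_weightConfig (H : IsSortingPair α c w₀ Q wo)
    (hw : w ∈ reflectionGroup α) (hI : IsPositiveFacet α w₀ Q w I) :
    weightConfig α Q I = w '' Set.range (weight α) ↔ IsSingletonFacet α w₀ Q wo I w := by
  refine ⟨fun h => (hI.1.isSingletonFacet_of_weightConfig H (hI.1.card_eq H) hw fun t => ?_).1,
    fun h => h.weightConfig_eq⟩
  have ht : w (weight α t) ∈ weightConfig α Q I :=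
    h ▸ Set.mem_image_of_mem w (Set.mem_range_self t)
  obtain ⟨i, hi, e⟩ := ht
  exact ⟨i, hi, e.symm⟩

theorem IsPositiveFacet.isSingletonFacet_iff_isChamber (H : IsSortingPair α c w₀ Q wo)
    (hw : w ∈ reflectionGroup α) (hI : IsPositiveFacet α w₀ Q w I) :
    IsChamber α (cone (weightConfig α Q I)) ↔ IsSingletonFacet α w₀ Q wo I w := by
  rw [isChamber_iff H.simple]
  constructor
  · rintro ⟨w', hw', hW⟩
    have h := (hI.1.isSingletonFacet_of_weightConfig H (hI.1.card_eq H) hw'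
      (exists_weightFn_eq_of_cone H hw' hW)).1
    obtain rfl := h.eq_of_isPositiveFacet H.simple hw hI
    exact h
  · intro h
    exact ⟨w, hw, by rw [h.weightConfig_eq, cone_image_weights]⟩

theorem IsPositiveFacet.isSingletonFacet_iff_brickVector (H : IsSortingPair α c w₀ Q wo)
    (hw : w ∈ reflectionGroup α) (hI : IsPositiveFacet α w₀ Q w I) :
    brickVector α Q I = translation α wo + w (balancedPoint α) ↔
      IsSingletonFacet α w₀ Q wo I w :=
  ⟨fun h => (hI.1.isSingletonFacet_of_weightConfig H (hI.1.card_eq H) hw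
    (exists_weightFn_eq_of_brickVector H hI.1 (hI.1.card_eq H) hw h)).1, fun h => h.brickVector⟩

theorem IsPositiveFacet.isSingletonFacet_iff_complementWord (H : IsSortingPair α c w₀ Q wo)
    (hw : w ∈ reflectionGroup α) (hI : IsPositiveFacet α w₀ Q w I) :
    CommutationEquiv α (complementWord Q I) wo ↔ IsSingletonFacet α w₀ Q wo I w := by
  refine ⟨fun h => ?_, fun h => h.complement⟩
  obtain ⟨w', h'⟩ := isSingletonFacet_of_complement H h
  obtain rfl := h'.eq_of_isPositiveFacet H.simple hw hI
  exact h'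

theorem IsPositiveFacet.isSingletonFacet_iff_prefix (H : IsSortingPair α c w₀ Q wo)
    (hcw : IsReducedExpr α cw c) (hwo : IsSortingWord α cw w₀ wo)
    (hw : w ∈ reflectionGroup α) (hI : IsPositiveFacet α w₀ Q w I) :
    (∃ ww c' wo' u : List S, IsReducedExpr α ww w ∧ IsReducedExpr α c' c ∧
      IsSortingWord α c' w₀ wo' ∧ CommutationEquiv α wo' u ∧ ww <+: u) ↔
      IsSingletonFacet α w₀ Q wo I w := by
  constructor
  · rintro ⟨ww, c', wo', _, hww, hc', hwo', hu, v, rfl⟩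
    -- The alternation rule and the heights depend on `c` alone, so the sorting word for `c'` obeys
    -- the same ones; the letter counts of its prefix `ww` serve as `p`.
    obtain ⟨h1, h2⟩ := hwo'.altFrom H.simple H.coxeter hc' H.longest
    have h3 := (altFrom_append.1 (h1.of_commutationEquiv hu)).1
    have h4 := isSingletonFacet_occurrences H (p := addCount (fun _ => 0) ww) (w := w)
      (h3.isAltCount (coxBefore_add H.simple H.coxeter) fun s t _ _ => by simp)
      (fun s => by
        rw [← h2 s, hu.perm.count_eq s, List.count_append, addCount, zero_add]
        exact Nat.le_add_right _ _) hw
      fun t => by rw [← hww.1, h3.wordProd_weight H.simple H.coxeter, addCount, zero_add]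
    obtain rfl := (H.existsUnique_isPositiveFacet hw).unique hI h4.isPositiveFacet
    exact h4
  · intro h
    obtain ⟨-, p, hp, hpm, hwp⟩ := hI.1.isSingletonFacet_of_weightConfig H (hI.1.card_eq H) hw
      (exists_weightFn_eq_of_rootConfig H hI.1 hw h.rootConfig_eq)
    obtain ⟨u, v, hu, hpos, hup⟩ := exists_apply_weight_eq_pow H hp hpm
    have e : wordProd α u = w := isom_eq_of_weights fun t => by rw [hup, hwp]
    exact ⟨u, cw, wo, u ++ v, e ▸ hpos.isReducedExpr H.simple, hcw, hwo, hu, v, rfl⟩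

end Singletons

end BrickPolytope

theorem mainTheorem9 {S V : Type*} [Fintype S] [DecidableEq S]
    [NormedAddCommGroup V] [InnerProductSpace ℝ V]
    (α : Module.Basis S ℝ V) (hα : IsSimpleSystem α)
    (c : V ≃ₗᵢ[ℝ] V) (hc : IsCoxeterElement α c)
    (cw : List S) (hcw : IsReducedExpr α cw c)
    (w₀ : V ≃ₗᵢ[ℝ] V) (hw₀ : IsLongest α w₀)
    (wo : List S) (hwo : IsSortingWord α cw w₀ wo) :
    -- the map `κ` is well defined
    (∀ w : reflectionGroup α, ∃! I, IsProjection α w₀ (cw ++ wo) w I) ∧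
    ∀ w : reflectionGroup α,
      List.TFAE [
        -- `w` is a singleton for `κ`
        kappa α w₀ (cw ++ wo) ⁻¹' {kappa α w₀ (cw ++ wo) w} = {w},
        -- the root configuration is `w(Δ)`
        rootConfig α (cw ++ wo) (kappa α w₀ (cw ++ wo) w) =
          Finset.univ.val.map (fun s => (w : V ≃ₗᵢ[ℝ] V) (α s)),
        -- the root configuration is a simple system for `W`
        ∃ U, IsSeparableRootSet α U ∧
          (rootConfig α (cw ++ wo) (kappa α w₀ (cw ++ wo) w)).Nodup ∧
          {β | β ∈ rootConfig α (cw ++ wo) (kappa α w₀ (cw ++ wo) w)} = extremalRoots U,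
        -- the cone at the brick vector is the polar of the chamber `w(C)`
        brickCone α w₀ (cw ++ wo) (kappa α w₀ (cw ++ wo) w) =
            polarCone ((w : V ≃ₗᵢ[ℝ] V) '' fundamentalChamber α) ∧
          brickCone α w₀ (cw ++ wo) (kappa α w₀ (cw ++ wo) w) =
            (w : V ≃ₗᵢ[ℝ] V) '' polarCone (fundamentalChamber α),
        -- the weight configuration is `w(∇)`
        weightConfig α (cw ++ wo) (kappa α w₀ (cw ++ wo) w) =
          (w : V ≃ₗᵢ[ℝ] V) '' Set.range (weight α),
        -- the weight configuration generates a chamber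
        IsChamber α (cone (weightConfig α (cw ++ wo) (kappa α w₀ (cw ++ wo) w))),
        -- the normal cone of the brick vector is the chamber `w(C)`
        normalCone α w₀ (cw ++ wo) (kappa α w₀ (cw ++ wo) w) =
          (w : V ≃ₗᵢ[ℝ] V) '' fundamentalChamber α,
        -- the brick vector is `Ω + w(q)`
        brickVector α (cw ++ wo) (kappa α w₀ (cw ++ wo) w) =
          translation α wo + (w : V ≃ₗᵢ[ℝ] V) (balancedPoint α),
        -- for some reduced expression of `c`, some reduced expression of `w` is,
        -- up to commutations, a prefix of the sorting word of `w₀`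
        ∃ ww c' wo' u : List S, IsReducedExpr α ww w ∧ IsReducedExpr α c' c ∧
          IsSortingWord α c' w₀ wo' ∧ CommutationEquiv α wo' u ∧ ww <+: u,
        -- up to commutations, the complement of `κ(w)` is the sorting word of `w₀`
        CommutationEquiv α (complementWord (cw ++ wo) (kappa α w₀ (cw ++ wo) w)) wo
      ] := by
  have H := isSortingPair_append hα hc hcw hw₀ hwo
  have hex : ∀ w : reflectionGroup α, ∃! I, IsProjection α w₀ (cw ++ wo) w I := fun w => by
    simpa only [isProjection_iff] using H.existsUnique_isPositiveFacet w.2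
  refine ⟨hex, fun w => ?_⟩
  have hκ : ∀ w : reflectionGroup α, IsPositiveFacet α w₀ (cw ++ wo) w (kappa α w₀ (cw ++ wo) w) := fun w =>
    isProjection_iff.1 (Classical.epsilon_spec (hex w).exists)
  have hI := hκ w
  refine List.tfae_of_forall
    (IsSingletonFacet α w₀ (cw ++ wo) wo (kappa α w₀ (cw ++ wo) w) w) _ ?_
  simp only [List.forall_mem_cons, List.not_mem_nil, false_imp_iff, implies_true, and_true]
  refine ⟨?_, ⟨fun h => ?_, fun h => h.rootConfig_eq⟩,
    hI.isSingletonFacet_iff_extremalRoots H w.2, ?_,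
    hI.isSingletonFacet_iff_weightConfig H w.2, hI.isSingletonFacet_iff_isChamber H w.2,
    hI.isSingletonFacet_iff_normalCone H w.2, hI.isSingletonFacet_iff_brickVector H w.2,
    hI.isSingletonFacet_iff_prefix H hcw hwo w.2,
    hI.isSingletonFacet_iff_complementWord H w.2⟩
  · rw [← hI.isSingletonFacet_iff_fiber H w.2]
    constructor
    · intro h w' hw' hI'
      have h1 : (⟨w', hw'⟩ : reflectionGroup α) ∈
          kappa α w₀ (cw ++ wo) ⁻¹' {kappa α w₀ (cw ++ wo) w} :=
        (H.existsUnique_isPositiveFacet hw').unique (hκ ⟨w', hw'⟩) hI'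
      rw [h] at h1
      exact congrArg Subtype.val h1
    · intro h
      refine Set.Subset.antisymm (fun w' hw' => Subtype.ext (h w' w'.2 ?_)) ?_
      · rw [← show kappa α w₀ (cw ++ wo) w' = kappa α w₀ (cw ++ wo) w from hw']
        exact hκ w'
      · rintro _ rfl
        rfl
  · exact hI.1.isSingletonFacet_of_rootConfig H w.2 h
  · rw [← polarCone_image, and_self]
    exact hI.isSingletonFacet_iff_brickCone H w.2
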